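/- Let $L>0$, $m>0$, $2<p<6$, let $\mathbb T$ be the circle of circumference $L$ and $\Omega=C(\mathbb T;\mathbb C)$. For $\phi\in\Omega$ put $N(\phi)=\|\phi\|_2^2$ and $X_k(\phi)=\langle u_k,\phi\rangle_{L^2}$, $u_k(x)=L^{-1/2}e^{2\pi i kx/L}$ ($k\in\mathbb Z$). For $\beta>0$ let $\mu_\beta$ be the centred Gaussian measure on $\Omega$ with covariance $\beta^{-1}(m^2-\Delta)^{-1}$, i.e. the Borel measure under which the $X_k$ are independent and $X_k$ has density $\frac{\theta_k}{2\pi}e^{-\theta_k|z|^2/2}$ on $\mathbb C$, where $\theta_k=\beta((2\pi k/L)^2+m^2)$; it is a probability measure. **(Grand-canonical ensemble.)** Let $0<\alpha<\tfrac12$ with $p<4\alpha+4$, and let $r>\frac{2\alpha p+2}{4\alpha+4-p}$ (such an $\alpha$ exists if and only if $r>\frac{p+2}{6-p}$). For $\beta>0$ and $\kappa,\lambda\in\mathbb C$ let $$Z(\kappa,\beta,\lambda)=\int_\Omega\exp\Big[\beta\Big(\tfrac{\lambda}{p}\|\phi\|_p^p+\tfrac{m^2}{2}\|\phi\|_2^2-\tfrac{\kappa}{r}\|\phi\|_2^{2r}\Big)\Big]d\mu_\beta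 ,$$ and for complex $\beta$ let $$Z(\kappa,\beta,\lambda)=\int_\Omega\exp\Big[\tfrac{\lambda\beta^{1-p/2}}{p}\|\psi\|_p^p+\tfrac{m^2}{2}\|\psi\|_2^2-\tfrac{\beta^{1-r}\kappa}{r}\|\psi\|_2^{2r}\Big]d\mu_1$$ (principal powers). The two expressions agree for all $\beta>0$ and $\kappa,\lambda\in\mathbb C$. Moreover there is a domain (a connected open set) $D\subset\mathbb C^3$, contained in $\{\Re\beta>0,\ \Re(\beta^{1-r}\kappa)>0\}$, such that * for all real $k_0>0$, $\beta_0>0$, $\lambda_0$ there is $\varepsilon>0$ such that $D$ contains every $(\kappa,\beta,\lambda)$ with $\Re\kappa=k_0$, $\Re\beta=\beta_0$, $\Re\lambda=\lambda_0$ and $|\Im\kappa|,|\Im\beta|,|\Im\lambda|<\varepsilon$; * on $D$ the integrand defining $Z(\kappa,\beta,\lambda)$ is integrable and $Z(\kappa,\beta,\lambda)\notin(-\infty,0]$; * the generalized pressure $\log Z(\kappa,\beta,\lambda)$ (principal branch) is analytic in $(\kappa,\beta,\lambda)$ on $D$. **(Canonical ensemble.)** For $t\in[-\pi,\pi]$ let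 $K_\ell(t)=\frac1\ell\sum_{k=0}^{\ell-1}\sum_{j=-k}^{k}e^{ijt}$ be the Fejér kernel, and let $K_\ell(t)=0$ for $|t|>\pi$. For all $n>0$ and $\beta>0$ the law $\nu_{n,\beta}$ of $\phi$ under $\mu_\beta$ conditioned on $N(\phi)=n$ exists, in the sense that the probability measures proportional to $K_\ell(n-N(\phi))\,d\mu_\beta$ converge weakly, as $\ell\to\infty$, to a probability measure $\nu_{n,\beta}$ on $\Omega$. For $\beta>0$ and $\lambda\in\mathbb C$ let $$\widetilde Z(n,\beta,\lambda)=e^{\frac\beta2m^2n}\int_\Omega \exp\Big[\beta\tfrac{\lambda}{p}\|\phi\|_p^p\Big]d\nu_{n,\beta},$$ and for $k>0$ and complex $\beta$ let $$\widetilde Z(\beta^{-1}k,\beta,\lambda)=e^{\frac12m^2k}\int_\Omega\exp\Big[\beta^{1-p/2}\tfrac{\lambda}{p}\|\psi\|_p^p\Big]d\nu_{k,1}.$$ For every $k>0$ the two expressions agree for $\beta>0$ and $\lambda\in\mathbb C$ (with $n=\beta^{-1}k$), and there is a domain $D_k\subset\{\Re\beta>0\}\subset\mathbb C^2$ such that *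 for all real $\beta_0>0$ and $\lambda_0$ there is $\varepsilon>0$ such that $D_k$ contains every $(\beta,\lambda)$ with $\Re\beta=\beta_0$, $\Re\lambda=\lambda_0$ and $|\Im\beta|,|\Im\lambda|<\varepsilon$; * on $D_k$ the integrand defining $\widetilde Z(\beta^{-1}k,\beta,\lambda)$ is integrable and $\widetilde Z(\beta^{-1}k,\beta,\lambda)\notin(-\infty,0]$; * the generalized free energy $\log\widetilde Z(\beta^{-1}k,\beta,\lambda)$ (principal branch) is analytic in $(\beta,\lambda)$ on $D_k$. -/

import Mathlib

open MeasureTheory ProbabilityTheory Filter Topology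

namespace NLSGibbs

noncomputable section

/-- The path space `Ω`: continuous complex-valued functions on the circle of circumference `L`. -/
abbrev PathSpace (L : ℝ) : Type := C(AddCircle L, ℂ)

/-- `Ω` carries the Borel `σ`-algebra of the topology of uniform convergence. -/
instance instMeasurableSpacePathSpace (L : ℝ) : MeasurableSpace (PathSpace L) := borel _

instance instBorelSpacePathSpace (L : ℝ) : BorelSpace (PathSpace L) := ⟨rfl⟩

/-- `u_k(x) = L^{-1/2} e^{2π i k x / L}`. -/
def mode (L : ℝ) (k : ℤ) (x : AddCircle L) : ℂ := ((√L : ℝ) : ℂ)⁻¹ * fourier k x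

/-- `X_k(φ) = ⟨u_k, φ⟩`, the inner product of `L²(𝕋)`, linear in the second slot; the circle
carries Lebesgue measure of total mass `L`. -/
def coeff (L : ℝ) [Fact (0 < L)] (φ : PathSpace L) (k : ℤ) : ℂ :=
  ∫ x, (starRingEnd ℂ) (mode L k x) * φ x

/-- `N(φ) = ‖φ‖₂²`. -/
def sqNorm (L : ℝ) [Fact (0 < L)] (φ : PathSpace L) : ℝ := ∫ x, ‖φ x‖ ^ 2

/-- `‖φ‖_p^p`. -/
def pNormPow (L : ℝ) [Fact (0 < L)] (p : ℝ) (φ : PathSpace L) : ℝ := ∫ x, ‖φ x‖ ^ p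

/-- `θ_k = β ((2πk/L)² + m²)`, the eigenvalue of `β (m² - Δ)` at `u_k`. -/
def theta (L m β : ℝ) (k : ℤ) : ℝ := β * ((2 * Real.pi * k / L) ^ 2 + m ^ 2)

/-- The law on `ℂ` whose real and imaginary parts are independent centred Gaussians of variance
`1/θ`, i.e. the law with density `(θ/2π) exp(-θ |z|²/2)` on the plane (for `θ > 0`). -/
def planeGaussian (θ : ℝ) : Measure ℂ :=
  ((gaussianReal 0 (Real.toNNReal θ⁻¹)).prod (gaussianReal 0 (Real.toNNReal θ⁻¹))).map
    Complex.measurableEquivRealProd.symm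

instance instIsProbabilityMeasurePlaneGaussian (θ : ℝ) :
    IsProbabilityMeasure (planeGaussian θ) :=
  Measure.isProbabilityMeasure_map Complex.measurableEquivRealProd.symm.measurable.aemeasurable

/-- The joint law of the coefficients `(X_k)`: independent, `X_k` with law `planeGaussian θ_k`. -/
def coeffLaw (L m β : ℝ) : Measure (ℤ → ℂ) :=
  Measure.infinitePi fun k => planeGaussian (theta L m β k)

/-- The centred Gaussian measure `μ_β` on `Ω` with covariance `β⁻¹ (m² - Δ)⁻¹`: the law on `Ω`
under which the coefficients `X_k` are independent with laws `planeGaussian θ_k`. A continuous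
function is determined by its coefficients, so `μ_β A` is the `coeffLaw`-mass of the set of
coefficient sequences of the members of `A`. -/
def gaussMeasure (L m : ℝ) [Fact (0 < L)] (β : ℝ) : Measure (PathSpace L) :=
  (coeffLaw L m β).comap (coeff L)

/-- The Fejér kernel `K_ℓ(t) = ℓ⁻¹ ∑_{k<ℓ} ∑_{|j| ≤ k} e^{ijt}` on `[-π, π]` (the imaginary parts
cancel), extended by `0` to the real line. -/
def fejer (n : ℕ) (t : ℝ) : ℝ :=
  if |t| ≤ Real.pi then
    (1 / n : ℝ) * ∑ k ∈ Finset.range n, ∑ j ∈ Finset.Icc (-(k : ℤ)) k, Real.cos (j * t)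
  else 0

/-- The measure `K_ℓ(n - N(φ)) dμ_β`, normalized to a probability measure. -/
def fejerMeasure (L m : ℝ) [Fact (0 < L)] (n β : ℝ) (l : ℕ) : Measure (PathSpace L) :=
  (∫⁻ φ, ENNReal.ofReal (fejer l (n - sqNorm L φ)) ∂gaussMeasure L m β)⁻¹ •
    (gaussMeasure L m β).withDensity fun φ => ENNReal.ofReal (fejer l (n - sqNorm L φ))

/-- `ν` is the law of `φ` under `μ_β` conditioned on `N(φ) = n`: the probability measure that is
the weak limit of the measures `fejerMeasure L m n β l` as `l → ∞`. -/
def IsConditionalLaw (L m : ℝ) [Fact (0 < L)] (n β : ℝ) (ν : Measure (PathSpace L)) : Prop :=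
  IsProbabilityMeasure ν ∧
    ∀ f : BoundedContinuousFunction (PathSpace L) ℝ,
      Tendsto (fun l : ℕ => ∫ φ, f φ ∂fejerMeasure L m n β l) atTop (𝓝 (∫ φ, f φ ∂ν))

open Classical in
/-- `ν_{n,β}`, the weak limit of `fejerMeasure L m n β l` as `l → ∞` (`0` if there is none). -/
def condMeasure (L m : ℝ) [Fact (0 < L)] (n β : ℝ) : Measure (PathSpace L) :=
  if h : ∃ ν, IsConditionalLaw L m n β ν then h.choose else 0

/-- The generalized grand-canonical partition function at a real inverse temperature `β`:
`∫ exp[β(λ/p ‖φ‖_p^p + m²/2 ‖φ‖₂² - κ/r ‖φ‖₂^{2r})] dμ_β`. -/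
def grandZReal (L m : ℝ) [Fact (0 < L)] (p r : ℝ) (κ : ℂ) (β : ℝ) (lam : ℂ) : ℂ :=
  ∫ φ, Complex.exp (β * (lam / p * pNormPow L p φ + m ^ 2 / 2 * sqNorm L φ
    - κ / r * ((sqNorm L φ ^ r : ℝ) : ℂ))) ∂gaussMeasure L m β

/-- `exp[λ β^{1-p/2}/p ‖ψ‖_p^p + m²/2 ‖ψ‖₂² - β^{1-r} κ/r ‖ψ‖₂^{2r}]`, for complex parameters;
the powers of `β` are principal ones. -/
def grandIntegrand (L m : ℝ) [Fact (0 < L)] (p r : ℝ) (κ β lam : ℂ) (ψ : PathSpace L) : ℂ :=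
  Complex.exp (lam * β ^ (1 - p / 2 : ℂ) / p * pNormPow L p ψ + m ^ 2 / 2 * sqNorm L ψ
    - β ^ (1 - r : ℂ) * κ / r * ((sqNorm L ψ ^ r : ℝ) : ℂ))

/-- The generalized grand-canonical partition function `Z(κ, β, λ)` for complex parameters. -/
def grandZ (L m : ℝ) [Fact (0 < L)] (p r : ℝ) (κ β lam : ℂ) : ℂ :=
  ∫ ψ, grandIntegrand L m p r κ β lam ψ ∂gaussMeasure L m 1

/-- The canonical partition function at particle number `n` and real inverse temperature `β`:
`e^{β m² n / 2} ∫ exp[β λ/p ‖φ‖_p^p] dν_{n,β}`. -/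
def canonZReal (L m : ℝ) [Fact (0 < L)] (p : ℝ) (n β : ℝ) (lam : ℂ) : ℂ :=
  Complex.exp (β / 2 * m ^ 2 * n) *
    ∫ φ, Complex.exp (β * (lam / p * pNormPow L p φ)) ∂condMeasure L m n β

/-- `exp[β^{1-p/2} λ/p ‖ψ‖_p^p]`, for complex parameters; the power of `β` is the principal one. -/
def canonIntegrand (L : ℝ) [Fact (0 < L)] (p : ℝ) (β lam : ℂ) (ψ : PathSpace L) : ℂ :=
  Complex.exp (β ^ (1 - p / 2 : ℂ) * lam / p * pNormPow L p ψ)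

/-- The canonical partition function `Z̃(β⁻¹k, β, λ)` for complex `β` and `λ`. -/
def canonZ (L m : ℝ) [Fact (0 < L)] (p k : ℝ) (β lam : ℂ) : ℂ :=
  Complex.exp (m ^ 2 * k / 2) * ∫ ψ, canonIntegrand L p β lam ψ ∂condMeasure L m k 1

end

end NLSGibbs

/-! The map `φ ↦ β^{-1/2} φ` carries the Gaussian measure at inverse temperature 1 to the one at
`β`, and the conditional law at particle number `k` to the one at `β⁻¹ k`. Both partition functions
thus become integrals against a measure independent of `β`, with the parameters entering only
through coupling constants that are holomorphic for `Re β > 0`. An integral of `exp (l x)`, with `l`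
a random linear functional, is analytic wherever it converges absolutely with room `exp (R ‖l‖)` to
spare (`analyticAt_integral_exp`). At real parameters the integrals are positive. Hence the open set
on which the partition function is analytic and avoids `(-∞, 0]` contains the connected set of real
parameters, and the connected component through them is the required domain (`exists_domain`).

What has to be proved is exponential integrability of the interaction. The random Fourier series is
cut into dyadic blocks. At a point, block `j` is Gaussian with variance of order `2^{-j}`, so a
multiple of `2^j` times its square has a bounded exponential moment. For trigonometric polynomials
of degree about `2^j`, a pointwise exponential is bounded by about `2^j` times an average over the
circle. A single functional `expSum` of finite mean therefore controls every block: with `w = log (1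
+ expSum)`, the block is bounded by a multiple of `(2^{-j} (1 + j) (1 + w))^{1/2}`. Summing the
blocks shows that almost every coefficient sequence comes from a continuous function, so the
Gaussian measure has mass one. The deterministic bound `2^j N` on the squared block gives, by
interpolation, `‖φ‖_∞² ≤ C N^s (1 + w)^{1-s}` for every `0 ≤ s < 1/2`. Then `‖φ‖_p^p ≤ ‖φ‖_∞^{p-2}
N` and Young's inequality give `A ‖φ‖_p^p ≤ 1 + w + C N^e`, with `e` the threshold exponent in the
hypothesis on `r` (`exists_mul_pNormPow_le`). The first two terms have a finite exponential moment,
and the last is absorbed by the cutoff `N^r` with `r > e`, or is constant once `N` is fixed.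

For the conditional law, the zero mode is written in polar form: `N = T + s`, where `T` comes from
the other modes and `s` is an independent exponential variable. Fejér kernels are an approximate
identity in `s`, so the limit puts `s = n - T` and weights the result by the exponential density
there. This `condLaw` is a probability measure because `N < n` has positive probability. It inherits
the integrability because changing the zero mode only alters block 0. -/

namespace NLSGibbs

noncomputable section

set_option linter.unusedSectionVars false

/-! ### Fourier coefficients of paths, Parseval, continuity of the functionals. -/

section Fourier

variable {L : ℝ} [hL : Fact (0 < L)]

/-- `u_k` as an element of the path space. -/
def modeC (L : ℝ) (k : ℤ) : PathSpace L := ((√L : ℝ) : ℂ)⁻¹ • fourier k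

lemma modeC_apply (k : ℤ) (x : AddCircle L) : modeC L k x = mode L k x := by
  simp [modeC, mode]

lemma norm_mode_sq (k : ℤ) (x : AddCircle L) : ‖mode L k x‖ ^ 2 = L⁻¹ := by
  have : ‖fourier k x‖ = 1 := by rw [fourier_apply]; exact Circle.norm_coe _
  rw [mode, norm_mul, this, mul_one, norm_inv, Complex.norm_real, inv_pow, Real.norm_eq_abs, sq_abs,
    Real.sq_sqrt hL.out.le]

lemma norm_mode (k : ℤ) (x : AddCircle L) : ‖mode L k x‖ = (√L)⁻¹ := by
  rw [← Real.sqrt_inv, ← norm_mode_sq k x, Real.sqrt_sq (norm_nonneg _)]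

lemma integrable_of_path {E : Type*} [NormedAddCommGroup E] {f : AddCircle L → E}
    (hf : Continuous f) : Integrable f :=
  hf.integrable_of_hasCompactSupport (HasCompactSupport.of_compactSpace f)

lemma coeff_eq_fourierCoeff (φ : PathSpace L) (k : ℤ) :
    coeff L φ k = (√L : ℝ) * fourierCoeff φ k := by
  have h0 : (0 : ℝ) < √L := Real.sqrt_pos.2 hL.out
  have h1 : ((√L : ℝ) : ℂ) ≠ 0 := by exact_mod_cast h0.ne'
  have h2 : ((√L : ℝ) : ℂ) * (√L : ℝ) = L := by
    rw [← Complex.ofReal_mul, Real.mul_self_sqrt hL.out.le]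
  rw [coeff, AddCircle.volume_eq_smul_haarAddCircle, integral_smul_measure, fourierCoeff]
  simp only [mode, map_mul, map_inv₀, Complex.conj_ofReal, mul_assoc, smul_eq_mul]
  rw [integral_const_mul, ENNReal.toReal_ofReal hL.out.le, Complex.real_smul]
  simp only [← fourier_neg]
  rw [← h2]
  field_simp

lemma norm_coeff_le (φ : PathSpace L) (k : ℤ) : ‖coeff L φ k‖ ≤ √L * ‖φ‖ := by
  rw [coeff]
  refine (norm_integral_le_of_norm_le_const (C := (√L)⁻¹ * ‖φ‖) ?_).trans ?_
  · refine Eventually.of_forall fun x => ?_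
    rw [norm_mul, RCLike.norm_conj, norm_mode]
    gcongr
    exact φ.norm_coe_le_norm x
  · have h0 : (0 : ℝ) < √L := Real.sqrt_pos.2 hL.out
    have h1 : (√L)⁻¹ * L = √L := by
      rw [inv_mul_eq_iff_eq_mul₀ h0.ne', Real.mul_self_sqrt hL.out.le]
    rw [measureReal_def, AddCircle.measure_univ, ENNReal.toReal_ofReal hL.out.le, mul_right_comm,
      h1]

lemma continuous_conj_mode_mul (φ : PathSpace L) (k : ℤ) :
    Continuous fun x => (starRingEnd ℂ) (mode L k x) * φ x := by
  simp only [← modeC_apply]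
  fun_prop

/-- `X_k` as a continuous linear functional. -/
def coeffCLM (L : ℝ) [Fact (0 < L)] (k : ℤ) : PathSpace L →L[ℂ] ℂ :=
  LinearMap.mkContinuous
    { toFun := fun φ => coeff L φ k
      map_add' := fun φ ψ => by
        simp only [coeff, ContinuousMap.add_apply, mul_add]
        exact integral_add (integrable_of_path (continuous_conj_mode_mul φ k))
          (integrable_of_path (continuous_conj_mode_mul ψ k))
      map_smul' := fun c φ => by
        simp only [coeff, ContinuousMap.smul_apply, smul_eq_mul, RingHom.id_apply, mul_left_comm _ c]
        exact integral_const_mul _ _ }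
    (√L) (fun φ => norm_coeff_le φ k)

lemma coeffCLM_apply (φ : PathSpace L) (k : ℤ) : coeffCLM L k φ = coeff L φ k := rfl

lemma coeff_modeC (k j : ℤ) : coeff L (modeC L k) j = if j = k then 1 else 0 := by
  have h1 : ((√L : ℝ) : ℂ) ≠ 0 := by exact_mod_cast (Real.sqrt_pos.2 hL.out).ne'
  rw [modeC, ← coeffCLM_apply, map_smul, coeffCLM_apply, coeff_eq_fourierCoeff,
    fourierCoeff_fourier]
  by_cases h : j = k
  · subst h; simp [h1]
  · simp [h]

/-- Parseval for the normalized Haar measure, rescaled by the total mass `L` of the circle. -/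
lemma hasSum_sqNorm (φ : PathSpace L) :
    HasSum (fun k => ‖coeff L φ k‖ ^ 2) (sqNorm L φ) := by
  have h := hasSum_sq_fourierCoeff (ContinuousMap.toLp 2 AddCircle.haarAddCircle ℂ φ)
  have e : ∀ᵐ x ∂(@AddCircle.haarAddCircle L _),
      (ContinuousMap.toLp 2 AddCircle.haarAddCircle ℂ φ : AddCircle L → ℂ) x = φ x :=
    ContinuousMap.coeFn_toLp _ φ
  have e2 : ∫ x, ‖(ContinuousMap.toLp 2 AddCircle.haarAddCircle ℂ φ : AddCircle L → ℂ) x‖ ^ 2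
      ∂(@AddCircle.haarAddCircle L _) = ∫ x, ‖φ x‖ ^ 2 ∂(@AddCircle.haarAddCircle L _) :=
    integral_congr_ae (e.mono fun x hx => by simp only [hx])
  rw [e2] at h
  simp only [fourierCoeff_toLp] at h
  have h3 := h.mul_left L
  have e3 : sqNorm L φ = L * ∫ x, ‖φ x‖ ^ 2 ∂(@AddCircle.haarAddCircle L _) := by
    rw [sqNorm, AddCircle.volume_eq_smul_haarAddCircle, integral_smul_measure,
      ENNReal.toReal_ofReal hL.out.le, smul_eq_mul]
  have e4 : (fun k => ‖coeff L φ k‖ ^ 2) = fun k => L * ‖fourierCoeff φ k‖ ^ 2 := by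
    funext k
    rw [coeff_eq_fourierCoeff, norm_mul, mul_pow, Complex.norm_real, Real.norm_eq_abs, sq_abs,
      Real.sq_sqrt hL.out.le]
  rw [e3, e4]
  exact h3

lemma sqNorm_nonneg (φ : PathSpace L) : 0 ≤ sqNorm L φ :=
  integral_nonneg fun _ => by positivity

lemma eq_zero_of_sqNorm_eq_zero {φ : PathSpace L} (h : sqNorm L φ = 0) : φ = 0 := by
  have hc : Continuous fun x => ‖φ x‖ ^ 2 := by fun_prop
  rw [sqNorm, integral_eq_zero_iff_of_nonneg (fun _ => by positivity) (integrable_of_path hc)] at h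
  have := (Continuous.ae_eq_iff_eq _ hc continuous_zero).1 h
  ext x
  simpa using congr_fun this x

lemma coeff_injective : Function.Injective (coeff L) := by
  intro φ ψ h
  have h0 : sqNorm L (φ - ψ) = 0 := by
    refine (hasSum_sqNorm (φ - ψ)).unique ?_
    convert hasSum_zero using 2 with k
    rw [← coeffCLM_apply, map_sub, coeffCLM_apply, coeffCLM_apply, h]
    simp
  exact sub_eq_zero.1 (eq_zero_of_sqNorm_eq_zero h0)

lemma continuous_coeff : Continuous (coeff L) :=
  continuous_pi fun k => (coeffCLM L k).continuous

/-- Lusin–Souslin: continuous injections out of a Polish space send Borel sets to Borel sets. This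
makes the `comap` in `gaussMeasure` a genuine pullback. -/
lemma measurableEmbedding_coeff : MeasurableEmbedding (coeff L) :=
  continuous_coeff.measurableEmbedding coeff_injective

lemma continuous_integral_path :
    Continuous fun f : C(AddCircle L, ℝ) => ∫ x, f x := by
  have : LipschitzWith (Real.toNNReal L) fun f : C(AddCircle L, ℝ) => ∫ x, f x := by
    refine LipschitzWith.of_dist_le_mul fun f g => ?_
    rw [dist_eq_norm, ← integral_sub (integrable_of_path f.continuous)
      (integrable_of_path g.continuous)]
    refine (norm_integral_le_of_norm_le_const (C := dist f g) ?_).trans ?_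
    · exact Eventually.of_forall fun x => by
        rw [← dist_eq_norm]; exact ContinuousMap.dist_apply_le_dist x
    · rw [measureReal_def, AddCircle.measure_univ, mul_comm]; rfl
  exact this.continuous

lemma continuous_sqNorm : Continuous (sqNorm L) := by
  have h : Continuous fun φ : PathSpace L =>
      ContinuousMap.comp (⟨fun z : ℂ => ‖z‖ ^ 2, by fun_prop⟩ : C(ℂ, ℝ)) φ :=
    ContinuousMap.continuous_postcomp _
  exact continuous_integral_path.comp h

lemma continuous_norm_rpow {p : ℝ} (hp : 0 ≤ p) : Continuous fun z : ℂ => ‖z‖ ^ p :=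
  continuous_norm.rpow_const fun _ => Or.inr hp

lemma continuous_pNormPow {p : ℝ} (hp : 0 ≤ p) : Continuous (pNormPow L p) := by
  have h : Continuous fun φ : PathSpace L =>
      ContinuousMap.comp (⟨fun z : ℂ => ‖z‖ ^ p, continuous_norm_rpow hp⟩ : C(ℂ, ℝ)) φ :=
    ContinuousMap.continuous_postcomp _
  exact continuous_integral_path.comp h

lemma pNormPow_nonneg (p : ℝ) (φ : PathSpace L) : 0 ≤ pNormPow L p φ :=
  integral_nonneg fun _ => by positivity

end Fourier

/-! ### Planar Gaussians: polar decomposition, moments, scaling. -/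

section PlaneGaussian

lemma planeGaussian_eq_withDensity {θ : ℝ} (hθ : 0 < θ) :
    planeGaussian θ = volume.withDensity fun z : ℂ =>
      ENNReal.ofReal (θ / (2 * Real.pi) * Real.exp (-(θ * ‖z‖ ^ 2 / 2))) := by
  have hv : Real.toNNReal θ⁻¹ ≠ 0 := by simpa using hθ
  have hpi := Real.pi_pos
  refine Measure.ext_of_lintegral _ fun f hf => ?_
  rw [planeGaussian, lintegral_map hf Complex.measurableEquivRealProd.symm.measurable,
    gaussianReal_of_var_ne_zero _ hv, prod_withDensity (measurable_gaussianPDF _ _)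
      (measurable_gaussianPDF _ _), lintegral_withDensity_eq_lintegral_mul _ (by fun_prop)
      (g := fun q => f (Complex.measurableEquivRealProd.symm q))
      (hf.comp Complex.measurableEquivRealProd.symm.measurable),
    lintegral_withDensity_eq_lintegral_mul _ (by fun_prop) hf,
    ← (Complex.volume_preserving_equiv_real_prod.symm).lintegral_comp_emb
      Complex.measurableEquivRealProd.symm.measurableEmbedding]
  refine lintegral_congr fun q => ?_
  simp only [Pi.mul_apply]
  congr 1
  rw [gaussianPDF, gaussianPDF, ← ENNReal.ofReal_mul (gaussianPDFReal_nonneg _ _ _)]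
  congr 1
  have h1 : ‖Complex.measurableEquivRealProd.symm q‖ ^ 2 = q.1 ^ 2 + q.2 ^ 2 := by
    rw [Complex.sq_norm, Complex.normSq_apply, Complex.measurableEquivRealProd_symm_apply]
    ring
  rw [h1, gaussianPDFReal, gaussianPDFReal, Real.coe_toNNReal _ (by positivity), mul_mul_mul_comm,
    ← Real.exp_add, ← mul_inv, Real.mul_self_sqrt (by positivity)]
  congr 1
  · field_simp
  · congr 1
    field_simp
    ring

/-- The point of the plane with squared modulus `s` and argument `ω`. -/
def radialPoint (s ω : ℝ) : ℂ := √s * (Real.cos ω + Real.sin ω * Complex.I)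

lemma norm_cos_add_sin (ω : ℝ) : ‖(Real.cos ω + Real.sin ω * Complex.I : ℂ)‖ = 1 := by
  rw [Complex.ofReal_cos, Complex.ofReal_sin, ← Complex.exp_mul_I, Complex.norm_exp_ofReal_mul_I]

lemma norm_radialPoint_sq {s : ℝ} (hs : 0 ≤ s) (ω : ℝ) : ‖radialPoint s ω‖ ^ 2 = s := by
  rw [radialPoint, norm_mul, norm_cos_add_sin, mul_one, Complex.norm_real, Real.norm_eq_abs, sq_abs,
    Real.sq_sqrt hs]

lemma continuous_radialPoint : Continuous fun q : ℝ × ℝ => radialPoint q.1 q.2 := by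
  unfold radialPoint
  fun_prop

/-- The law of the squared modulus under `planeGaussian θ`. -/
def expLaw (θ : ℝ) : Measure ℝ :=
  (volume.restrict (Set.Ioi 0)).withDensity fun s => ENNReal.ofReal (θ / 2 * Real.exp (-(θ * s / 2)))

/-- The uniform law on the interval `(-π, π)`. -/
def angLaw : Measure ℝ :=
  (ENNReal.ofReal (2 * Real.pi))⁻¹ • volume.restrict (Set.Ioo (-Real.pi) Real.pi)

instance instIsProbabilityMeasureAngLaw : IsProbabilityMeasure angLaw := by
  constructor
  have hpi := Real.pi_pos
  rw [angLaw, Measure.smul_apply, Measure.restrict_apply_univ, Real.volume_Ioo, smul_eq_mul,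
    show Real.pi - -Real.pi = 2 * Real.pi by ring]
  exact ENNReal.inv_mul_cancel (by simpa using hpi) ENNReal.ofReal_ne_top

instance instSFiniteExpLaw (θ : ℝ) : SFinite (expLaw θ) := by unfold expLaw; infer_instance

lemma setLIntegral_Ioi_comp_sq (g : ℝ → ENNReal) :
    ∫⁻ s in Set.Ioi 0, g s = ∫⁻ r in Set.Ioi (0 : ℝ), ENNReal.ofReal (2 * r) * g (r ^ 2) := by
  have h := lintegral_image_eq_lintegral_abs_deriv_mul (s := Set.Ioi (0 : ℝ)) (f := fun r => r ^ 2)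
    (f' := fun r => 2 * r) measurableSet_Ioi
    (fun x _ => by simpa using (hasDerivAt_pow 2 x).hasDerivWithinAt)
    (fun x hx y hy hxy => by
      exact (pow_left_inj₀ (le_of_lt hx) (le_of_lt hy) two_ne_zero).1 hxy) g
  have himg : (fun r : ℝ => r ^ 2) '' Set.Ioi 0 = Set.Ioi 0 := by
    ext y
    constructor
    · rintro ⟨x, hx, rfl⟩
      have hx' : (0 : ℝ) < x := hx
      exact pow_pos hx' 2
    · intro hy
      exact ⟨√y, Real.sqrt_pos.2 hy, Real.sq_sqrt (le_of_lt hy)⟩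
  rw [himg] at h
  rw [h]
  refine setLIntegral_congr_fun measurableSet_Ioi fun x hx => ?_
  have hx' : (0 : ℝ) < x := hx
  simp only [abs_of_pos (show (0 : ℝ) < 2 * x by positivity)]

/-- Polar coordinates followed by `s = r²`: the Jacobian `r dr` becomes `ds / 2`, so the squared
modulus is exponential and independent of a uniform angle. The conditional law is built on this
splitting. -/
lemma planeGaussian_eq_map_polar {θ : ℝ} (hθ : 0 < θ) :
    planeGaussian θ = ((expLaw θ).prod angLaw).map fun q => radialPoint q.1 q.2 := by
  have hpi := Real.pi_pos
  refine Measure.ext_of_lintegral _ fun f hf => ?_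
  have hm : Measurable fun q : ℝ × ℝ => f (radialPoint q.1 q.2) :=
    hf.comp continuous_radialPoint.measurable
  have hm1 : Measurable fun s : ℝ => ∫⁻ ω in Set.Ioo (-Real.pi) Real.pi, f (radialPoint s ω) :=
    hm.lintegral_prod_right'
  rw [lintegral_map hf continuous_radialPoint.measurable, lintegral_prod _ hm.aemeasurable, expLaw,
    angLaw]
  simp only [lintegral_smul_measure, smul_eq_mul]
  rw [lintegral_withDensity_eq_lintegral_mul _ (by fun_prop) (hm1.const_mul _)]
  simp only [Pi.mul_apply]
  rw [setLIntegral_Ioi_comp_sq, planeGaussian_eq_withDensity hθ,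
    lintegral_withDensity_eq_lintegral_mul _ (by fun_prop) hf,
    ← Complex.lintegral_comp_polarCoord_symm, polarCoord_target, Measure.volume_eq_prod,
    ← Measure.prod_restrict, lintegral_prod]
  · refine setLIntegral_congr_fun measurableSet_Ioi fun r hr => ?_
    have hr : (0 : ℝ) < r := hr
    simp only [Pi.mul_apply, smul_eq_mul]
    rw [← mul_assoc, ← mul_assoc, ← lintegral_const_mul _ (by
      exact (hm.comp (measurable_prodMk_left (x := r ^ 2))))]
    refine lintegral_congr fun ω => ?_
    have e1 : Complex.polarCoord.symm (r, ω) = radialPoint (r ^ 2) ω := by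
      rw [Complex.polarCoord_symm_apply, radialPoint, Real.sqrt_sq hr.le]
    rw [e1, norm_radialPoint_sq (by positivity), ← mul_assoc]
    congr 1
    rw [← ENNReal.ofReal_inv_of_pos (by positivity), ← ENNReal.ofReal_mul (by positivity),
      ← ENNReal.ofReal_mul (by positivity), ← ENNReal.ofReal_mul (by positivity)]
    congr 1
    field_simp
  · have hms : Measurable fun p : ℝ × ℝ => Complex.polarCoord.symm p := by
      simp only [Complex.polarCoord_symm_apply]
      fun_prop
    have hd : Measurable fun z : ℂ =>
        ENNReal.ofReal (θ / (2 * Real.pi) * Real.exp (-(θ * ‖z‖ ^ 2 / 2))) * f z :=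
      Measurable.mul (by fun_prop) hf
    have hr : Measurable fun p : ℝ × ℝ => ENNReal.ofReal p.1 := by fun_prop
    exact (hr.mul (hd.comp hms)).aemeasurable

lemma lintegral_exp_neg_Ioi {a : ℝ} (ha : 0 < a) :
    ∫⁻ s in Set.Ioi (0 : ℝ), ENNReal.ofReal (Real.exp (-(a * s))) = ENNReal.ofReal a⁻¹ := by
  have h : IntegrableOn (fun s : ℝ => Real.exp (-a * s)) (Set.Ioi 0) :=
    integrableOn_exp_mul_Ioi (by linarith) 0
  have h2 := integral_exp_mul_Ioi (a := -a) (by linarith) 0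
  simp only [← neg_mul]
  rw [← ofReal_integral_eq_lintegral_ofReal h (Eventually.of_forall fun _ => by positivity), h2]
  congr 1
  simp

/-- A function of the squared modulus is integrated against the exponential law. -/
lemma lintegral_planeGaussian_radial {θ : ℝ} (hθ : 0 < θ) {f : ℝ → ENNReal} (hf : Measurable f) :
    ∫⁻ z, f (‖z‖ ^ 2) ∂planeGaussian θ =
      ∫⁻ s in Set.Ioi (0 : ℝ), ENNReal.ofReal (θ / 2 * Real.exp (-(θ * s / 2))) * f s := by
  have hm : Measurable fun q : ℝ × ℝ => f (‖radialPoint q.1 q.2‖ ^ 2) :=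
    Measurable.comp (g := fun z : ℂ => f (‖z‖ ^ 2)) (by fun_prop) continuous_radialPoint.measurable
  rw [planeGaussian_eq_map_polar hθ, lintegral_map (f := fun z : ℂ => f (‖z‖ ^ 2)) (by fun_prop) continuous_radialPoint.measurable,
    lintegral_prod _ hm.aemeasurable, expLaw]
  rw [lintegral_withDensity_eq_lintegral_mul _ (by fun_prop) hm.lintegral_prod_right']
  refine setLIntegral_congr_fun measurableSet_Ioi fun r hr => ?_
  simp only [Pi.mul_apply, norm_radialPoint_sq (le_of_lt hr)]
  simp

/-- Exponential moments of the squared modulus. -/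
lemma lintegral_planeGaussian_exp_sq {θ c : ℝ} (hθ : 0 < θ) (hc : c < θ / 2) :
    ∫⁻ z, ENNReal.ofReal (Real.exp (c * ‖z‖ ^ 2)) ∂planeGaussian θ =
      ENNReal.ofReal (θ / 2 * (θ / 2 - c)⁻¹) := by
  rw [lintegral_planeGaussian_radial hθ (f := fun s => ENNReal.ofReal (Real.exp (c * s)))
    (by fun_prop), ENNReal.ofReal_mul (by positivity), ← lintegral_exp_neg_Ioi (by linarith),
    ← lintegral_const_mul _ (by fun_prop)]
  refine lintegral_congr fun s => ?_
  rw [← ENNReal.ofReal_mul (by positivity), ← ENNReal.ofReal_mul (by positivity), mul_assoc,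
    ← Real.exp_add]
  congr 3
  ring

/-- The second moment is finite, with an explicit bound of order `θ⁻¹`. -/
lemma lintegral_planeGaussian_sq_le {θ : ℝ} (hθ : 0 < θ) :
    ∫⁻ z, ENNReal.ofReal (‖z‖ ^ 2) ∂planeGaussian θ ≤ ENNReal.ofReal (8 * θ⁻¹) := by
  calc ∫⁻ z, ENNReal.ofReal (‖z‖ ^ 2) ∂planeGaussian θ
      ≤ ∫⁻ z, ENNReal.ofReal (4 * θ⁻¹) * ENNReal.ofReal (Real.exp (θ / 4 * ‖z‖ ^ 2))
          ∂planeGaussian θ := by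
        refine lintegral_mono fun z => ?_
        rw [← ENNReal.ofReal_mul (by positivity)]
        refine ENNReal.ofReal_le_ofReal ?_
        -- The elementary `x ≤ exp x` trades the second moment for an exponential one at half the
        -- critical rate, where it equals 2.
        have := Real.add_one_le_exp (θ / 4 * ‖z‖ ^ 2)
        calc ‖z‖ ^ 2 = 4 * θ⁻¹ * (θ / 4 * ‖z‖ ^ 2) := by field_simp
          _ ≤ _ := by gcongr; linarith
    _ = ENNReal.ofReal (8 * θ⁻¹) := by
        rw [lintegral_const_mul _ (by fun_prop), lintegral_planeGaussian_exp_sq hθ (by linarith),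
          ← ENNReal.ofReal_mul (by positivity)]
        congr 1
        field_simp
        norm_num

lemma planeGaussian_sphere {θ : ℝ} (hθ : 0 < θ) (t : ℝ) :
    planeGaussian θ {z | ‖z‖ ^ 2 = t} = 0 := by
  have hm : MeasurableSet {z : ℂ | ‖z‖ ^ 2 = t} :=
    measurableSet_eq_fun (by fun_prop) measurable_const
  rw [← lintegral_indicator_one hm]
  have h := lintegral_planeGaussian_radial hθ (f := ({t} : Set ℝ).indicator 1)
    (measurable_one.indicator (measurableSet_singleton t))
  have e : (fun z : ℂ => ({t} : Set ℝ).indicator (1 : ℝ → ENNReal) (‖z‖ ^ 2)) =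
      {z : ℂ | ‖z‖ ^ 2 = t}.indicator 1 := by
    funext z
    simp [Set.indicator_apply]
  rw [e] at h
  rw [h]
  refine lintegral_eq_zero_of_ae_eq_zero ?_
  have : ∀ᵐ s ∂(volume.restrict (Set.Ioi (0 : ℝ))), s ≠ t := by
    refine ae_restrict_of_ae ?_
    simp [ae_iff]
  filter_upwards [this] with s hs
  simp [hs]

lemma planeGaussian_ball_pos {θ δ : ℝ} (hθ : 0 < θ) (hδ : 0 < δ) :
    0 < planeGaussian θ {z | ‖z‖ ^ 2 < δ} := by
  have hm : MeasurableSet {z : ℂ | ‖z‖ ^ 2 < δ} :=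
    measurableSet_lt (by fun_prop) measurable_const
  rw [pos_iff_ne_zero, planeGaussian_eq_withDensity hθ]
  intro h
  rw [withDensity_apply_eq_zero (by fun_prop)] at h
  have h2 : {z : ℂ | ENNReal.ofReal (θ / (2 * Real.pi) * Real.exp (-(θ * ‖z‖ ^ 2 / 2))) ≠ 0} ∩
      {z | ‖z‖ ^ 2 < δ} = {z | ‖z‖ ^ 2 < δ} := by
    refine Set.inter_eq_right.2 fun z _ => ?_
    have := Real.pi_pos
    simp only [ne_eq, ENNReal.ofReal_eq_zero, not_le, Set.mem_ofPred_eq]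
    positivity
  rw [h2] at h
  have ho : IsOpen {z : ℂ | ‖z‖ ^ 2 < δ} := isOpen_lt (by fun_prop) continuous_const
  exact (ho.measure_pos volume ⟨0, by simpa using hδ⟩).ne' h

lemma planeGaussian_map_smul {θ c : ℝ} (hc : 0 < c) :
    (planeGaussian θ).map (fun z => (c : ℂ) * z) = planeGaussian ((c ^ 2)⁻¹ * θ) := by
  have e : Measurable fun x : ℝ => c * x := by fun_prop
  have hg : (gaussianReal 0 (Real.toNNReal θ⁻¹)).map (fun x => c * x) =
      gaussianReal 0 (Real.toNNReal ((c ^ 2)⁻¹ * θ)⁻¹) := by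
    rw [gaussianReal_map_const_mul, mul_zero]
    congr 1
    rw [mul_inv, inv_inv, Real.toNNReal_mul (by positivity)]
    congr 1
    ext
    simp [Real.coe_toNNReal _ (sq_nonneg c)]
  rw [planeGaussian, planeGaussian, ← hg, Measure.map_prod_map _ _ e e,
    Measure.map_map (by fun_prop) Complex.measurableEquivRealProd.symm.measurable,
    Measure.map_map Complex.measurableEquivRealProd.symm.measurable (by fun_prop)]
  congr 1
  funext q
  apply Complex.ext <;> simp [Complex.measurableEquivRealProd_symm_apply]

lemma lintegral_exp_mul_gaussianReal (v : NNReal) (t : ℝ) :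
    ∫⁻ x, ENNReal.ofReal (Real.exp (t * x)) ∂gaussianReal 0 v =
      ENNReal.ofReal (Real.exp (v * t ^ 2 / 2)) := by
  rw [← ofReal_integral_eq_lintegral_ofReal (integrable_exp_mul_gaussianReal t)
    (Eventually.of_forall fun _ => by positivity)]
  congr 1
  have := congr_fun (mgf_id_gaussianReal (μ := 0) (v := v)) t
  simpa [mgf] using this

lemma lintegral_exp_re_mul_planeGaussian {θ : ℝ} (hθ : 0 < θ) (w : ℂ) :
    ∫⁻ z, ENNReal.ofReal (Real.exp (w * z).re) ∂planeGaussian θ =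
      ENNReal.ofReal (Real.exp (‖w‖ ^ 2 / (2 * θ))) := by
  have hm : Measurable fun z : ℂ => ENNReal.ofReal (Real.exp (w * z).re) := by fun_prop
  rw [planeGaussian, lintegral_map hm Complex.measurableEquivRealProd.symm.measurable]
  have e : ∀ q : ℝ × ℝ, ENNReal.ofReal (Real.exp (w * Complex.measurableEquivRealProd.symm q).re) =
      ENNReal.ofReal (Real.exp (w.re * q.1)) * ENNReal.ofReal (Real.exp (-w.im * q.2)) := by
    intro q
    rw [← ENNReal.ofReal_mul (by positivity), ← Real.exp_add]
    simp [Complex.measurableEquivRealProd_symm_apply, sub_eq_add_neg]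
  simp_rw [e]
  rw [lintegral_prod_mul (f := fun x => ENNReal.ofReal (Real.exp (w.re * x)))
    (g := fun x => ENNReal.ofReal (Real.exp (-w.im * x))) (by fun_prop) (by fun_prop),
    lintegral_exp_mul_gaussianReal, lintegral_exp_mul_gaussianReal,
    ← ENNReal.ofReal_mul (by positivity), ← Real.exp_add, Real.coe_toNNReal _ (by positivity),
    Complex.sq_norm, Complex.normSq_apply]
  congr 2
  field_simp

end PlaneGaussian

/-! ### The product law of the coefficients. -/

section CoeffLaw

variable {L m β : ℝ}

instance instIsProbabilityMeasureCoeffLaw : IsProbabilityMeasure (coeffLaw L m β) := by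
  unfold coeffLaw; infer_instance

lemma theta_pos (hm : 0 < m) (hβ : 0 < β) (k : ℤ) : 0 < theta L m β k := by
  unfold theta; positivity

lemma measurable_update (i : ℤ) : Measurable fun q : (ℤ → ℂ) × ℂ => Function.update q.1 i q.2 := by
  refine measurable_pi_iff.2 fun k => ?_
  by_cases h : k = i
  · subst h; simpa using measurable_snd
  · simp only [Function.update_of_ne h]
    fun_prop

/-- Resampling the coordinate `i` preserves the law of the coefficients. -/
lemma map_update_coeffLaw (i : ℤ) :
    ((coeffLaw L m β).prod (planeGaussian (theta L m β i))).map
      (fun q => Function.update q.1 i q.2) = coeffLaw L m β := by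
  refine Measure.eq_infinitePi _ fun s t ht => ?_
  rw [Measure.map_apply (measurable_update i) (MeasurableSet.pi s.countable_toSet fun k _ => ht k)]
  by_cases hi : i ∈ s
  · have : (fun q : (ℤ → ℂ) × ℂ => Function.update q.1 i q.2) ⁻¹' (Set.pi s t) =
        (Set.pi (s.erase i : Finset ℤ) t) ×ˢ t i := by
      ext q
      simp only [Set.mem_preimage, Set.mem_pi, Set.mem_prod, Finset.coe_erase, Finset.mem_coe]
      constructor
      · intro h
        refine ⟨fun k hk => ?_, by simpa using h i hi⟩
        have h1 : k ≠ i := fun h => hk.2 (by simpa using h)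
        simpa [Function.update_of_ne h1] using h k hk.1
      · rintro ⟨h1, h2⟩ k hk
        by_cases hki : k = i
        · subst hki; simpa using h2
        · simpa [Function.update_of_ne hki] using h1 k ⟨hk, by simpa using hki⟩
    rw [this, Measure.prod_prod, coeffLaw, Measure.infinitePi_pi _ (fun k _ => ht k), mul_comm,
      Finset.mul_prod_erase _ (fun k => planeGaussian (theta L m β k) (t k)) hi]
  · have : (fun q : (ℤ → ℂ) × ℂ => Function.update q.1 i q.2) ⁻¹' (Set.pi s t) =
        (Set.pi s t) ×ˢ Set.univ := by
      ext q
      simp only [Set.mem_preimage, Set.mem_pi, Set.mem_prod, Finset.mem_coe, Set.mem_univ, and_true]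
      refine forall₂_congr fun k hk => ?_
      rw [Function.update_of_ne (ne_of_mem_of_not_mem hk hi)]
    rw [this, Measure.prod_prod, measure_univ, mul_one, coeffLaw,
      Measure.infinitePi_pi _ (fun k _ => ht k)]

lemma lintegral_coeffLaw_update (i : ℤ) {F : (ℤ → ℂ) → ENNReal} (hF : Measurable F) :
    ∫⁻ X, F X ∂coeffLaw L m β =
      ∫⁻ X, ∫⁻ z, F (Function.update X i z) ∂planeGaussian (theta L m β i) ∂coeffLaw L m β := by
  conv_lhs => rw [← map_update_coeffLaw i]
  have h : Measurable fun q : (ℤ → ℂ) × ℂ => F (Function.update q.1 i q.2) :=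
    hF.comp (measurable_update i)
  rw [lintegral_map hF (measurable_update i), lintegral_prod _ h.aemeasurable]

/-- Independence, used through resampling: each induction step integrates out one fresh coordinate
and factors off its Gaussian Laplace transform. -/
lemma lintegral_exp_re_sum (hm : 0 < m) (hβ : 0 < β) (s : Finset ℤ) (w : ℤ → ℂ) :
    ∫⁻ X, ENNReal.ofReal (Real.exp (∑ k ∈ s, w k * X k).re) ∂coeffLaw L m β =
      ENNReal.ofReal (Real.exp (∑ k ∈ s, ‖w k‖ ^ 2 / (2 * theta L m β k))) := by
  induction s using Finset.induction_on with
  | empty => simp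
  | insert i s hi ih =>
    rw [lintegral_coeffLaw_update i (by fun_prop), Finset.sum_insert hi, Real.exp_add,
      ENNReal.ofReal_mul (by positivity), ← ih, ← lintegral_const_mul _ (by fun_prop)]
    refine lintegral_congr fun X => ?_
    have e : ∀ z : ℂ, ENNReal.ofReal (Real.exp
        (∑ k ∈ insert i s, w k * Function.update X i z k).re) =
        ENNReal.ofReal (Real.exp (w i * z).re) *
          ENNReal.ofReal (Real.exp (∑ k ∈ s, w k * X k).re) := by
      intro z
      have h2 : ∑ k ∈ s, w k * Function.update X i z k = ∑ k ∈ s, w k * X k :=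
        Finset.sum_congr rfl fun k hk => by
          rw [Function.update_of_ne (ne_of_mem_of_not_mem hk hi)]
      rw [Finset.sum_insert hi, h2, Function.update_self, Complex.add_re, Real.exp_add,
        ENNReal.ofReal_mul (by positivity)]
    simp_rw [e]
    rw [lintegral_mul_const _ (by fun_prop), lintegral_exp_re_mul_planeGaussian (theta_pos hm hβ i)]

/-- Gaussian exponential moment of a finite linear combination of the coefficients. -/
lemma lintegral_exp_sq_sum_le (hm : 0 < m) (hβ : 0 < β) (s : Finset ℤ) (w : ℤ → ℂ)
    (hw : ∑ k ∈ s, ‖w k‖ ^ 2 / theta L m β k ≤ 1 / 4) :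
    ∫⁻ X, ENNReal.ofReal (Real.exp (‖∑ k ∈ s, w k * X k‖ ^ 2)) ∂coeffLaw L m β ≤ 2 := by
  -- Linearize the square with an auxiliary standard planar Gaussian `g`. After Tonelli only linear
  -- exponentials of the coefficients remain, and the variance bound `1/4` leaves the moment of `exp
  -- (‖g‖² / 4)`, which is 2.
  have h1 : ∀ S : ℂ, ENNReal.ofReal (Real.exp (‖S‖ ^ 2)) =
      ∫⁻ g, ENNReal.ofReal (Real.exp ((√2 * g) * S).re) ∂planeGaussian 1 := by
    intro S
    have h := lintegral_exp_re_mul_planeGaussian one_pos ((√2 : ℝ) * S)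
    rw [norm_mul, mul_pow, Complex.norm_real, Real.norm_eq_abs, sq_abs,
      Real.sq_sqrt zero_le_two] at h
    rw [show ‖S‖ ^ 2 = 2 * ‖S‖ ^ 2 / (2 * 1) by ring, ← h]
    refine lintegral_congr fun z => ?_
    rw [mul_right_comm]
  simp_rw [h1]
  rw [lintegral_lintegral_swap (by fun_prop)]
  have h2 : ∀ g : ℂ, ∫⁻ X, ENNReal.ofReal (Real.exp ((√2 * g) * ∑ k ∈ s, w k * X k).re)
      ∂coeffLaw L m β ≤ ENNReal.ofReal (Real.exp (1 / 4 * ‖g‖ ^ 2)) := by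
    intro g
    have h := lintegral_exp_re_sum (L := L) hm hβ s fun k => (√2 * g) * w k
    simp only [mul_assoc] at h
    simp only [Finset.mul_sum, mul_assoc]
    rw [h]
    refine ENNReal.ofReal_le_ofReal (Real.exp_le_exp.2 ?_)
    have : ∀ k, ‖(√2 : ℂ) * (g * w k)‖ ^ 2 / (2 * theta L m β k) =
        ‖g‖ ^ 2 * (‖w k‖ ^ 2 / theta L m β k) := by
      intro k
      rw [norm_mul, norm_mul, mul_pow, mul_pow, Complex.norm_real, Real.norm_eq_abs, sq_abs,
        Real.sq_sqrt zero_le_two]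
      have := (theta_pos (L := L) hm hβ k).ne'
      field_simp
    rw [Finset.sum_congr rfl fun k _ => this k, ← Finset.mul_sum, mul_comm]
    gcongr
  refine (lintegral_mono h2).trans ?_
  rw [lintegral_planeGaussian_exp_sq one_pos (by norm_num)]
  norm_num

lemma coeffLaw_map_smul {c : ℝ} (hc : 0 < c) :
    (coeffLaw L m β).map (fun X k => (c : ℂ) * X k) = coeffLaw L m ((c ^ 2)⁻¹ * β) := by
  have h := Measure.infinitePi_map_pi (μ := fun k => planeGaussian (theta L m β k))
    (f := fun _ z => (c : ℂ) * z) (fun _ => by fun_prop)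
  rw [coeffLaw, coeffLaw, h]
  congr 1
  funext k
  rw [planeGaussian_map_smul hc]
  congr 1
  unfold theta
  ring

end CoeffLaw

/-! ### Trigonometric polynomials: pointwise bounds from averages. -/

section TrigPoly

variable {L : ℝ} [hL : Fact (0 < L)]

/-- The trigonometric polynomials of degree at most `N`. -/
def trigPoly (L : ℝ) (N : ℕ) : Submodule ℂ (PathSpace L) :=
  Submodule.span ℂ (fourier '' (Set.Icc (-(N : ℤ)) N))

lemma fourier_mem_trigPoly {N : ℕ} {k : ℤ} (hk : |k| ≤ N) : fourier k ∈ trigPoly L N :=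
  Submodule.subset_span ⟨k, abs_le.1 hk, rfl⟩

lemma modeC_mem_trigPoly {N : ℕ} {k : ℤ} (hk : |k| ≤ N) : modeC L k ∈ trigPoly L N :=
  Submodule.smul_mem _ _ (fourier_mem_trigPoly hk)

lemma mul_mem_trigPoly {N M : ℕ} {f g : PathSpace L} (hf : f ∈ trigPoly L N)
    (hg : g ∈ trigPoly L M) : f * g ∈ trigPoly L (N + M) := by
  have h := Submodule.mul_mem_mul hf hg
  rw [trigPoly, trigPoly, Submodule.span_mul_span] at h
  refine Submodule.span_le.2 ?_ h
  rintro _ ⟨_, ⟨a, ha, rfl⟩, _, ⟨b, hb, rfl⟩, rfl⟩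
  have e : (fourier a * fourier b : PathSpace L) = fourier (a + b) := by
    ext x
    rw [ContinuousMap.mul_apply, fourier_add]
  change (fourier a * fourier b : PathSpace L) ∈ _
  rw [e]
  refine fourier_mem_trigPoly ?_
  have h1 := abs_le.2 ha
  have h2 := abs_le.2 hb
  have h3 := abs_add_le a b
  push_cast
  linarith

lemma pow_mem_trigPoly {N : ℕ} {f : PathSpace L} (hf : f ∈ trigPoly L N) (q : ℕ) :
    f ^ q ∈ trigPoly L (q * N) := by
  induction q with
  | zero =>
    have : (f ^ 0 : PathSpace L) = fourier 0 := by
      ext x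
      simp
    rw [this]
    exact fourier_mem_trigPoly (by simp)
  | succ q ih =>
    rw [pow_succ, add_mul, one_mul]
    exact mul_mem_trigPoly ih hf

lemma eq_sum_of_mem_trigPoly {N : ℕ} {f : PathSpace L} (hf : f ∈ trigPoly L N) :
    f = ∑ k ∈ Finset.Icc (-(N : ℤ)) N, coeff L f k • modeC L k := by
  have h1 : ((√L : ℝ) : ℂ) ≠ 0 := by exact_mod_cast (Real.sqrt_pos.2 hL.out).ne'
  simp only [← coeffCLM_apply]
  induction hf using Submodule.span_induction with
  | mem f hf =>
    obtain ⟨j, hj, rfl⟩ := hf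
    have e : (fourier j : PathSpace L) = ((√L : ℝ) : ℂ) • modeC L j := by
      rw [modeC, smul_smul, mul_inv_cancel₀ h1, one_smul]
    have hj' : j ∈ Finset.Icc (-(N : ℤ)) N := by simpa using hj
    simp only [e, map_smul, coeffCLM_apply, coeff_modeC, smul_eq_mul, mul_ite, mul_one, mul_zero,
      ite_smul, zero_smul]
    rw [Finset.sum_ite_eq' , if_pos hj']
  | zero => simp
  | add f g _ _ hf hg =>
    conv_lhs => rw [hf, hg]
    simp only [map_add, add_smul, Finset.sum_add_distrib]
  | smul c f _ hf =>
    conv_lhs => rw [hf]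
    simp only [map_smul, smul_eq_mul, Finset.smul_sum, smul_smul]

/-- A trigonometric polynomial of degree `N` is bounded by `N^{1/2}` times its `L²` norm. -/
lemma norm_sq_le_of_mem_trigPoly {N : ℕ} {f : PathSpace L} (hf : f ∈ trigPoly L N)
    (x : AddCircle L) : ‖f x‖ ^ 2 ≤ (2 * N + 1) / L * sqNorm L f := by
  have hL0 := hL.out
  have h1 : ‖f x‖ ≤ ∑ k ∈ Finset.Icc (-(N : ℤ)) N, ‖coeff L f k‖ * (√L)⁻¹ := by
    conv_lhs => rw [eq_sum_of_mem_trigPoly hf]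
    rw [ContinuousMap.sum_apply]
    refine (norm_sum_le _ _).trans (Finset.sum_le_sum fun k _ => ?_)
    rw [ContinuousMap.smul_apply, norm_smul, modeC_apply, norm_mode]
  rw [← Finset.sum_mul] at h1
  -- Cauchy–Schwarz over the `2N + 1` frequencies, then Parseval.
  have h2 : (∑ k ∈ Finset.Icc (-(N : ℤ)) N, ‖coeff L f k‖) ^ 2 ≤ (2 * N + 1) * sqNorm L f := by
    refine (sq_sum_le_card_mul_sum_sq (s := Finset.Icc (-(N : ℤ)) N)).trans ?_
    have hc : ((Finset.Icc (-(N : ℤ)) N).card : ℝ) = 2 * N + 1 := by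
      rw [Int.card_Icc, ← Int.cast_natCast, Int.toNat_of_nonneg (by omega)]
      push_cast
      ring
    rw [hc]
    gcongr
    exact sum_le_hasSum _ (fun _ _ => by positivity) (hasSum_sqNorm f)
  calc ‖f x‖ ^ 2 ≤ ((∑ k ∈ Finset.Icc (-(N : ℤ)) N, ‖coeff L f k‖) * (√L)⁻¹) ^ 2 := by gcongr
    _ = (∑ k ∈ Finset.Icc (-(N : ℤ)) N, ‖coeff L f k‖) ^ 2 * L⁻¹ := by
      rw [mul_pow, inv_pow, Real.sq_sqrt hL0.le]
    _ ≤ ((2 * N + 1) * sqNorm L f) * L⁻¹ := by gcongr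
    _ = _ := by ring

/-- The exponential square of the supremum of a trigonometric polynomial is controlled by an
average over the circle. -/
lemma exp_norm_sq_le_of_mem_trigPoly {N : ℕ} {f : PathSpace L} (hf : f ∈ trigPoly L N) {a : ℝ}
    (ha : 0 ≤ a) (x : AddCircle L) :
    Real.exp (a * ‖f x‖ ^ 2) ≤ (2 * N + 1) / L * ∫ y, Real.exp (2 * a * ‖f y‖ ^ 2) := by
  have hL0 := hL.out
  -- Apply the `L²` bound to `f ^ q`, a polynomial of degree `q N`, and sum the exponential series
  -- over `q`.
  have hpow : ∀ q : ℕ, a ^ q * ‖f x‖ ^ (2 * q) / q.factorial ≤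
      (2 * N + 1) / L * ∫ y, (2 * a * ‖f y‖ ^ 2) ^ q / q.factorial := by
    intro q
    have h := norm_sq_le_of_mem_trigPoly (pow_mem_trigPoly hf q) x
    have e1 : ‖(f ^ q) x‖ ^ 2 = ‖f x‖ ^ (2 * q) := by
      rw [ContinuousMap.pow_apply, norm_pow, ← pow_mul, mul_comm]
    have e2 : ∫ y, (2 * a * ‖f y‖ ^ 2) ^ q / q.factorial =
        (2 * a) ^ q / q.factorial * sqNorm L (f ^ q) := by
      rw [sqNorm, ← integral_const_mul]
      refine integral_congr_ae (Eventually.of_forall fun y => ?_)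
      simp only [ContinuousMap.pow_apply, norm_pow]
      rw [mul_pow, ← pow_mul, ← pow_mul, mul_comm q 2]
      ring
    -- The growth of the degree with `q` costs a factor `2 ^ q`, which turns the rate `a` into `2 *
    -- a` on the right.
    have h3 : ((2 * (q * N : ℕ) + 1 : ℝ)) ≤ 2 ^ q * (2 * N + 1) := by
      have hq : (q + 1 : ℝ) ≤ 2 ^ q := by exact_mod_cast Nat.lt_two_pow_self
      have hq0 : (0 : ℝ) ≤ q := by positivity
      have hN : (0 : ℝ) ≤ N := by positivity
      push_cast
      nlinarith [mul_le_mul_of_nonneg_right hq hN]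
    rw [e2, ← e1]
    have hs := sqNorm_nonneg (f ^ q)
    calc a ^ q * ‖(f ^ q) x‖ ^ 2 / q.factorial
        ≤ a ^ q * ((2 ^ q * (2 * N + 1)) / L * sqNorm L (f ^ q)) / q.factorial := by
          gcongr
          exact h.trans (by gcongr)
      _ = _ := by rw [mul_pow]; ring
  have hint : ∀ q : ℕ, Integrable fun y => (2 * a * ‖f y‖ ^ 2) ^ q / q.factorial := fun q =>
    integrable_of_path (by fun_prop)
  have hsum : ∀ n : ℕ, ∑ q ∈ Finset.range n, (a * ‖f x‖ ^ 2) ^ q / q.factorial ≤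
      (2 * N + 1) / L * ∫ y, Real.exp (2 * a * ‖f y‖ ^ 2) := by
    intro n
    calc ∑ q ∈ Finset.range n, (a * ‖f x‖ ^ 2) ^ q / q.factorial
        ≤ ∑ q ∈ Finset.range n,
            (2 * N + 1) / L * ∫ y, (2 * a * ‖f y‖ ^ 2) ^ q / q.factorial := by
          refine Finset.sum_le_sum fun q _ => ?_
          rw [mul_pow, ← pow_mul]
          exact hpow q
      _ = (2 * N + 1) / L * ∫ y, ∑ q ∈ Finset.range n,
            (2 * a * ‖f y‖ ^ 2) ^ q / q.factorial := by
          rw [← Finset.mul_sum, integral_finsetSum _ fun q _ => hint q]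
      _ ≤ _ := by
          gcongr
          · exact integrable_finsetSum _ fun q _ => hint q
          · exact integrable_of_path (by fun_prop)
          · intro y
            exact Real.sum_le_exp_of_nonneg (by positivity) n
  have hlim : Tendsto (fun n : ℕ => ∑ q ∈ Finset.range n, (a * ‖f x‖ ^ 2) ^ q / q.factorial) atTop
      (𝓝 (Real.exp (a * ‖f x‖ ^ 2))) := by
    have h := (NormedSpace.expSeries_div_hasSum_exp (𝔸 := ℝ) (a * ‖f x‖ ^ 2)).tendsto_sum_nat
    rwa [← Real.exp_eq_exp_ℝ] at h
  exact le_of_tendsto' hlim hsum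

end TrigPoly

/-! ### Dyadic blocks of the random Fourier series. -/

section Blocks

/-- The dyadic block of frequencies `k` with `2^j ≤ |k| + 1 < 2^(j+1)`. -/
def block (j : ℕ) : Finset ℤ :=
  (Finset.Icc (-(2 ^ (j + 1) : ℤ)) (2 ^ (j + 1))).filter fun k => Nat.log 2 (k.natAbs + 1) = j

lemma natAbs_lt_of_log_eq {j : ℕ} {k : ℤ} (h : Nat.log 2 (k.natAbs + 1) = j) :
    k.natAbs + 1 < 2 ^ (j + 1) := by
  rw [← h]; exact Nat.lt_pow_succ_log_self (by norm_num) _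

lemma mem_block {j : ℕ} {k : ℤ} : k ∈ block j ↔ Nat.log 2 (k.natAbs + 1) = j := by
  simp only [block, Finset.mem_filter, Finset.mem_Icc, and_iff_right_iff_imp]
  intro h
  have h1 : ((k.natAbs + 1 : ℕ) : ℤ) < (2 ^ (j + 1) : ℕ) := by exact_mod_cast natAbs_lt_of_log_eq h
  push_cast at h1
  rw [← abs_le]
  linarith

lemma pow_le_of_mem_block {j : ℕ} {k : ℤ} (h : k ∈ block j) : (2 : ℝ) ^ j ≤ |(k : ℝ)| + 1 := by
  have h1 : 2 ^ j ≤ k.natAbs + 1 := by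
    rw [← mem_block.1 h]; exact Nat.pow_log_le_self _ (by omega)
  have h2 : ((2 ^ j : ℕ) : ℝ) ≤ (k.natAbs + 1 : ℕ) := by exact_mod_cast h1
  rw [Nat.cast_add, Nat.cast_natAbs] at h2
  push_cast at h2
  exact h2

lemma abs_le_of_mem_block {j : ℕ} {k : ℤ} (h : k ∈ block j) : |k| ≤ (2 ^ (j + 1) : ℕ) := by
  have h1 : ((k.natAbs + 1 : ℕ) : ℤ) < (2 ^ (j + 1) : ℕ) := by
    exact_mod_cast natAbs_lt_of_log_eq (mem_block.1 h)
  rw [Nat.cast_add, Int.natCast_natAbs] at h1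
  push_cast at h1 ⊢
  linarith

lemma card_block_le (j : ℕ) : ((block j).card : ℝ) ≤ 8 * 2 ^ j := by
  have h1 : (block j).card ≤ 8 * 2 ^ j := by
    refine (Finset.card_filter_le _ _).trans ?_
    rw [Int.card_Icc]
    have h2 : 1 ≤ 2 ^ j := Nat.one_le_two_pow
    have h3 : (2 ^ (j + 1) : ℤ) = 2 * (2 ^ j : ℕ) := by push_cast; ring
    rw [h3]
    omega
  exact_mod_cast h1

lemma block_zero : block 0 = {0} := by
  ext k
  rw [mem_block, Finset.mem_singleton, Nat.log_eq_zero_iff]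
  omega

variable {L m β : ℝ} [hL : Fact (0 < L)]

/-- The part of the random Fourier series with frequencies in the block `j`. -/
def blockSum (L : ℝ) (X : ℤ → ℂ) (j : ℕ) : PathSpace L := ∑ k ∈ block j, X k • modeC L k

lemma blockSum_apply (X : ℤ → ℂ) (j : ℕ) (x : AddCircle L) :
    blockSum L X j x = ∑ k ∈ block j, mode L k x * X k := by
  rw [blockSum, ContinuousMap.sum_apply]
  refine Finset.sum_congr rfl fun k _ => ?_
  rw [ContinuousMap.smul_apply, modeC_apply, smul_eq_mul, mul_comm]

lemma blockSum_mem_trigPoly (X : ℤ → ℂ) (j : ℕ) : blockSum L X j ∈ trigPoly L (2 ^ (j + 1)) :=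
  Submodule.sum_mem _ fun _ hk =>
    Submodule.smul_mem _ _ (modeC_mem_trigPoly (abs_le_of_mem_block hk))

lemma coeff_blockSum (X : ℤ → ℂ) (j : ℕ) (i : ℤ) :
    coeff L (blockSum L X j) i = if Nat.log 2 (i.natAbs + 1) = j then X i else 0 := by
  rw [blockSum, ← coeffCLM_apply, map_sum]
  simp only [map_smul, coeffCLM_apply, coeff_modeC, smul_eq_mul, mul_ite, mul_one, mul_zero]
  rw [Finset.sum_ite_eq]
  simp only [mem_block]

/-- A constant for which the block sums have uniformly bounded exponential moments. -/
def expRate (L m β : ℝ) : ℝ := L * β * min ((2 * Real.pi / L) ^ 2) (m ^ 2) / 64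

lemma expRate_pos (hm : 0 < m) (hβ : 0 < β) : 0 < expRate L m β := by
  have := hL.out
  have := Real.pi_pos
  have : 0 < min ((2 * Real.pi / L) ^ 2) (m ^ 2) := lt_min (by positivity) (by positivity)
  unfold expRate
  positivity

/-- On block `j` one has `4^j ≤ 2 (k² + 1)`, so `theta` is at least a multiple of `4^j`. The 64 in
`expRate` produces the 32 here. -/
lemma inv_theta_le (hm : 0 < m) (hβ : 0 < β) {j : ℕ} {k : ℤ} (hk : k ∈ block j) :
    (theta L m β k)⁻¹ ≤ L / (32 * expRate L m β * 4 ^ j) := by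
  have hL0 := hL.out
  have hpi := Real.pi_pos
  set c := min ((2 * Real.pi / L) ^ 2) (m ^ 2) with hc
  have hc0 : 0 < c := lt_min (by positivity) (by positivity)
  have h1 := pow_le_of_mem_block hk
  have h2 : (4 : ℝ) ^ j ≤ 2 * ((k : ℝ) ^ 2 + 1) := by
    have : (4 : ℝ) ^ j = (2 ^ j) ^ 2 := by rw [← pow_mul, mul_comm, pow_mul]; norm_num
    rw [this]
    calc ((2 : ℝ) ^ j) ^ 2 ≤ (|(k : ℝ)| + 1) ^ 2 := by gcongr
      _ ≤ 2 * ((k : ℝ) ^ 2 + 1) := by nlinarith [sq_abs (k : ℝ), sq_nonneg (|(k : ℝ)| - 1)]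
  have h3 : β * c * 4 ^ j / 2 ≤ theta L m β k := by
    unfold theta
    have e : (2 * Real.pi * k / L) ^ 2 = (2 * Real.pi / L) ^ 2 * (k : ℝ) ^ 2 := by ring
    have h4 : c * (k : ℝ) ^ 2 ≤ (2 * Real.pi / L) ^ 2 * (k : ℝ) ^ 2 := by
      gcongr; exact min_le_left _ _
    have h5 : c ≤ m ^ 2 := min_le_right _ _
    rw [e, mul_assoc, mul_div_assoc]
    gcongr
    nlinarith
  calc (theta L m β k)⁻¹ ≤ (β * c * 4 ^ j / 2)⁻¹ := inv_anti₀ (by positivity) h3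
    _ = _ := by
      unfold expRate
      rw [← hc]
      field_simp
      norm_num

/-- A functional of the coefficients with finite mean that controls the random Fourier series. -/
def expSum (L m β : ℝ) [Fact (0 < L)] (X : ℤ → ℂ) : ENNReal :=
  ∑' j : ℕ, ENNReal.ofReal ((2 ^ j)⁻¹) *
    ∫⁻ x, ENNReal.ofReal (Real.exp (expRate L m β * 2 ^ j * ‖blockSum L X j x‖ ^ 2))

lemma measurable_blockSum_uncurry (j : ℕ) :
    Measurable fun q : (ℤ → ℂ) × AddCircle L => blockSum L q.1 j q.2 := by
  simp only [blockSum_apply, ← modeC_apply]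
  fun_prop

lemma measurable_expSum : Measurable (expSum L m β) := by
  unfold expSum
  refine Measurable.tsum fun j => Measurable.const_mul ?_ _
  have h := measurable_blockSum_uncurry (L := L) j
  have : Measurable fun q : (ℤ → ℂ) × AddCircle L =>
      ENNReal.ofReal (Real.exp (expRate L m β * 2 ^ j * ‖blockSum L q.1 j q.2‖ ^ 2)) := by fun_prop
  exact this.lintegral_prod_right'

/-- There are at most `8 * 2^j` modes, each of variance of order `4^{-j}`, so the rate `2^j` is
exactly what the block tolerates. The constants multiply to the `1/4` required by
`lintegral_exp_sq_sum_le`. -/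
lemma lintegral_exp_blockSum_le (hm : 0 < m) (hβ : 0 < β) (j : ℕ) (x : AddCircle L) :
    ∫⁻ X, ENNReal.ofReal (Real.exp (expRate L m β * 2 ^ j * ‖blockSum L X j x‖ ^ 2))
      ∂coeffLaw L m β ≤ 2 := by
  have hL0 := hL.out
  have hb := expRate_pos (L := L) hm hβ
  set b := expRate L m β with hbdef
  have hw : ∑ k ∈ block j, ‖(√(b * 2 ^ j) : ℂ) * mode L k x‖ ^ 2 / theta L m β k ≤ 1 / 4 := by
    calc ∑ k ∈ block j, ‖(√(b * 2 ^ j) : ℂ) * mode L k x‖ ^ 2 / theta L m β k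
        ≤ ∑ k ∈ block j, b * 2 ^ j * L⁻¹ * (L / (32 * b * 4 ^ j)) := by
          refine Finset.sum_le_sum fun k hk => ?_
          rw [norm_mul, mul_pow, norm_mode_sq, Complex.norm_real, Real.norm_eq_abs, sq_abs,
            Real.sq_sqrt (by positivity), div_eq_mul_inv]
          gcongr
          exact inv_theta_le hm hβ hk
      _ = (block j).card * (b * 2 ^ j * L⁻¹ * (L / (32 * b * 4 ^ j))) := by
          rw [Finset.sum_const, nsmul_eq_mul]
      _ ≤ 8 * 2 ^ j * (b * 2 ^ j * L⁻¹ * (L / (32 * b * 4 ^ j))) := by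
          gcongr
          exact card_block_le j
      _ = 1 / 4 := by
          have : (4 : ℝ) ^ j = 2 ^ j * 2 ^ j := by rw [← mul_pow]; norm_num
          rw [this]
          field_simp
          norm_num
  refine le_trans (le_of_eq ?_) (lintegral_exp_sq_sum_le hm hβ (block j) _ hw)
  refine lintegral_congr fun X => ?_
  simp only [mul_assoc]
  rw [← Finset.mul_sum, norm_mul, mul_pow, Complex.norm_real, Real.norm_eq_abs, sq_abs,
    Real.sq_sqrt (by positivity), blockSum_apply, mul_assoc]

/-- Each block contributes a bounded mean at every point, so the weights `2^{-j}` make the sum over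
blocks converge. -/
lemma lintegral_expSum_lt_top (hm : 0 < m) (hβ : 0 < β) :
    ∫⁻ X, expSum L m β X ∂coeffLaw L m β < ⊤ := by
  have hmeas : ∀ j, Measurable fun q : (ℤ → ℂ) × AddCircle L =>
      ENNReal.ofReal (Real.exp (expRate L m β * 2 ^ j * ‖blockSum L q.1 j q.2‖ ^ 2)) := fun j => by
    have h := measurable_blockSum_uncurry (L := L) j
    fun_prop
  unfold expSum
  rw [lintegral_tsum fun j => ((hmeas j).lintegral_prod_right'.const_mul _).aemeasurable]
  have h1 : ∀ j : ℕ, ∫⁻ X, ENNReal.ofReal ((2 ^ j)⁻¹) *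
      (∫⁻ x, ENNReal.ofReal (Real.exp (expRate L m β * 2 ^ j * ‖blockSum L X j x‖ ^ 2)))
        ∂coeffLaw L m β ≤ ENNReal.ofReal ((2 ^ j)⁻¹ * (2 * L)) := by
    intro j
    rw [lintegral_const_mul _ (hmeas j).lintegral_prod_right',
      lintegral_lintegral_swap (hmeas j).aemeasurable, ENNReal.ofReal_mul (by positivity)]
    gcongr
    refine (lintegral_mono fun x => lintegral_exp_blockSum_le hm hβ j x).trans ?_
    rw [lintegral_const, AddCircle.measure_univ, ENNReal.ofReal_mul zero_le_two]
    simp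
  refine (ENNReal.tsum_le_tsum h1).trans_lt ?_
  have hs : Summable fun j : ℕ => ((2 : ℝ) ^ j)⁻¹ * (2 * L) := by
    have := (summable_geometric_two).mul_right (2 * L)
    simpa [one_div, inv_pow] using this
  have hL0 := hL.out
  rw [← ENNReal.ofReal_tsum_of_nonneg (fun j => by positivity) hs]
  exact ENNReal.ofReal_lt_top

/-- The logarithmic size of the control functional. -/
def logSum (L m β : ℝ) [Fact (0 < L)] (X : ℤ → ℂ) : ℝ := Real.log (1 + (expSum L m β X).toReal)

lemma logSum_nonneg (X : ℤ → ℂ) : 0 ≤ logSum L m β X :=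
  Real.log_nonneg (by linarith [ENNReal.toReal_nonneg (a := expSum L m β X)])

/-- The weight `2^{-j}` in `expSum` and the degree of the block each cost a factor `2^j` in passing
from `expSum` to a pointwise exponential. Taking logarithms turns `4^j (1 + expSum)` into a multiple
of `(1 + j) (1 + w)`, with `w` the value of `logSum`. -/
lemma exists_norm_blockSum_sq_le (hm : 0 < m) (hβ : 0 < β) :
    ∃ C : ℝ, 0 < C ∧ ∀ X : ℤ → ℂ, expSum L m β X ≠ ⊤ → ∀ (j : ℕ) (x : AddCircle L),
      ‖blockSum L X j x‖ ^ 2 ≤ C * ((2 ^ j)⁻¹ * (1 + j) * (1 + logSum L m β X)) := by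
  have hL0 := hL.out
  have hb := expRate_pos (L := L) hm hβ
  set b := expRate L m β with hbdef
  have hc0 : 0 ≤ Real.log (1 + 5 / L) := Real.log_nonneg (by
    have : 0 < 5 / L := by positivity
    linarith)
  -- The 5 comes from `2 * 2^(j+1) + 1 ≤ 5 * 2^j`, the summand 1 keeps the logarithm nonnegative,
  -- and 2 bounds `log 4`.
  refine ⟨2 / b * (Real.log (1 + 5 / L) + 2), by positivity, fun X hX j x => ?_⟩
  set y := (expSum L m β X).toReal with hy
  have hy0 : 0 ≤ y := ENNReal.toReal_nonneg
  have hint : Integrable fun x => Real.exp (b * 2 ^ j * ‖blockSum L X j x‖ ^ 2) :=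
    integrable_of_path (by fun_prop)
  have h1 : ∫ x, Real.exp (b * 2 ^ j * ‖blockSum L X j x‖ ^ 2) ≤ 2 ^ j * y := by
    have h := ENNReal.le_tsum (f := fun j : ℕ => ENNReal.ofReal ((2 ^ j)⁻¹) *
      ∫⁻ x, ENNReal.ofReal (Real.exp (expRate L m β * 2 ^ j * ‖blockSum L X j x‖ ^ 2))) j
    change _ ≤ expSum L m β X at h
    have h' := ENNReal.toReal_mono hX h
    rw [← ofReal_integral_eq_lintegral_ofReal hint (Eventually.of_forall fun _ => by positivity),
      ← ENNReal.ofReal_mul (by positivity), ENNReal.toReal_ofReal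
        (mul_nonneg (by positivity) (integral_nonneg fun _ => by positivity))] at h'
    rwa [inv_mul_le_iff₀ (by positivity)] at h'
  have h2 := exp_norm_sq_le_of_mem_trigPoly (blockSum_mem_trigPoly X j)
    (a := b * 2 ^ j / 2) (by positivity) x
  rw [show 2 * (b * 2 ^ j / 2) = b * 2 ^ j by ring] at h2
  have h3 : Real.exp (b * 2 ^ j / 2 * ‖blockSum L X j x‖ ^ 2) ≤
      (1 + 5 / L) * (4 ^ j * (1 + y)) := by
    have h5 : (1 : ℝ) ≤ 2 ^ j := one_le_pow₀ one_le_two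
    have h4 : (4 : ℝ) ^ j = 2 ^ j * 2 ^ j := by rw [← mul_pow]; norm_num
    calc _ ≤ (2 * ((2 ^ (j + 1) : ℕ) : ℝ) + 1) / L * (2 ^ j * y) := h2.trans (by gcongr)
      _ ≤ (5 * 2 ^ j) / L * (2 ^ j * (1 + y)) := by
        gcongr
        · push_cast; rw [pow_succ]; linarith
        · linarith
      _ = 5 / L * (4 ^ j * (1 + y)) := by rw [h4]; ring
      _ ≤ _ := by gcongr; linarith
  have h6 := Real.log_le_log (Real.exp_pos _) h3
  rw [Real.log_exp, Real.log_mul (by positivity) (by positivity), Real.log_mul (by positivity)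
    (by positivity), Real.log_pow] at h6
  change _ ≤ _ + (_ + logSum L m β X) at h6
  have hw := logSum_nonneg (L := L) (m := m) (β := β) X
  set w := logSum L m β X
  have hlog4 : Real.log 4 ≤ 2 := by
    have : Real.log 4 = 2 * Real.log 2 := by
      rw [show (4 : ℝ) = 2 ^ 2 by norm_num, Real.log_pow]; norm_num
    linarith [Real.log_two_lt_d9]
  have hj : (0 : ℝ) ≤ j := by positivity
  have h7 : b * 2 ^ j / 2 * ‖blockSum L X j x‖ ^ 2 ≤
      (Real.log (1 + 5 / L) + 2) * ((1 + j) * (1 + w)) := by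
    have h8 : (j : ℝ) * Real.log 4 ≤ j * 2 := by gcongr
    have h9 : 1 ≤ (1 + (j : ℝ)) * (1 + w) := by nlinarith [mul_nonneg hj hw]
    nlinarith [mul_nonneg hj hw, mul_le_mul_of_nonneg_left h9 hc0]
  calc ‖blockSum L X j x‖ ^ 2
      = 2 / b * (2 ^ j)⁻¹ * (b * 2 ^ j / 2 * ‖blockSum L X j x‖ ^ 2) := by field_simp
    _ ≤ 2 / b * (2 ^ j)⁻¹ * ((Real.log (1 + 5 / L) + 2) * ((1 + j) * (1 + w))) := by gcongr
    _ = _ := by ring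

end Blocks

/-! ### The Gaussian measure on continuous paths and the interpolation bound. -/

section Existence

variable {L m β : ℝ} [hL : Fact (0 < L)]

lemma summable_succ_mul_geometric {q : ℝ} (h0 : 0 ≤ q) (h1 : q < 1) :
    Summable fun j : ℕ => (1 + (j : ℝ)) * q ^ j := by
  have h := summable_pow_mul_geometric_of_norm_lt_one 1 (r := q) (by
    rwa [Real.norm_eq_abs, abs_of_nonneg h0])
  have h2 := summable_geometric_of_lt_one h0 h1
  simpa [add_mul] using h2.add h

/-- The supremum norms of the blocks are dominated by `(1 + j) 2^{-j/2}`, so the series converges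
uniformly. -/
lemma summable_blockSum (hm : 0 < m) (hβ : 0 < β) {X : ℤ → ℂ} (hX : expSum L m β X ≠ ⊤) :
    Summable (blockSum L X) := by
  obtain ⟨C, hC, h⟩ := exists_norm_blockSum_sq_le (L := L) hm hβ
  have hw := logSum_nonneg (L := L) (m := m) (β := β) X
  set K := √(C * (1 + logSum L m β X))
  have hq : √(1 / 2 : ℝ) < 1 := by
    rw [Real.sqrt_lt' one_pos]; norm_num
  refine Summable.of_norm_bounded
    ((summable_succ_mul_geometric (Real.sqrt_nonneg (1 / 2)) hq).mul_left K) fun j => ?_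
  refine (ContinuousMap.norm_le _ (by positivity)).2 fun x => ?_
  refine le_of_sq_le_sq ?_ (by positivity)
  have e : (K * ((1 + (j : ℝ)) * √(1 / 2) ^ j)) ^ 2 =
      C * (1 + logSum L m β X) * ((1 + j) ^ 2 * (2 ^ j)⁻¹) := by
    rw [mul_pow, mul_pow, Real.sq_sqrt (by positivity), ← pow_mul, mul_comm j 2, pow_mul,
      Real.sq_sqrt (by norm_num), one_div, inv_pow]
  rw [e]
  refine (h X hX j x).trans ?_
  have : (1 + (j : ℝ)) ≤ (1 + j) ^ 2 := by nlinarith [(Nat.cast_nonneg j : (0 : ℝ) ≤ j)]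
  calc _ = C * (1 + logSum L m β X) * ((1 + j) * (2 ^ j)⁻¹) := by ring
    _ ≤ _ := by gcongr

lemma coeff_tsum_blockSum {X : ℤ → ℂ} (h : Summable (blockSum L X)) :
    coeff L (∑' j, blockSum L X j) = X := by
  funext i
  rw [← coeffCLM_apply, ContinuousLinearMap.map_tsum _ h]
  simp only [coeffCLM_apply, coeff_blockSum]
  rw [tsum_eq_single (Nat.log 2 (i.natAbs + 1)) (fun j hj => if_neg hj.symm), if_pos rfl]

lemma hasSum_blockSum (hm : 0 < m) (hβ : 0 < β) {φ : PathSpace L}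
    (hφ : expSum L m β (coeff L φ) ≠ ⊤) : HasSum (blockSum L (coeff L φ)) φ := by
  have h := summable_blockSum hm hβ hφ
  have e : ∑' j, blockSum L (coeff L φ) j = φ := coeff_injective (coeff_tsum_blockSum h)
  have h1 := h.hasSum
  rwa [e] at h1

/-- A functional of finite mean is almost surely finite, and then the random series converges to a
continuous path. This gives the pulled-back measure full mass. -/
lemma ae_mem_range_coeff (hm : 0 < m) (hβ : 0 < β) :
    ∀ᵐ X ∂coeffLaw L m β, X ∈ Set.range (coeff L) := by
  filter_upwards [ae_lt_top measurable_expSum (lintegral_expSum_lt_top (L := L) hm hβ).ne]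
    with X hX
  exact ⟨_, coeff_tsum_blockSum (summable_blockSum hm hβ hX.ne)⟩

lemma map_coeff_gaussMeasure (hm : 0 < m) (hβ : 0 < β) :
    (gaussMeasure L m β).map (coeff L) = coeffLaw L m β := by
  rw [gaussMeasure, measurableEmbedding_coeff.map_comap]
  exact Measure.restrict_eq_self_of_ae_mem (ae_mem_range_coeff hm hβ)

/-- A measure on the path space with the right law of the coefficients is the Gaussian measure. -/
lemma eq_gaussMeasure_of_map_coeff {μ : Measure (PathSpace L)}
    (h : μ.map (coeff L) = coeffLaw L m β) : μ = gaussMeasure L m β := by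
  rw [gaussMeasure, ← h, measurableEmbedding_coeff.comap_map]

lemma isProbabilityMeasure_gaussMeasure (hm : 0 < m) (hβ : 0 < β) :
    IsProbabilityMeasure (gaussMeasure L m β) := by
  constructor
  have h := congrArg (fun μ => μ Set.univ) (map_coeff_gaussMeasure (L := L) hm hβ)
  simp only [measurableEmbedding_coeff.map_apply, measure_univ, Set.preimage_univ] at h
  exact h

lemma lintegral_gaussMeasure_coeff (hm : 0 < m) (hβ : 0 < β) {F : (ℤ → ℂ) → ENNReal}
    (hF : Measurable F) :
    ∫⁻ φ, F (coeff L φ) ∂gaussMeasure L m β = ∫⁻ X, F X ∂coeffLaw L m β := by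
  rw [← map_coeff_gaussMeasure (L := L) hm hβ, lintegral_map hF continuous_coeff.measurable]

lemma lintegral_expSum_coeff_lt_top (hm : 0 < m) (hβ : 0 < β) :
    ∫⁻ φ, expSum L m β (coeff L φ) ∂gaussMeasure L m β < ⊤ := by
  rw [lintegral_gaussMeasure_coeff hm hβ measurable_expSum]
  exact lintegral_expSum_lt_top hm hβ

lemma ae_expSum_coeff_ne_top (hm : 0 < m) (hβ : 0 < β) :
    ∀ᵐ φ ∂gaussMeasure L m β, expSum L m β (coeff L φ) ≠ ⊤ := by
  filter_upwards [ae_lt_top (measurable_expSum.comp continuous_coeff.measurable)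
    (lintegral_expSum_coeff_lt_top (L := L) hm hβ).ne] with φ hφ
  exact hφ.ne

lemma sqNorm_blockSum_le (φ : PathSpace L) (j : ℕ) :
    sqNorm L (blockSum L (coeff L φ) j) ≤ sqNorm L φ := by
  refine hasSum_le (fun k => ?_) (hasSum_sqNorm _) (hasSum_sqNorm φ)
  rw [coeff_blockSum]
  split_ifs
  · exact le_rfl
  · simp

/-- Each squared block has two bounds, `2^j N` deterministically and `2^{-j} (1 + j) (1 + w)` from
`expSum`, up to constants. Their geometric mean with weights `s` and `1 - s` is summable over blocks
when `s < 1/2`. -/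
lemma exists_norm_sq_le (hm : 0 < m) (hβ : 0 < β) {s : ℝ} (hs0 : 0 ≤ s) (hs : s < 1 / 2) :
    ∃ C : ℝ, 0 < C ∧ ∀ φ : PathSpace L, expSum L m β (coeff L φ) ≠ ⊤ → ∀ x : AddCircle L,
      ‖φ x‖ ^ 2 ≤ C * (sqNorm L φ ^ s * (1 + logSum L m β (coeff L φ)) ^ (1 - s)) := by
  have hL0 := hL.out
  obtain ⟨C, hC, h⟩ := exists_norm_blockSum_sq_le (L := L) hm hβ
  -- Per block, the two powers of `2^j` combine to `2^{j(2s-1)} = q^j`.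
  set q : ℝ := 2 ^ (-(1 - 2 * s)) with hqdef
  have hq0 : 0 < q := by positivity
  have hq1 : q < 1 := Real.rpow_lt_one_of_one_lt_of_neg (by norm_num) (by linarith)
  have hq : √q < 1 := by
    rw [Real.sqrt_lt' one_pos]; linarith
  set D := ∑' j : ℕ, (1 + (j : ℝ)) * √q ^ j with hD
  have hsum := summable_succ_mul_geometric (Real.sqrt_nonneg q) hq
  have hD0 : 0 < D := hsum.tsum_pos (fun j => by positivity) 0 (by simp)
  refine ⟨(5 / L) ^ s * C ^ (1 - s) * D ^ 2, by positivity, fun φ hφ x => ?_⟩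
  have hv := sqNorm_nonneg φ
  have hw := logSum_nonneg (L := L) (m := m) (β := β) (coeff L φ)
  set w := logSum L m β (coeff L φ)
  set v := sqNorm L φ
  set K := (5 / L) ^ s * C ^ (1 - s) * (v ^ s * (1 + w) ^ (1 - s)) with hK
  have hK0 : 0 ≤ K := by positivity
  have hblock : ∀ j, ‖blockSum L (coeff L φ) j x‖ ≤ √K * ((1 + (j : ℝ)) * √q ^ j) := by
    intro j
    have h1 : ‖blockSum L (coeff L φ) j x‖ ^ 2 ≤ 5 / L * 2 ^ j * v := by
      refine (norm_sq_le_of_mem_trigPoly (blockSum_mem_trigPoly _ j) x).trans ?_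
      have h5 : (1 : ℝ) ≤ 2 ^ j := one_le_pow₀ one_le_two
      have h6 : (2 * ((2 ^ (j + 1) : ℕ) : ℝ) + 1) ≤ 5 * 2 ^ j := by
        push_cast; rw [pow_succ]; linarith
      calc _ ≤ (5 * 2 ^ j) / L * v := by
            gcongr
            · exact sqNorm_nonneg _
            · exact sqNorm_blockSum_le φ j
        _ = _ := by ring
    have h2 := h _ hφ j x
    refine le_of_sq_le_sq ?_ (by positivity)
    rw [mul_pow, Real.sq_sqrt hK0, mul_pow, ← pow_mul, mul_comm j 2, pow_mul, Real.sq_sqrt hq0.le]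
    set P := ‖blockSum L (coeff L φ) j x‖ ^ 2
    have hP : 0 ≤ P := by positivity
    have hpq : ((2 : ℝ) ^ j) ^ s * (((2 : ℝ) ^ j)⁻¹) ^ (1 - s) = q ^ j := by
      rw [Real.inv_rpow (by positivity), ← Real.rpow_neg (by positivity),
        ← Real.rpow_add (by positivity), hqdef, ← Real.rpow_natCast, ← Real.rpow_natCast,
        ← Real.rpow_mul (by norm_num), ← Real.rpow_mul (by norm_num)]
      congr 1
      ring
    have hj1 : (1 + (j : ℝ)) ^ (1 - s) ≤ (1 + j) ^ 2 := by
      have hj : (1 : ℝ) ≤ 1 + j := by linarith [(Nat.cast_nonneg j : (0 : ℝ) ≤ j)]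
      rw [← Real.rpow_natCast]
      exact Real.rpow_le_rpow_of_exponent_le hj (by push_cast; linarith)
    calc P = P ^ s * P ^ (1 - s) := by
          rw [← Real.rpow_add_of_nonneg hP hs0 (by linarith)]; simp
      _ ≤ (5 / L * 2 ^ j * v) ^ s * (C * ((2 ^ j)⁻¹ * (1 + j) * (1 + w))) ^ (1 - s) := by
          gcongr
          linarith
      _ = (5 / L) ^ s * C ^ (1 - s) * (v ^ s * (1 + w) ^ (1 - s)) *
            ((1 + (j : ℝ)) ^ (1 - s) * (((2 : ℝ) ^ j) ^ s * (((2 : ℝ) ^ j)⁻¹) ^ (1 - s))) := by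
          rw [Real.mul_rpow (by positivity) hv, Real.mul_rpow (by positivity) (by positivity),
            Real.mul_rpow hC.le (by positivity), Real.mul_rpow (by positivity) (by positivity),
            Real.mul_rpow (by positivity) (by positivity)]
          ring
      _ ≤ K * ((1 + (j : ℝ)) ^ 2 * q ^ j) := by
          rw [hpq]
          gcongr
  have hφx : HasSum (fun j => blockSum L (coeff L φ) j x) (φ x) :=
    (hasSum_blockSum hm hβ hφ).map (ContinuousMap.evalCLM ℂ x) (ContinuousMap.evalCLM ℂ x).continuous
  have hle : ‖φ x‖ ≤ √K * D := by
    rw [← hφx.tsum_eq, hD, ← tsum_mul_left]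
    exact tsum_of_norm_bounded (hsum.mul_left _).hasSum hblock |>.trans_eq (by simp)
  calc ‖φ x‖ ^ 2 ≤ (√K * D) ^ 2 := by gcongr
    _ = K * D ^ 2 := by rw [mul_pow, Real.sq_sqrt hK0]
    _ = _ := by rw [hK]; ring

/-- The `p`-norm is bounded by the supremum norm and the `L²` norm. -/
lemma pNormPow_le_of_norm_sq_le {p M : ℝ} (hp : 2 < p) {φ : PathSpace L}
    (h : ∀ x, ‖φ x‖ ^ 2 ≤ M) : pNormPow L p φ ≤ M ^ ((p - 2) / 2) * sqNorm L φ := by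
  rw [pNormPow, sqNorm, ← integral_const_mul]
  refine integral_mono (integrable_of_path
    ((continuous_norm_rpow (by linarith)).comp φ.continuous))
    (integrable_of_path (by fun_prop)) fun x => ?_
  have e : ‖φ x‖ ^ p = (‖φ x‖ ^ 2) ^ ((p - 2) / 2) * ‖φ x‖ ^ 2 := by
    rw [← Real.rpow_natCast, ← Real.rpow_mul (norm_nonneg _),
      ← Real.rpow_add_of_nonneg (norm_nonneg _) (by push_cast; linarith) (by positivity)]
    congr 1
    push_cast
    ring
  simp only
  rw [e]
  gcongr
  exact h x

/-- The interpolation bound: up to a power of the particle number, the interaction is dominated by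
a quantity with finite exponential moment. -/
lemma exists_mul_pNormPow_le (hm : 0 < m) (hβ : 0 < β) {p α : ℝ} (hp : 2 < p) (hα : 0 < α)
    (hα' : α < 1 / 2) (hpα : p < 4 * α + 4) (A : ℝ) :
    ∃ C : ℝ, 0 < C ∧ ∀ φ : PathSpace L, expSum L m β (coeff L φ) ≠ ⊤ →
      A * pNormPow L p φ ≤ 1 + logSum L m β (coeff L φ) +
        C * sqNorm L φ ^ ((2 * α * p + 2) / (4 * α + 4 - p)) := by
  -- Chosen so that `s < 1/2` is equivalent to `α < 1/2`. The power of `1 + w` is then `τ = (p - 2)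
  -- / (2 (1 + 2α))`, and `τ < 1` is equivalent to `p < 4α + 4`.
  set s := 2 * α / (1 + 2 * α) with hs
  have hs0 : 0 ≤ s := by positivity
  have hs1 : s < 1 / 2 := by
    rw [hs, div_lt_iff₀ (by positivity)]; linarith
  obtain ⟨C, hC, h⟩ := exists_norm_sq_le (L := L) hm hβ hs0 hs1
  set τ := (1 - s) * ((p - 2) / 2) with hτ
  have h1s : 1 - s = 1 / (1 + 2 * α) := by rw [hs]; field_simp; ring
  have hτ0 : 0 < τ := mul_pos (by linarith) (by linarith)
  have hτ1 : τ < 1 := by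
    rw [hτ, h1s, one_div_mul_eq_div, div_lt_one (by positivity)]; linarith
  set B := (|A| + 1) * C ^ ((p - 2) / 2) with hB
  have hB0 : 0 < B := by positivity
  refine ⟨B ^ (1 / (1 - τ)), by positivity, fun φ hφ => ?_⟩
  have hv := sqNorm_nonneg φ
  have hw := logSum_nonneg (L := L) (m := m) (β := β) (coeff L φ)
  have h1 := pNormPow_le_of_norm_sq_le hp (h φ hφ)
  set w := logSum L m β (coeff L φ)
  set v := sqNorm L φ
  have hexp : (1 + s * ((p - 2) / 2)) * (1 / (1 - τ)) = (2 * α * p + 2) / (4 * α + 4 - p) := by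
    have e1 : 1 - τ = (4 * α + 4 - p) / (2 * (1 + 2 * α)) := by
      rw [hτ, h1s]; field_simp; ring
    have e2 : 1 + s * ((p - 2) / 2) = (1 + α * p) / (1 + 2 * α) := by
      rw [hs]; field_simp; ring
    have : 4 * α + 4 - p ≠ 0 := by linarith
    rw [e1, e2]
    field_simp
    ring
  have h2 : A * pNormPow L p φ ≤ (B * v ^ (1 + s * ((p - 2) / 2))) * (1 + w) ^ τ := by
    calc A * pNormPow L p φ ≤ (|A| + 1) * pNormPow L p φ := by
          gcongr
          · exact pNormPow_nonneg p φ
          · linarith [le_abs_self A]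
      _ ≤ (|A| + 1) * ((C * (v ^ s * (1 + w) ^ (1 - s))) ^ ((p - 2) / 2) * v) := by gcongr
      _ = _ := by
          have hp2 : 0 ≤ (p - 2) / 2 := by linarith
          rw [Real.mul_rpow hC.le (by positivity), Real.mul_rpow (by positivity) (by positivity),
            ← Real.rpow_mul hv, ← Real.rpow_mul (by linarith),
            Real.rpow_add_of_nonneg hv zero_le_one (by positivity), Real.rpow_one]
          ring
  refine h2.trans ?_
  set a := B * v ^ (1 + s * ((p - 2) / 2)) with ha
  have ha0 : 0 ≤ a := by positivity
  -- Young's inequality separates the factors: `1 + w` becomes linear, and the power of `N` is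
  -- raised to `1 / (1 - τ)`, which gives the threshold exponent.
  have hy := Real.geom_mean_le_arith_mean2_weighted (w₁ := 1 - τ) (w₂ := τ)
    (p₁ := a ^ (1 / (1 - τ))) (p₂ := 1 + w) (by linarith) hτ0.le (by positivity) (by linarith)
    (by ring)
  have e3 : (a ^ (1 / (1 - τ))) ^ (1 - τ) = a := by
    rw [← Real.rpow_mul ha0, one_div_mul_cancel (by linarith), Real.rpow_one]
  rw [e3] at hy
  have e4 : a ^ (1 / (1 - τ)) = B ^ (1 / (1 - τ)) * v ^ ((2 * α * p + 2) / (4 * α + 4 - p)) := by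
    rw [ha, Real.mul_rpow hB0.le (by positivity), ← Real.rpow_mul hv, hexp]
  rw [← e4]
  have h5 : 0 ≤ a ^ (1 / (1 - τ)) := by positivity
  nlinarith [mul_nonneg hτ0.le h5, mul_nonneg (sub_nonneg.2 hτ1.le) (show 0 ≤ 1 + w by linarith)]

/-- The exponential of the control term is affine in `expSum`, so finiteness of the mean of `expSum`
suffices for its exponential moment. -/
lemma exp_one_add_logSum {X : ℤ → ℂ} (hX : expSum L m β X ≠ ⊤) :
    ENNReal.ofReal (Real.exp (1 + logSum L m β X)) =
      ENNReal.ofReal (Real.exp 1) * (1 + expSum L m β X) := by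
  have h0 := ENNReal.toReal_nonneg (a := expSum L m β X)
  rw [Real.exp_add, logSum, Real.exp_log (by linarith), ENNReal.ofReal_mul (by positivity),
    ENNReal.ofReal_add zero_le_one h0, ENNReal.ofReal_toReal hX, ENNReal.ofReal_one]

lemma lintegral_exp_one_add_logSum_lt_top (hm : 0 < m) (hβ : 0 < β) :
    ∫⁻ φ, ENNReal.ofReal (Real.exp (1 + logSum L m β (coeff L φ))) ∂gaussMeasure L m β < ⊤ := by
  have := isProbabilityMeasure_gaussMeasure (L := L) hm hβ
  have hm1 := (measurable_expSum (L := L) (m := m) (β := β)).comp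
    (continuous_coeff (L := L)).measurable
  change Measurable fun φ => expSum L m β (coeff L φ) at hm1
  have hm2 : Measurable fun φ => 1 + expSum L m β (coeff L φ) := measurable_const.add hm1
  rw [lintegral_congr_ae ((ae_expSum_coeff_ne_top hm hβ).mono fun φ hφ => exp_one_add_logSum hφ),
    lintegral_const_mul _ hm2, lintegral_add_left measurable_const]
  refine ENNReal.mul_lt_top ENNReal.ofReal_lt_top (ENNReal.add_lt_top.2 ⟨by simp, ?_⟩)
  exact lintegral_expSum_coeff_lt_top hm hβ

end Existence

/-! ### Analyticity of Laplace transforms. -/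

section Analytic

variable {Ω : Type*} [MeasurableSpace Ω] {μ : Measure Ω} {E : Type*} [NormedAddCommGroup E]
  [NormedSpace ℂ E]

/-- The `n`-th power of a continuous linear functional as a multilinear map. -/
def functionalPow (n : ℕ) (l : E →L[ℂ] ℂ) : ContinuousMultilinearMap ℂ (fun _ : Fin n => E) ℂ :=
  (ContinuousMultilinearMap.mkPiAlgebraFin ℂ n ℂ).compContinuousLinearMap fun _ => l

lemma functionalPow_apply (n : ℕ) (l : E →L[ℂ] ℂ) (y : E) :
    functionalPow n l (fun _ => y) = l y ^ n := by
  simp [functionalPow]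

lemma norm_functionalPow_le (n : ℕ) (l : E →L[ℂ] ℂ) : ‖functionalPow n l‖ ≤ ‖l‖ ^ n := by
  refine (ContinuousMultilinearMap.norm_compContinuousLinearMap_le _ _).trans ?_
  simp

lemma continuous_functionalPow (n : ℕ) :
    Continuous fun l : E →L[ℂ] ℂ => functionalPow n l := by
  have h := (ContinuousMultilinearMap.compContinuousLinearMapContinuousMultilinear ℂ
    (fun _ : Fin n => E) (fun _ : Fin n => ℂ) ℂ).cont
  have h2 : Continuous fun l : E →L[ℂ] ℂ => fun _ : Fin n => l := by fun_prop
  exact ((ContinuousLinearMap.apply ℂ _ (ContinuousMultilinearMap.mkPiAlgebraFin ℂ n ℂ)).continuous).comp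
    (h.comp h2)

/-- A Laplace transform is analytic at the origin as soon as it converges absolutely on a ball. -/
lemma analyticAt_integral_exp_zero {l : Ω → E →L[ℂ] ℂ} (hl : AEStronglyMeasurable l μ) {g : Ω → ℂ}
    (hg : AEStronglyMeasurable g μ) {R : ℝ} (hR : 0 < R)
    (hint : Integrable (fun ω => Real.exp (R * ‖l ω‖) * ‖g ω‖) μ) :
    AnalyticAt ℂ (fun x => ∫ ω, Complex.exp (l ω x) * g ω ∂μ) 0 := by
  have hbound : ∀ (n : ℕ) (ω : Ω), (R * ‖l ω‖) ^ n / n.factorial ≤ Real.exp (R * ‖l ω‖) :=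
    fun n ω => Real.pow_div_factorial_le_exp _ (by positivity) n
  -- Terms of the exponential series as multilinear maps. They are integrated as such to give the
  -- power series, since each term scaled by `R ^ n` is dominated by the assumed integrable
  -- function.
  set F : ∀ n : ℕ, Ω → ContinuousMultilinearMap ℂ (fun _ : Fin n => E) ℂ := fun n ω => ((n.factorial : ℂ)⁻¹ * g ω) • functionalPow n (l ω) with hF
  have hFm : ∀ n, AEStronglyMeasurable (F n) μ := fun n =>
    (hg.const_mul _).smul ((continuous_functionalPow n).comp_aestronglyMeasurable hl)
  have hFn : ∀ n ω, ‖F n ω‖ * R ^ n ≤ Real.exp (R * ‖l ω‖) * ‖g ω‖ := by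
    intro n ω
    have h1 : ‖F n ω‖ = (n.factorial : ℝ)⁻¹ * ‖g ω‖ * ‖functionalPow n (l ω)‖ := by
      rw [hF]; simp [norm_smul]
    calc ‖F n ω‖ * R ^ n ≤ ((n.factorial : ℝ)⁻¹ * ‖g ω‖ * ‖l ω‖ ^ n) * R ^ n := by
          rw [h1]; gcongr; exact norm_functionalPow_le n _
      _ = ((R * ‖l ω‖) ^ n / n.factorial) * ‖g ω‖ := by rw [mul_pow]; ring
      _ ≤ _ := by gcongr; exact hbound n ω
  have hFi : ∀ n, Integrable (F n) μ := fun n => by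
    refine (hint.mul_const ((R ^ n)⁻¹)).mono' (hFm n) (Eventually.of_forall fun ω => ?_)
    rw [← div_eq_mul_inv, le_div_iff₀ (by positivity)]
    exact hFn n ω
  let P : FormalMultilinearSeries ℂ E ℂ := fun n => ∫ ω, F n ω ∂μ
  have hP : HasFPowerSeriesOnBall (fun x => ∫ ω, Complex.exp (l ω x) * g ω ∂μ) P 0
      (ENNReal.ofReal R) := by
    refine ⟨?_, by simpa using hR, ?_⟩
    · refine P.le_radius_of_bound (r := Real.toNNReal R)
        (∫ ω, Real.exp (R * ‖l ω‖) * ‖g ω‖ ∂μ) fun n => ?_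
      rw [Real.coe_toNNReal _ hR.le]
      calc ‖P n‖ * R ^ n ≤ (∫ ω, ‖F n ω‖ ∂μ) * R ^ n := by
            gcongr; exact norm_integral_le_integral_norm _
        _ = ∫ ω, ‖F n ω‖ * R ^ n ∂μ := (integral_mul_const _ _).symm
        _ ≤ _ := integral_mono ((hFi n).norm.mul_const _) hint fun ω => hFn n ω
    · intro y hy
      have hy' : ‖y‖ < R := by
        rw [Metric.mem_eball, edist_zero_right, ← ofReal_norm] at hy
        exact (ENNReal.ofReal_lt_ofReal_iff hR).1 hy
      have e1 : ∀ n, P n (fun _ => y) = ∫ ω, (n.factorial : ℂ)⁻¹ * g ω * l ω y ^ n ∂μ := by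
        intro n
        have h := (ContinuousMultilinearMap.apply ℂ (fun _ : Fin n => E) ℂ
          (fun _ => y)).integral_comp_comm (hFi n)
        rw [ContinuousMultilinearMap.apply_apply] at h
        rw [← h]
        refine integral_congr_ae (Eventually.of_forall fun ω => ?_)
        simp [hF, functionalPow_apply]
      simp only [e1, zero_add]
      refine hasSum_integral_of_dominated_convergence
        (fun n ω => (R * ‖l ω‖) ^ n / n.factorial * ‖g ω‖) (fun n => ?_) (fun n => ?_) ?_ ?_ ?_
      · have hc : Continuous fun L : E →L[ℂ] ℂ => L y ^ n := by fun_prop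
        exact (hg.const_mul _).mul (hc.comp_aestronglyMeasurable hl)
      · refine Eventually.of_forall fun ω => ?_
        rw [norm_mul, norm_mul, norm_inv, norm_pow, Complex.norm_natCast]
        have h3 : ‖l ω y‖ ≤ R * ‖l ω‖ := by
          rw [mul_comm]
          exact (l ω).le_opNorm_of_le hy'.le
        calc _ ≤ (n.factorial : ℝ)⁻¹ * ‖g ω‖ * (R * ‖l ω‖) ^ n := by gcongr
          _ = _ := by ring
      · exact Eventually.of_forall fun ω => (Real.summable_pow_div_factorial _).mul_right _
      · have e2 : (fun ω => ∑' n : ℕ, (R * ‖l ω‖) ^ n / n.factorial * ‖g ω‖) =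
            fun ω => Real.exp (R * ‖l ω‖) * ‖g ω‖ := by
          funext ω
          rw [tsum_mul_right, Real.exp_eq_exp_ℝ, NormedSpace.exp_eq_tsum_div]
        rw [e2]
        exact hint
      · refine Eventually.of_forall fun ω => ?_
        have h := (NormedSpace.expSeries_div_hasSum_exp (𝔸 := ℂ) (l ω y)).mul_right (g ω)
        rw [← Complex.exp_eq_exp_ℂ] at h
        have e3 : (fun n : ℕ => (n.factorial : ℂ)⁻¹ * g ω * l ω y ^ n) =
            fun n : ℕ => l ω y ^ n / n.factorial * g ω := by
          funext n; ring
        rw [e3]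
        exact h
  exact hP.analyticAt

/-- Translate to the origin: the factor `exp (l ω x₀)` is absorbed into `g`. -/
lemma analyticAt_integral_exp {l : Ω → E →L[ℂ] ℂ} (hl : AEStronglyMeasurable l μ) {g : Ω → ℂ}
    (hg : AEStronglyMeasurable g μ) (x₀ : E) {R : ℝ} (hR : 0 < R)
    (hint : Integrable (fun ω => Real.exp (R * ‖l ω‖) * ‖Complex.exp (l ω x₀) * g ω‖) μ) :
    AnalyticAt ℂ (fun x => ∫ ω, Complex.exp (l ω x) * g ω ∂μ) x₀ := by
  have hm : AEStronglyMeasurable (fun ω => Complex.exp (l ω x₀)) μ := by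
    have : Continuous fun L : E →L[ℂ] ℂ => Complex.exp (L x₀) := by fun_prop
    exact this.comp_aestronglyMeasurable hl
  have h := analyticAt_integral_exp_zero hl (hm.mul hg) hR hint
  have h2 : AnalyticAt ℂ (fun x => x - x₀) x₀ := analyticAt_id.sub analyticAt_const
  have h3 := AnalyticAt.comp_of_eq (f := fun x => x - x₀) (x := x₀) h h2 (sub_self x₀)
  refine h3.congr (Eventually.of_forall fun x => ?_)
  refine integral_congr_ae (Eventually.of_forall fun ω => ?_)
  simp only [map_sub, Pi.mul_apply]
  rw [← mul_assoc, ← Complex.exp_add, sub_add_cancel]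

end Analytic

/-! ### Domains around connected sets of parameters. -/

section Domain

variable {E : Type*} [NormedAddCommGroup E] [NormedSpace ℂ E]

/-- An open set with a connected subset `R` contains a domain with a ball around each point
of `R`. -/
lemma exists_domain {O R : Set E} (hO : IsOpen O) (hR : IsConnected R) (hRO : R ⊆ O) :
    ∃ D ⊆ O, IsOpen D ∧ IsConnected D ∧ ∀ x ∈ R, ∃ ε : ℝ, 0 < ε ∧ Metric.ball x ε ⊆ D := by
  obtain ⟨x₀, hx₀⟩ := hR.nonempty
  have hRD : R ⊆ connectedComponentIn O x₀ := hR.isPreconnected.subset_connectedComponentIn hx₀ hRO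
  have hopen : IsOpen (connectedComponentIn O x₀) := by
    -- The real structure supplies local connectedness, by which components of open sets are open.
    let _ := NormedSpace.restrictScalars ℝ ℂ E
    exact hO.connectedComponentIn
  refine ⟨connectedComponentIn O x₀, connectedComponentIn_subset _ _, hopen,
    isConnected_connectedComponentIn_iff.2 (hRO hx₀), fun x hx => ?_⟩
  obtain ⟨ε, hε, h⟩ := Metric.isOpen_iff.1 hopen x (hRD hx)
  exact ⟨ε, hε, h⟩

end Domain

/-! ### Scaling between inverse temperatures, grand-canonical case. -/

section Scaling

variable {L m β : ℝ} [hL : Fact (0 < L)]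

lemma sqNorm_smul (c : ℝ) (φ : PathSpace L) : sqNorm L ((c : ℂ) • φ) = c ^ 2 * sqNorm L φ := by
  rw [sqNorm, sqNorm, ← integral_const_mul]
  refine integral_congr_ae (Eventually.of_forall fun x => ?_)
  simp [mul_pow]

lemma pNormPow_smul {c : ℝ} (hc : 0 ≤ c) (p : ℝ) (φ : PathSpace L) :
    pNormPow L p ((c : ℂ) • φ) = c ^ p * pNormPow L p φ := by
  rw [pNormPow, pNormPow, ← integral_const_mul]
  refine integral_congr_ae (Eventually.of_forall fun x => ?_)
  simp only [ContinuousMap.smul_apply, norm_smul, Complex.norm_real, Real.norm_eq_abs,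
    abs_of_nonneg hc]
  rw [Real.mul_rpow hc (norm_nonneg _)]

lemma coeff_smul (c : ℂ) (φ : PathSpace L) : coeff L (c • φ) = fun k => c * coeff L φ k := by
  funext k
  rw [← coeffCLM_apply, map_smul, smul_eq_mul, coeffCLM_apply]

lemma continuous_smul_path (c : ℂ) : Continuous fun φ : PathSpace L => c • φ :=
  continuous_const_smul c

lemma measurableEmbedding_smul {c : ℝ} (hc : 0 < c) :
    MeasurableEmbedding fun φ : PathSpace L => (c : ℂ) • φ :=
  (Homeomorph.smulOfNeZero (c : ℂ) (by exact_mod_cast hc.ne')).measurableEmbedding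

/-- Coefficients are linear and their variances scale by `c ^ 2`; the coefficient law determines the
measure. -/
lemma gaussMeasure_map_smul (hm : 0 < m) (hβ : 0 < β) {c : ℝ} (hc : 0 < c) :
    (gaussMeasure L m β).map (fun φ => (c : ℂ) • φ) = gaussMeasure L m ((c ^ 2)⁻¹ * β) := by
  apply eq_gaussMeasure_of_map_coeff
  rw [Measure.map_map continuous_coeff.measurable (continuous_smul_path _).measurable,
    ← coeffLaw_map_smul hc, ← map_coeff_gaussMeasure hm hβ,
    Measure.map_map (by fun_prop) continuous_coeff.measurable]
  congr 1
  funext φ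
  exact coeff_smul _ φ

lemma gaussMeasure_one_map_smul (hm : 0 < m) (hβ : 0 < β) :
    (gaussMeasure L m 1).map (fun φ => (((√β)⁻¹ : ℝ) : ℂ) • φ) = gaussMeasure L m β := by
  rw [gaussMeasure_map_smul hm one_pos (inv_pos.2 (Real.sqrt_pos.2 hβ)), inv_pow,
    Real.sq_sqrt hβ.le, inv_inv, mul_one]

lemma mul_inv_sqrt_rpow (hβ : 0 < β) (p : ℝ) : β * (√β)⁻¹ ^ p = β ^ (1 - p / 2) := by
  rw [Real.sqrt_eq_rpow, ← Real.rpow_neg hβ.le, ← Real.rpow_mul hβ.le]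
  nth_rw 1 [← Real.rpow_one β]
  rw [← Real.rpow_add hβ]
  congr 1
  ring

lemma ofReal_cpow_one_sub_half (hβ : 0 < β) (p : ℝ) :
    (β : ℂ) ^ (1 - p / 2 : ℂ) = ((β ^ (1 - p / 2) : ℝ) : ℂ) := by
  rw [Complex.ofReal_cpow hβ.le]
  push_cast
  rfl

lemma ofReal_cpow_one_sub (hβ : 0 < β) (r : ℝ) :
    (β : ℂ) ^ (1 - r : ℂ) = ((β ^ (1 - r) : ℝ) : ℂ) := by
  rw [Complex.ofReal_cpow hβ.le]
  push_cast
  rfl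

/-- The two expressions for the grand-canonical partition function agree. -/
lemma grandZReal_eq_grandZ (hm : 0 < m) (p r : ℝ) (κ : ℂ) (hβ : 0 < β) (lam : ℂ) :
    grandZReal L m p r κ β lam = grandZ L m p r κ β lam := by
  have hc : 0 < (√β)⁻¹ := inv_pos.2 (Real.sqrt_pos.2 hβ)
  rw [grandZReal, grandZ, ← gaussMeasure_one_map_smul hm hβ,
    (measurableEmbedding_smul hc).integral_map]
  refine integral_congr_ae (Eventually.of_forall fun φ => ?_)
  simp only [grandIntegrand]
  congr 1
  have hN := sqNorm_nonneg φ
  have h2 : β * (√β)⁻¹ ^ 2 = 1 := by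
    rw [inv_pow, Real.sq_sqrt hβ.le, mul_inv_cancel₀ hβ.ne']
  have hr : β * ((√β)⁻¹ ^ 2) ^ r = β ^ (1 - r) := by
    rw [inv_pow, Real.sq_sqrt hβ.le, Real.inv_rpow hβ.le, ← Real.rpow_neg hβ.le]
    nth_rw 1 [← Real.rpow_one β]
    rw [← Real.rpow_add hβ]
    rfl
  rw [sqNorm_smul, pNormPow_smul hc.le, ofReal_cpow_one_sub_half hβ, ofReal_cpow_one_sub hβ,
    Real.mul_rpow (by positivity) hN, ← mul_inv_sqrt_rpow hβ, ← hr]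
  have h2' : (β : ℂ) * (((√β)⁻¹ ^ 2 : ℝ) : ℂ) = 1 := by exact_mod_cast h2
  calc _ = (β : ℂ) * (lam / p) * ((((√β)⁻¹ ^ p : ℝ) : ℂ) * (pNormPow L p φ : ℂ)) +
        m ^ 2 / 2 * ((β : ℂ) * (((√β)⁻¹ ^ 2 : ℝ) : ℂ)) * (sqNorm L φ : ℂ) -
        (β : ℂ) * (κ / r) * ((((√β)⁻¹ ^ 2) ^ r : ℝ) * ((sqNorm L φ ^ r : ℝ) : ℂ)) := by
          push_cast; ring
    _ = _ := by rw [h2']; push_cast; ring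

end Scaling

/-! ### The grand-canonical partition function. -/

section GrandCanonical

variable {L m : ℝ} [hL : Fact (0 < L)]

lemma exists_mul_rpow_le {q r C c : ℝ} (hq : 0 < q) (hqr : q < r) (hC : 0 ≤ C) (hc : 0 < c) :
    ∃ M : ℝ, ∀ v : ℝ, 0 ≤ v → C * v ^ q ≤ M + c * v ^ r := by
  -- The crossover point at which `C * v ^ q` and `c * v ^ r` agree: below it a constant suffices,
  -- above it the higher power dominates.
  set v₁ := (C / c) ^ (1 / (r - q)) with hv
  have hv0 : 0 ≤ v₁ := by positivity
  refine ⟨C * v₁ ^ q, fun v hv0' => ?_⟩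
  rcases le_total v v₁ with h | h
  · have : 0 ≤ c * v ^ r := by positivity
    have : C * v ^ q ≤ C * v₁ ^ q := by gcongr
    linarith
  · have h1 : C / c ≤ v ^ (r - q) := by
      have e : v₁ ^ (r - q) = C / c := by
        rw [hv, ← Real.rpow_mul (by positivity), one_div_mul_cancel (by linarith), Real.rpow_one]
      rw [← e]
      gcongr
    have h2 : C ≤ c * v ^ (r - q) := by rwa [div_le_iff₀' hc] at h1
    have h3 : v ^ r = v ^ (r - q) * v ^ q := by
      rw [← Real.rpow_add_of_nonneg hv0' (by linarith) hq.le]; congr 1; ring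
    have h4 : 0 ≤ C * v₁ ^ q := by positivity
    have h5 : C * v ^ q ≤ c * v ^ (r - q) * v ^ q := by gcongr
    rw [h3]
    linarith

/-- Cross-multiplied, this is `(p - 2) (2α + 1) ≥ 0`. It forces `r > 1`, so the cutoff also absorbs
the mass term, which is linear in `N`. -/
lemma one_le_exponent {p α : ℝ} (hp : 2 < p) (hα : 0 < α) (hpα : p < 4 * α + 4) :
    1 ≤ (2 * α * p + 2) / (4 * α + 4 - p) := by
  rw [le_div_iff₀ (by linarith)]
  nlinarith

lemma measurable_real_exponent {p r : ℝ} (hp : 0 ≤ p) (A B c : ℝ) :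
    Measurable fun φ : PathSpace L =>
      Real.exp (A * pNormPow L p φ + B * sqNorm L φ - c * sqNorm L φ ^ r) := by
  have h1 : Measurable (pNormPow L p) := (continuous_pNormPow hp).measurable
  have h2 : Measurable (sqNorm L) := continuous_sqNorm.measurable
  fun_prop

/-- Half of the cutoff absorbs the power of `N` from the interpolation bound and the other half the
linear term. What remains is a constant plus `1 + w`. -/
lemma integrable_real_exponent (hm : 0 < m) {p α r : ℝ} (hp : 2 < p) (hα : 0 < α)
    (hα' : α < 1 / 2) (hpα : p < 4 * α + 4) (hr : (2 * α * p + 2) / (4 * α + 4 - p) < r)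
    (A B : ℝ) {c : ℝ} (hc : 0 < c) :
    Integrable (fun φ => Real.exp (A * pNormPow L p φ + B * sqNorm L φ - c * sqNorm L φ ^ r))
      (gaussMeasure L m 1) := by
  have hr0 := one_le_exponent hp hα hpα
  obtain ⟨C, hC, h⟩ := exists_mul_pNormPow_le (L := L) hm one_pos hp hα hα' hpα A
  obtain ⟨M₁, hM₁⟩ := exists_mul_rpow_le (c := c / 2) (by linarith) hr hC.le (by linarith)
  obtain ⟨M₂, hM₂⟩ := exists_mul_rpow_le (C := |B|) (c := c / 2) one_pos
    (show (1 : ℝ) < r by linarith) (abs_nonneg B) (by linarith)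
  refine ⟨(measurable_real_exponent (by linarith) A B c).aestronglyMeasurable, ?_⟩
  rw [hasFiniteIntegral_iff_ofReal (Eventually.of_forall fun _ => by positivity)]
  have hfin := lintegral_exp_one_add_logSum_lt_top (L := L) hm one_pos
  have hle : ∀ᵐ φ ∂gaussMeasure L m 1,
      ENNReal.ofReal (Real.exp (A * pNormPow L p φ + B * sqNorm L φ - c * sqNorm L φ ^ r)) ≤
      ENNReal.ofReal (Real.exp (M₁ + M₂)) *
        ENNReal.ofReal (Real.exp (1 + logSum L m 1 (coeff L φ))) := by
    filter_upwards [ae_expSum_coeff_ne_top (L := L) hm one_pos] with φ hφ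
    rw [← ENNReal.ofReal_mul (by positivity), ← Real.exp_add]
    refine ENNReal.ofReal_le_ofReal (Real.exp_le_exp.2 ?_)
    have h1 := h φ hφ
    have h2 := hM₁ _ (sqNorm_nonneg φ)
    have h3 := hM₂ _ (sqNorm_nonneg φ)
    rw [Real.rpow_one] at h3
    have h4 : B * sqNorm L φ ≤ |B| * sqNorm L φ :=
      mul_le_mul_of_nonneg_right (le_abs_self B) (sqNorm_nonneg φ)
    linarith
  refine (lintegral_mono_ae hle).trans_lt ?_
  rw [lintegral_const_mul' _ _ ENNReal.ofReal_ne_top]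
  exact ENNReal.mul_lt_top ENNReal.ofReal_lt_top hfin

lemma norm_grandIntegrand (p r : ℝ) (κ β lam : ℂ) (φ : PathSpace L) :
    ‖grandIntegrand L m p r κ β lam φ‖ =
      Real.exp ((lam * β ^ (1 - p / 2 : ℂ) / p).re * pNormPow L p φ + m ^ 2 / 2 * sqNorm L φ -
        (β ^ (1 - r : ℂ) * κ / r).re * sqNorm L φ ^ r) := by
  have h : (m ^ 2 / 2 * sqNorm L φ : ℂ) = ((m ^ 2 / 2 * sqNorm L φ : ℝ) : ℂ) := by push_cast; rfl
  rw [grandIntegrand, Complex.norm_exp, Complex.sub_re, Complex.add_re, h, Complex.ofReal_re,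
    Complex.re_mul_ofReal, Complex.re_mul_ofReal]

lemma measurable_grandIntegrand {p : ℝ} (hp : 0 ≤ p) (r : ℝ) (κ β lam : ℂ) :
    Measurable (grandIntegrand L m p r κ β lam) := by
  have h1 : Measurable (pNormPow L p) := (continuous_pNormPow hp).measurable
  have h2 : Measurable (sqNorm L) := continuous_sqNorm.measurable
  unfold grandIntegrand
  fun_prop

lemma integrable_grandIntegrand (hm : 0 < m) {p α r : ℝ} (hp : 2 < p) (hα : 0 < α)
    (hα' : α < 1 / 2) (hpα : p < 4 * α + 4) (hr : (2 * α * p + 2) / (4 * α + 4 - p) < r)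
    {κ β lam : ℂ} (h : 0 < (β ^ (1 - r : ℂ) * κ).re) :
    Integrable (grandIntegrand L m p r κ β lam) (gaussMeasure L m 1) := by
  have hr0 := one_le_exponent hp hα hpα
  have hc : 0 < (β ^ (1 - r : ℂ) * κ / r).re := by
    rw [Complex.div_ofReal_re]; exact div_pos h (by linarith)
  rw [← integrable_norm_iff (measurable_grandIntegrand (by linarith) _ _ _ _).aestronglyMeasurable]
  simp only [norm_grandIntegrand]
  exact integrable_real_exponent hm hp hα hα' hpα hr _ _ hc

/-- The partition function as a function of the two coupling constants. -/
def couplingZ (L m : ℝ) [Fact (0 < L)] (p r : ℝ) (x : ℂ × ℂ) : ℂ :=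
  ∫ φ, Complex.exp (((pNormPow L p φ : ℂ) • ContinuousLinearMap.fst ℂ ℂ ℂ -
    ((sqNorm L φ ^ r : ℝ) : ℂ) • ContinuousLinearMap.snd ℂ ℂ ℂ) x) *
      Complex.exp (m ^ 2 / 2 * sqNorm L φ) ∂gaussMeasure L m 1

lemma grandZ_eq_couplingZ (p r : ℝ) (κ β lam : ℂ) :
    grandZ L m p r κ β lam =
      couplingZ L m p r (lam * β ^ (1 - p / 2 : ℂ) / p, β ^ (1 - r : ℂ) * κ / r) := by
  rw [grandZ, couplingZ]
  refine integral_congr_ae (Eventually.of_forall fun φ => ?_)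
  simp only [grandIntegrand]
  rw [← Complex.exp_add]
  congr 1
  simp
  ring

lemma analyticAt_couplingZ (hm : 0 < m) {p α r : ℝ} (hp : 2 < p) (hα : 0 < α)
    (hα' : α < 1 / 2) (hpα : p < 4 * α + 4) (hr : (2 * α * p + 2) / (4 * α + 4 - p) < r)
    {x : ℂ × ℂ} (hx : 0 < x.2.re) : AnalyticAt ℂ (couplingZ L m p r) x := by
  have hr0 := one_le_exponent hp hα hpα
  have h1 : Continuous (pNormPow L p) := continuous_pNormPow (by linarith)
  have h2 : Continuous (sqNorm L) := continuous_sqNorm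
  have h3 : Continuous fun φ => sqNorm L φ ^ r := h2.rpow_const fun _ => Or.inr (by linarith)
  have hl : Continuous fun φ : PathSpace L =>
      (pNormPow L p φ : ℂ) • ContinuousLinearMap.fst ℂ ℂ ℂ -
      ((sqNorm L φ ^ r : ℝ) : ℂ) • ContinuousLinearMap.snd ℂ ℂ ℂ := by fun_prop
  have hg : Continuous fun φ : PathSpace L => Complex.exp (m ^ 2 / 2 * sqNorm L φ) := by fun_prop
  -- The functional has norm at most `‖φ‖_p^p + N^r`. This radius spends half of the cutoff and
  -- leaves the other half for integrability.
  refine analyticAt_integral_exp (R := x.2.re / 2) hl.aestronglyMeasurable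
    hg.aestronglyMeasurable x (by linarith) ?_
  have hint := integrable_real_exponent (L := L) hm hp hα hα' hpα hr (x.2.re / 2 + x.1.re)
    (m ^ 2 / 2) (c := x.2.re / 2) (by linarith)
  refine hint.mono' ?_ (Eventually.of_forall fun φ => ?_)
  · have hc : Continuous fun φ : PathSpace L =>
        Complex.exp (((pNormPow L p φ : ℂ) • ContinuousLinearMap.fst ℂ ℂ ℂ -
        ((sqNorm L φ ^ r : ℝ) : ℂ) • ContinuousLinearMap.snd ℂ ℂ ℂ) x) := by fun_prop
    exact (Continuous.mul (by fun_prop) (hc.mul hg).norm).aestronglyMeasurable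
  · have hP := pNormPow_nonneg p φ
    have hN : 0 ≤ sqNorm L φ ^ r := Real.rpow_nonneg (sqNorm_nonneg φ) r
    have hn : ‖(pNormPow L p φ : ℂ) • ContinuousLinearMap.fst ℂ ℂ ℂ -
        ((sqNorm L φ ^ r : ℝ) : ℂ) • ContinuousLinearMap.snd ℂ ℂ ℂ‖ ≤
        pNormPow L p φ + sqNorm L φ ^ r := by
      refine (norm_sub_le _ _).trans ?_
      rw [norm_smul, norm_smul, Complex.norm_real, Complex.norm_real, Real.norm_eq_abs,
        Real.norm_eq_abs, abs_of_nonneg hP, abs_of_nonneg hN]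
      have f1 := ContinuousLinearMap.norm_fst_le ℂ ℂ ℂ
      have f2 := ContinuousLinearMap.norm_snd_le ℂ ℂ ℂ
      nlinarith
    have he : ((m ^ 2 / 2 * sqNorm L φ : ℂ)).re = m ^ 2 / 2 * sqNorm L φ := by
      have h : (m ^ 2 / 2 * sqNorm L φ : ℂ) = ((m ^ 2 / 2 * sqNorm L φ : ℝ) : ℂ) := by
        push_cast; rfl
      rw [h, Complex.ofReal_re]
    rw [Real.norm_eq_abs, abs_of_nonneg (by positivity), norm_mul, Complex.norm_exp,
      Complex.norm_exp, ← Real.exp_add, ← Real.exp_add, he]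
    refine Real.exp_le_exp.2 ?_
    have hre : (((pNormPow L p φ : ℂ) • ContinuousLinearMap.fst ℂ ℂ ℂ -
        ((sqNorm L φ ^ r : ℝ) : ℂ) • ContinuousLinearMap.snd ℂ ℂ ℂ) x).re =
        pNormPow L p φ * x.1.re - sqNorm L φ ^ r * x.2.re := by
      simp
    rw [hre]
    nlinarith [mul_le_mul_of_nonneg_left hn (show 0 ≤ x.2.re / 2 by linarith)]

lemma analyticAt_cpow_const {F : Type*} [NormedAddCommGroup F] [NormedSpace ℂ F] {f : F → ℂ}
    {x : F} (hf : AnalyticAt ℂ f x) (hx : 0 < (f x).re) (c : ℂ) :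
    AnalyticAt ℂ (fun y => f y ^ c) x :=
  hf.cpow analyticAt_const (Or.inl hx)

lemma analyticAt_grandZ (hm : 0 < m) {p α r : ℝ} (hp : 2 < p) (hα : 0 < α)
    (hα' : α < 1 / 2) (hpα : p < 4 * α + 4) (hr : (2 * α * p + 2) / (4 * α + 4 - p) < r)
    {z : ℂ × ℂ × ℂ} (h0 : 0 < z.2.1.re) (h : 0 < (z.2.1 ^ (1 - r : ℂ) * z.1).re) :
    AnalyticAt ℂ (fun z : ℂ × ℂ × ℂ => grandZ L m p r z.1 z.2.1 z.2.2) z := by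
  have hr0 := one_le_exponent hp hα hpα
  simp only [grandZ_eq_couplingZ]
  have hβ : AnalyticAt ℂ (fun z : ℂ × ℂ × ℂ => z.2.1) z := analyticAt_fst.comp analyticAt_snd
  have hl : AnalyticAt ℂ (fun z : ℂ × ℂ × ℂ => z.2.2) z := analyticAt_snd.comp analyticAt_snd
  have ha : AnalyticAt ℂ (fun z : ℂ × ℂ × ℂ => z.2.2 * z.2.1 ^ (1 - p / 2 : ℂ) / p) z :=
    (hl.mul (analyticAt_cpow_const hβ h0 _)).div_const
  have hc : AnalyticAt ℂ (fun z : ℂ × ℂ × ℂ => z.2.1 ^ (1 - r : ℂ) * z.1 / r) z :=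
    ((analyticAt_cpow_const hβ h0 _).mul analyticAt_fst).div_const
  refine AnalyticAt.fun_comp (analyticAt_couplingZ hm hp hα hα' hpα hr ?_) (ha.prod hc)
  simp only
  rw [Complex.div_ofReal_re]
  exact div_pos h (by linarith)

lemma grandZ_ofReal_mem_slitPlane (hm : 0 < m) {p α r : ℝ} (hp : 2 < p) (hα : 0 < α)
    (hα' : α < 1 / 2) (hpα : p < 4 * α + 4) (hr : (2 * α * p + 2) / (4 * α + 4 - p) < r)
    {k b : ℝ} (hk : 0 < k) (hb : 0 < b) (l : ℝ) :
    grandZ L m p r k b l ∈ Complex.slitPlane := by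
  have hr0 := one_le_exponent hp hα hpα
  have := isProbabilityMeasure_gaussMeasure (L := L) hm one_pos
  have hint := integrable_real_exponent (L := L) hm hp hα hα' hpα hr (l * b ^ (1 - p / 2) / p)
    (m ^ 2 / 2) (c := b ^ (1 - r) * k / r) (by
      have : 0 < r := by linarith
      positivity)
  have e : grandZ L m p r k b l = ((∫ φ, Real.exp (l * b ^ (1 - p / 2) / p * pNormPow L p φ +
      m ^ 2 / 2 * sqNorm L φ - b ^ (1 - r) * k / r * sqNorm L φ ^ r) ∂gaussMeasure L m 1 : ℝ) : ℂ)
      := by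
    rw [grandZ, ← integral_complex_ofReal]
    refine integral_congr_ae (Eventually.of_forall fun φ => ?_)
    simp only [grandIntegrand, ofReal_cpow_one_sub_half hb, ofReal_cpow_one_sub hb]
    push_cast
    rfl
  rw [e, Complex.ofReal_mem_slitPlane]
  exact integral_exp_pos hint

lemma re_cpow_mul_pos {k b : ℝ} (hk : 0 < k) (hb : 0 < b) (r : ℝ) :
    0 < ((b : ℂ) ^ (1 - r : ℂ) * k).re := by
  rw [ofReal_cpow_one_sub hb, ← Complex.ofReal_mul, Complex.ofReal_re]
  positivity

lemma dist_re_lt_of_abs_im_lt {z : ℂ} {ε : ℝ} (h : |z.im| < ε) : dist z (z.re : ℂ) < ε := by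
  rw [dist_eq_norm]
  have : z - (z.re : ℂ) = (z.im : ℂ) * Complex.I := by
    apply Complex.ext <;> simp
  rw [this, norm_mul, Complex.norm_I, mul_one, Complex.norm_real]
  exact h

/-- The admissible set is open by continuity of the partition function, and contains the convex,
hence connected, set of real parameters, where the integral is positive. The domain is its component
through them. -/
lemma grand_canonical (hm : 0 < m) {p α r : ℝ} (hp : 2 < p) (hα : 0 < α)
    (hα' : α < 1 / 2) (hpα : p < 4 * α + 4) (hr : (2 * α * p + 2) / (4 * α + 4 - p) < r) :
    ∃ D : Set (ℂ × ℂ × ℂ), IsOpen D ∧ IsConnected D ∧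
      (∀ k b l : ℝ, 0 < k → 0 < b → ∃ ε : ℝ, 0 < ε ∧ ∀ κ β lam : ℂ,
        κ.re = k → β.re = b → lam.re = l → |κ.im| < ε → |β.im| < ε → |lam.im| < ε →
          (κ, β, lam) ∈ D) ∧
      (∀ κ β lam : ℂ, (κ, β, lam) ∈ D →
        0 < β.re ∧ 0 < (β ^ (1 - r : ℂ) * κ).re ∧
        Integrable (grandIntegrand L m p r κ β lam) (gaussMeasure L m 1) ∧
        grandZ L m p r κ β lam ∈ Complex.slitPlane) ∧
      AnalyticOnNhd ℂ
        (fun z : ℂ × ℂ × ℂ => Complex.log (grandZ L m p r z.1 z.2.1 z.2.2)) D := by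
  set H : Set (ℂ × ℂ × ℂ) := {z | 0 < z.2.1.re} with hHdef
  have hH : IsOpen H := isOpen_lt continuous_const (by fun_prop)
  set U : Set (ℂ × ℂ × ℂ) := H ∩ (fun z => (z.2.1 ^ (1 - r : ℂ) * z.1).re) ⁻¹' Set.Ioi 0 with hUdef
  have hU : IsOpen U := by
    -- Continuity of the principal power is used only on the half-plane `Re β > 0`.
    refine ContinuousOn.isOpen_inter_preimage (fun z hz => ?_) hH isOpen_Ioi
    have hβ : AnalyticAt ℂ (fun z : ℂ × ℂ × ℂ => z.2.1) z := analyticAt_fst.comp analyticAt_snd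
    have h1 := ((analyticAt_cpow_const hβ hz (1 - r : ℂ)).mul analyticAt_fst).continuousAt
    exact (Complex.continuous_re.continuousAt.comp h1).continuousWithinAt
  set Z := fun z : ℂ × ℂ × ℂ => grandZ L m p r z.1 z.2.1 z.2.2 with hZdef
  have hZ : ∀ z ∈ U, AnalyticAt ℂ Z z := fun z hz =>
    analyticAt_grandZ hm hp hα hα' hpα hr hz.1 hz.2
  have hO : IsOpen (U ∩ Z ⁻¹' Complex.slitPlane) :=
    ContinuousOn.isOpen_inter_preimage (fun z hz => (hZ z hz).continuousAt.continuousWithinAt) hU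
      Complex.isOpen_slitPlane
  set S : Set (ℂ × ℂ × ℂ) := (fun q : ℝ × ℝ × ℝ => ((q.1 : ℂ), (q.2.1 : ℂ), (q.2.2 : ℂ))) ''
    (Set.Ioi 0 ×ˢ Set.Ioi 0 ×ˢ Set.univ) with hSdef
  have hS : IsConnected S := by
    refine IsConnected.image ?_ _ (by fun_prop)
    refine Convex.isConnected ?_ ⟨(1, 1, 1), by simp⟩
    exact (convex_Ioi 0).prod ((convex_Ioi 0).prod convex_univ)
  have hSO : S ⊆ U ∩ Z ⁻¹' Complex.slitPlane := by
    rintro _ ⟨⟨k, b, l⟩, ⟨hk, hb, -⟩, rfl⟩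
    exact ⟨⟨by simpa [hHdef] using hb, re_cpow_mul_pos hk hb r⟩,
      grandZ_ofReal_mem_slitPlane hm hp hα hα' hpα hr hk hb l⟩
  obtain ⟨D, hDO, hDo, hDc, hball⟩ := exists_domain hO hS hSO
  refine ⟨D, hDo, hDc, fun k b l hk hb => ?_, fun κ β lam hz => ?_, fun z hz => ?_⟩
  · obtain ⟨ε, hε, h⟩ := hball (k, b, l) ⟨(k, b, l), ⟨hk, hb, trivial⟩, rfl⟩
    refine ⟨ε, hε, fun κ β lam h1 h2 h3 h4 h5 h6 => h ?_⟩
    subst h1 h2 h3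
    rw [Metric.mem_ball, Prod.dist_eq, Prod.dist_eq, max_lt_iff, max_lt_iff]
    exact ⟨dist_re_lt_of_abs_im_lt h4, dist_re_lt_of_abs_im_lt h5, dist_re_lt_of_abs_im_lt h6⟩
  · have h := hDO hz
    exact ⟨h.1.1, h.1.2, integrable_grandIntegrand hm hp hα hα' hpα hr h.1.2, h.2⟩
  · exact (hZ z (hDO hz).1).clog (hDO hz).2

end GrandCanonical

/-! ### The Fejér kernel as an approximate identity. -/

section Fejer

lemma sum_Icc_cos (k : ℕ) (t : ℝ) :
    ∑ j ∈ Finset.Icc (-(k : ℤ)) k, Real.cos (j * t) =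
      1 + 2 * ∑ j ∈ Finset.range k, Real.cos ((j + 1) * t) := by
  induction k with
  | zero => simp
  | succ k ih =>
    have e : Finset.Icc (-((k + 1 : ℕ) : ℤ)) (k + 1 : ℕ) =
        insert ((k : ℤ) + 1) (insert (-((k : ℤ) + 1)) (Finset.Icc (-(k : ℤ)) k)) := by
      ext j
      simp only [Finset.mem_Icc, Finset.mem_insert]
      push_cast
      omega
    rw [e, Finset.sum_insert, Finset.sum_insert, ih, Finset.sum_range_succ]
    · push_cast
      rw [neg_mul, Real.cos_neg]
      ring
    · simp only [Finset.mem_Icc]; omega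
    · simp only [Finset.mem_Icc, Finset.mem_insert]; omega

/-- The exponential sum whose squared modulus is the Fejér sum. -/
def expPartialSum (n : ℕ) (t : ℝ) : ℂ := ∑ k ∈ Finset.range n, Complex.exp (t * Complex.I) ^ k

lemma sum_cos_eq_normSq (n : ℕ) (t : ℝ) :
    ∑ k ∈ Finset.range n, ∑ j ∈ Finset.Icc (-(k : ℤ)) k, Real.cos (j * t) =
      ‖expPartialSum n t‖ ^ 2 := by
  have hexp : ∀ k : ℕ, Complex.exp (t * Complex.I) ^ k =
      Real.cos (k * t) + Real.sin (k * t) * Complex.I := by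
    intro k
    rw [← Complex.exp_nat_mul, ← mul_assoc, Complex.exp_mul_I]
    push_cast
    rfl
  induction n with
  | zero => simp [expPartialSum]
  | succ n ih =>
    have e : expPartialSum (n + 1) t = expPartialSum n t + Complex.exp (t * Complex.I) ^ n :=
      Finset.sum_range_succ _ _
    -- The cross term in `‖a + b‖²`; reversing the order of summation matches it with the cosines
    -- added by the next Dirichlet kernel.
    have e2 : (expPartialSum n t * (starRingEnd ℂ) (Complex.exp (t * Complex.I) ^ n)).re =
        ∑ j ∈ Finset.range n, Real.cos ((j + 1) * t) := by
      rw [expPartialSum, Finset.sum_mul, Complex.re_sum, ← Finset.sum_range_reflect]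
      refine Finset.sum_congr rfl fun j hj => ?_
      have hj' : j < n := Finset.mem_range.1 hj
      have hc : ((n - 1 - j : ℕ) : ℝ) = n - 1 - j := by
        rw [Nat.cast_sub (by omega), Nat.cast_sub (by omega)]; simp
      have hc2 : ((j : ℝ) + 1) * t = n * t - (n - 1 - j) * t := by ring
      rw [hexp, hexp, hc, hc2, Real.cos_sub]
      generalize Real.cos (n * t) = a, Real.sin (n * t) = b, Real.cos ((n - 1 - j) * t) = c,
        Real.sin ((n - 1 - j) * t) = d
      simp
      ring
    rw [Finset.sum_range_succ, ih, e, sum_Icc_cos, Complex.sq_norm, Complex.sq_norm,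
      Complex.normSq_add, e2, hexp n, Complex.normSq_add_mul_I, Real.cos_sq_add_sin_sq]
    ring

lemma fejer_of_abs_le (n : ℕ) {t : ℝ} (h : |t| ≤ Real.pi) :
    fejer n t = 1 / n * ‖expPartialSum n t‖ ^ 2 := by
  rw [fejer, if_pos h, sum_cos_eq_normSq]

lemma fejer_of_lt_abs (n : ℕ) {t : ℝ} (h : Real.pi < |t|) : fejer n t = 0 := by
  rw [fejer, if_neg (not_le.2 h)]

lemma fejer_nonneg (n : ℕ) (t : ℝ) : 0 ≤ fejer n t := by
  rcases le_or_gt |t| Real.pi with h | h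
  · rw [fejer_of_abs_le n h]; positivity
  · rw [fejer_of_lt_abs n h]

lemma measurable_fejer (n : ℕ) : Measurable (fejer n) := by
  unfold fejer
  refine Measurable.ite (measurableSet_le (by fun_prop) (by fun_prop)) ?_ measurable_const
  fun_prop

lemma fejer_le (n : ℕ) (t : ℝ) : fejer n t ≤ 1 / n * n ^ 2 := by
  rcases le_or_gt |t| Real.pi with h | h
  · rw [fejer_of_abs_le n h]
    gcongr
    refine (norm_sum_le _ _).trans ?_
    simp [Complex.norm_exp_ofReal_mul_I]
  · rw [fejer_of_lt_abs n h]; positivity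

lemma fejer_eq_indicator (n : ℕ) : fejer n = (Set.Icc (-Real.pi) Real.pi).indicator
    fun t => (1 / n : ℝ) * ∑ k ∈ Finset.range n, ∑ j ∈ Finset.Icc (-(k : ℤ)) k, Real.cos (j * t) := by
  funext t
  rw [fejer, Set.indicator_apply]
  simp only [Set.mem_Icc, ← abs_le]

/-- Only the `j = 0` term of each Dirichlet kernel survives integration over a period. -/
lemma integral_fejer {n : ℕ} (hn : n ≠ 0) : ∫ t, fejer n t = 2 * Real.pi := by
  have hpi := Real.pi_pos
  have hn' : (n : ℝ) ≠ 0 := by exact_mod_cast hn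
  have hcos : ∀ j : ℕ, ∫ t in (-Real.pi)..Real.pi, Real.cos ((j + 1) * t) = 0 := by
    intro j
    have hj : (j + 1 : ℝ) ≠ 0 := by positivity
    have hs : Real.sin ((j + 1) * Real.pi) = 0 := by
      have := Real.sin_nat_mul_pi (j + 1)
      push_cast at this
      exact this
    rw [intervalIntegral.integral_comp_mul_left _ hj, integral_cos, mul_neg, Real.sin_neg, hs]
    simp
  rw [fejer_eq_indicator, integral_indicator measurableSet_Icc, integral_Icc_eq_integral_Ioc,
    ← intervalIntegral.integral_of_le (by linarith), intervalIntegral.integral_const_mul]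
  have h : ∫ t in (-Real.pi)..Real.pi, ∑ k ∈ Finset.range n,
      ∑ j ∈ Finset.Icc (-(k : ℤ)) k, Real.cos (j * t) = n * (2 * Real.pi) := by
    rw [intervalIntegral.integral_finsetSum
      fun k _ => Continuous.intervalIntegrable (by fun_prop) _ _]
    have hk : ∀ k : ℕ, ∫ t in (-Real.pi)..Real.pi,
        ∑ j ∈ Finset.Icc (-(k : ℤ)) k, Real.cos (j * t) = 2 * Real.pi := by
      intro k
      simp only [sum_Icc_cos]
      rw [intervalIntegral.integral_add (Continuous.intervalIntegrable (by fun_prop) _ _)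
        (Continuous.intervalIntegrable (by fun_prop) _ _), intervalIntegral.integral_const_mul,
        intervalIntegral.integral_finsetSum
          fun k _ => Continuous.intervalIntegrable (by fun_prop) _ _]
      simp only [hcos, Finset.sum_const_zero, mul_zero, add_zero, intervalIntegral.integral_const]
      simp
      ring
    simp only [hk, Finset.sum_const, Finset.card_range, nsmul_eq_mul]
  rw [h]
  field_simp

/-- Away from the origin the Fejér kernel is of order `n⁻¹`. -/
lemma fejer_le_of_le_abs (n : ℕ) {δ t : ℝ} (hδ : 0 < δ) (hδ' : δ ≤ Real.pi) (ht : δ ≤ |t|) :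
    fejer n t ≤ 1 / n * (2 / (1 - Real.cos δ)) := by
  have hcosδ : Real.cos δ < 1 := by
    have := Real.cos_lt_cos_of_nonneg_of_le_pi le_rfl hδ' hδ
    rwa [Real.cos_zero] at this
  rcases le_or_gt |t| Real.pi with h | h
  · rw [fejer_of_abs_le n h]
    gcongr
    have h1 : Real.cos t ≤ Real.cos δ := by
      rw [← Real.cos_abs t]
      exact Real.cos_le_cos_of_nonneg_of_le_pi hδ.le h ht
    have h2 : ‖Complex.exp (t * Complex.I) - 1‖ ^ 2 = 2 - 2 * Real.cos t := by
      rw [Complex.exp_mul_I, ← Complex.ofReal_cos, ← Complex.ofReal_sin, Complex.sq_norm,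
        Complex.normSq_apply]
      have hsc := Real.sin_sq_add_cos_sq t
      generalize Real.cos t = a, Real.sin t = b at hsc ⊢
      simp
      nlinarith
    -- Multiplying the geometric sum by `exp (i t) - 1` telescopes it to `exp (i n t) - 1`, of
    -- modulus at most 2.
    have h3 : ‖expPartialSum n t‖ ^ 2 * (2 - 2 * Real.cos t) ≤ 4 := by
      rw [← h2, ← mul_pow, ← norm_mul, expPartialSum, geom_sum_mul]
      have h4 : ‖Complex.exp (t * Complex.I) ^ n - 1‖ ≤ 2 := by
        refine (norm_sub_le _ _).trans ?_
        rw [norm_pow, Complex.norm_exp_ofReal_mul_I]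
        norm_num
      calc _ ≤ (2 : ℝ) ^ 2 := by gcongr
        _ = 4 := by norm_num
    rw [le_div_iff₀ (by linarith)]
    have h5 : ‖expPartialSum n t‖ ^ 2 * (1 - Real.cos δ) ≤
        ‖expPartialSum n t‖ ^ 2 * (1 - Real.cos t) := by gcongr
    linarith
  · rw [fejer_of_lt_abs n h]
    have : 0 < 1 - Real.cos δ := by linarith
    positivity

/-- The Fejér kernels are an approximate identity. -/
lemma tendsto_integral_fejer {f : ℝ → ℝ} (hf : Integrable f) {a : ℝ} (ha : ContinuousAt f a) :
    Tendsto (fun n : ℕ => ∫ s, fejer n (a - s) * f s) atTop (𝓝 (2 * Real.pi * f a)) := by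
  have hpi := Real.pi_pos
  have hmain : Tendsto (fun n : ℕ => ∫ s, ((2 * Real.pi)⁻¹ * fejer n (a - s)) • f s) atTop
      (𝓝 (f a)) := by
    refine tendsto_integral_peak_smul_of_integrable_of_tendsto (x₀ := a)
      (t := Set.Icc (a - Real.pi) (a + Real.pi)) measurableSet_Icc
      (Icc_mem_nhds (by linarith) (by linarith)) (by simp) ?_ ?_ ?_ ?_ hf ha
    · exact Eventually.of_forall fun n s => mul_nonneg (by positivity) (fejer_nonneg _ _)
    · intro u hu hau
      obtain ⟨ε, hε, hball⟩ := Metric.isOpen_iff.1 hu a hau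
      set δ := min ε Real.pi with hδ
      have hδ0 : 0 < δ := lt_min hε hpi
      set B := (2 * Real.pi)⁻¹ * (2 / (1 - Real.cos δ))
      have hlim : Tendsto (fun n : ℕ => 1 / (n : ℝ) * B) atTop (𝓝 0) := by
        simpa using (tendsto_one_div_atTop_nhds_zero_nat (𝕜 := ℝ)).mul_const B
      rw [Metric.tendstoUniformlyOn_iff]
      intro e he
      filter_upwards [hlim.eventually (gt_mem_nhds he)] with n hn s hs
      have hsa : δ ≤ |a - s| := by
        by_contra! hlt
        refine hs (hball ?_)
        rw [Metric.mem_ball, dist_comm, Real.dist_eq]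
        exact hlt.trans_le (min_le_left _ _)
      have h1 := fejer_le_of_le_abs n hδ0 (min_le_right _ _) hsa
      rw [Pi.zero_apply, dist_zero_left, Real.norm_eq_abs,
        abs_of_nonneg (mul_nonneg (by positivity) (fejer_nonneg _ _))]
      calc (2 * Real.pi)⁻¹ * fejer n (a - s)
          ≤ (2 * Real.pi)⁻¹ * (1 / n * (2 / (1 - Real.cos δ))) := by gcongr
        _ = 1 / (n : ℝ) * B := by ring
        _ < e := hn
    · refine tendsto_const_nhds.congr' ?_
      -- At `n = 0` the kernel is identically zero because `1 / 0 = 0`, so the mass is `2π` only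
      -- from `n = 1` on.
      filter_upwards [eventually_ne_atTop 0] with n hn
      have h1 : ∫ s in Set.Icc (a - Real.pi) (a + Real.pi), fejer n (a - s) = ∫ s, fejer n (a - s) :=
        setIntegral_eq_integral_of_forall_compl_eq_zero fun s hs => by
          refine fejer_of_lt_abs n ?_
          by_contra! hle
          rw [abs_le] at hle
          exact hs ⟨by linarith, by linarith⟩
      rw [integral_const_mul, h1, integral_sub_left_eq_self (fejer n) volume a, integral_fejer hn]
      field_simp
    · exact Eventually.of_forall fun n =>
        (((measurable_fejer n).comp (by fun_prop)).const_mul _).aestronglyMeasurable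
  have h2 := hmain.const_mul (2 * Real.pi)
  refine h2.congr fun n => ?_
  rw [← integral_const_mul]
  refine integral_congr_ae (Eventually.of_forall fun s => ?_)
  simp only [smul_eq_mul]
  field_simp

lemma integrable_fejer_sub (n : ℕ) (a : ℝ) : Integrable fun s => fejer n (a - s) := by
  have h : Integrable (fejer n) := by
    rw [fejer_eq_indicator]
    refine IntegrableOn.integrable_indicator ?_ measurableSet_Icc
    exact Continuous.integrableOn_Icc (by fun_prop)
  exact h.comp_sub_left a

end Fejer

/-! ### Resampling one mode; small particle numbers. -/

section Resampling

variable {L m β : ℝ} [hL : Fact (0 < L)]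

/-- The path `φ` with its `i`-th coefficient replaced by `z`. -/
def resample (L : ℝ) [Fact (0 < L)] (i : ℤ) (φ : PathSpace L) (z : ℂ) : PathSpace L :=
  φ + (z - coeff L φ i) • modeC L i

lemma coeff_resample (i : ℤ) (φ : PathSpace L) (z : ℂ) :
    coeff L (resample L i φ z) = Function.update (coeff L φ) i z := by
  funext k
  rw [resample, ← coeffCLM_apply, map_add, map_smul, coeffCLM_apply, coeffCLM_apply, coeff_modeC]
  by_cases h : k = i
  · subst h; simp
  · simp [h]

lemma sqNorm_resample (i : ℤ) (φ : PathSpace L) (z : ℂ) :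
    sqNorm L (resample L i φ z) = sqNorm L φ - ‖coeff L φ i‖ ^ 2 + ‖z‖ ^ 2 := by
  have h1 := hasSum_sqNorm (resample L i φ z)
  have h2 := (hasSum_sqNorm φ).update i (‖z‖ ^ 2)
  rw [coeff_resample] at h1
  have e : (fun k => ‖Function.update (coeff L φ) i z k‖ ^ 2) =
      Function.update (fun k => ‖coeff L φ k‖ ^ 2) i (‖z‖ ^ 2) := by
    funext k
    by_cases h : k = i
    · subst h; simp
    · simp [h]
  rw [e] at h1
  rw [h1.unique h2]
  ring

lemma continuous_coeff_apply (i : ℤ) : Continuous fun φ : PathSpace L => coeff L φ i :=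
  (coeffCLM L i).continuous

lemma continuous_resample (i : ℤ) :
    Continuous fun q : PathSpace L × ℂ => resample L i q.1 q.2 := by
  have h := continuous_coeff_apply (L := L) i
  unfold resample
  fun_prop

lemma gaussMeasure_map_resample (hm : 0 < m) (hβ : 0 < β) (i : ℤ) :
    ((gaussMeasure L m β).prod (planeGaussian (theta L m β i))).map
      (fun q => resample L i q.1 q.2) = gaussMeasure L m β := by
  have := isProbabilityMeasure_gaussMeasure (L := L) hm hβ
  apply eq_gaussMeasure_of_map_coeff
  rw [Measure.map_map continuous_coeff.measurable (continuous_resample i).measurable]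
  have h := Measure.map_prod_map (gaussMeasure L m β) (planeGaussian (theta L m β i))
    (continuous_coeff (L := L)).measurable measurable_id
  rw [map_coeff_gaussMeasure hm hβ, Measure.map_id] at h
  have h' : coeff L ∘ (fun q : PathSpace L × ℂ => resample L i q.1 q.2) =
      (fun q : (ℤ → ℂ) × ℂ => Function.update q.1 i q.2) ∘ Prod.map (coeff L) id := by
    funext q
    exact coeff_resample i q.1 q.2
  rw [h', ← Measure.map_map (measurable_update i)
    (continuous_coeff.measurable.prodMap measurable_id), ← h, map_update_coeffLaw]

/-- The part of the particle number that does not come from the constant mode. -/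
def tailSq (L : ℝ) [Fact (0 < L)] (φ : PathSpace L) : ℝ := sqNorm L φ - ‖coeff L φ 0‖ ^ 2

lemma continuous_tailSq : Continuous (tailSq L) := by
  have h := continuous_coeff_apply (L := L) 0
  have h2 := continuous_sqNorm (L := L)
  unfold tailSq
  fun_prop

lemma tailSq_nonneg (φ : PathSpace L) : 0 ≤ tailSq L φ :=
  sub_nonneg.2 (le_hasSum (hasSum_sqNorm φ) 0 fun _ _ => by positivity)

lemma tailSq_le_sqNorm (φ : PathSpace L) : tailSq L φ ≤ sqNorm L φ :=
  sub_le_self _ (by positivity)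

lemma sqNorm_resample_zero (φ : PathSpace L) (z : ℂ) :
    sqNorm L (resample L 0 φ z) = tailSq L φ + ‖z‖ ^ 2 := sqNorm_resample 0 φ z

/-- Resample mode 1: with all other modes fixed, `tailSq` is a constant plus `‖z‖²`, and circles are
null for the planar Gaussian. -/
lemma ae_tailSq_ne (hm : 0 < m) (hβ : 0 < β) (t : ℝ) :
    ∀ᵐ φ ∂gaussMeasure L m β, tailSq L φ ≠ t := by
  have := isProbabilityMeasure_gaussMeasure (L := L) hm hβ
  have hmeas : MeasurableSet {φ : PathSpace L | tailSq L φ ≠ t} :=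
    (measurableSet_eq_fun continuous_tailSq.measurable measurable_const).compl
  have hmeas2 : MeasurableSet {q : PathSpace L × ℂ | tailSq L (resample L 1 q.1 q.2) ≠ t} :=
    (continuous_resample 1).measurable hmeas
  rw [← gaussMeasure_map_resample hm hβ 1, ae_map_iff (continuous_resample 1).aemeasurable hmeas,
    Measure.ae_prod_iff_ae_ae hmeas2]
  refine Eventually.of_forall fun φ => ?_
  have h := planeGaussian_sphere (theta_pos (L := L) hm hβ 1)
    (t - (sqNorm L φ - ‖coeff L φ 1‖ ^ 2 - ‖coeff L φ 0‖ ^ 2))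
  rw [ae_iff]
  refine measure_mono_null (fun z hz => ?_) h
  have hz' : tailSq L (resample L 1 φ z) = t := not_not.1 hz
  rw [tailSq, sqNorm_resample, coeff_resample, Function.update_of_ne (by norm_num)] at hz'
  change ‖z‖ ^ 2 = _
  linarith

lemma tsum_inv_theta_ne_top (hm : 0 < m) (hβ : 0 < β) :
    ∑' k : ℤ, ENNReal.ofReal (8 * (theta L m β k)⁻¹) ≠ ⊤ := by
  have hL0 := hL.out
  have hpi := Real.pi_pos
  have hs : Summable fun k : ℤ => 8 * (theta L m β k)⁻¹ := by
    refine Summable.mul_left _ ?_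
    have h2 : Summable fun k : ℤ => (β * (2 * Real.pi / L) ^ 2)⁻¹ * (1 / (k : ℝ) ^ 2) :=
      ((Real.summable_one_div_int_pow (p := 2)).2 one_lt_two).mul_left _
    refine Summable.of_norm_bounded_eventually h2 ?_
    rw [Filter.eventually_cofinite]
    refine (Set.finite_singleton (0 : ℤ)).subset fun k hk => ?_
    by_contra h0
    refine hk ?_
    have hk0 : (k : ℝ) ≠ 0 := by exact_mod_cast h0
    rw [Real.norm_eq_abs, abs_of_pos (inv_pos.2 (theta_pos hm hβ k)), one_div, ← mul_inv]
    refine inv_anti₀ (by positivity) ?_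
    unfold theta
    have e : (2 * Real.pi * k / L) ^ 2 = (2 * Real.pi / L) ^ 2 * (k : ℝ) ^ 2 := by ring
    rw [e, mul_assoc]
    gcongr
    linarith [sq_nonneg m]
  rw [← ENNReal.ofReal_tsum_of_nonneg
    (fun k => by have := theta_pos (L := L) hm hβ k; positivity) hs]
  exact ENNReal.ofReal_ne_top

lemma ofReal_sqNorm_eq (s : Finset ℤ) (φ : PathSpace L) :
    ENNReal.ofReal (sqNorm L φ) = ENNReal.ofReal (∑ k ∈ s, ‖coeff L φ k‖ ^ 2) +
      ∑' k : {k : ℤ // k ∉ s}, ENNReal.ofReal (‖coeff L φ k‖ ^ 2) := by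
  have hs := (hasSum_sqNorm φ).summable
  have hs' : Summable fun k : {k : ℤ // k ∉ s} => ‖coeff L φ k‖ ^ 2 := hs.subtype _
  rw [← ENNReal.ofReal_tsum_of_nonneg (fun _ => by positivity) hs',
    ← ENNReal.ofReal_add (Finset.sum_nonneg fun _ _ => by positivity)
      (tsum_nonneg fun _ => by positivity), ← (hasSum_sqNorm φ).tsum_eq]
  congr 1
  exact (hs.sum_add_tsum_subtype_compl s).symm

/-- The particle number is small with positive probability. -/
lemma gaussMeasure_sqNorm_lt_pos (hm : 0 < m) (hβ : 0 < β) {n : ℝ} (hn : 0 < n) :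
    0 < gaussMeasure L m β {φ | sqNorm L φ < n} := by
  by_contra! h0
  have h0 : gaussMeasure L m β {φ | sqNorm L φ < n} = 0 := le_antisymm h0 zero_le
  -- Suppose `N ≥ n` almost surely. Choose finitely many modes `s` so that the bounds on the
  -- remaining second moments sum to less than `n / 4`, and let `B` be the event that the modes in
  -- `s` contribute at most `n / 2`. On `B` the tail would be at least `n / 2`, contradicting its
  -- mean.
  have hae : ∀ᵐ φ ∂gaussMeasure L m β, n ≤ sqNorm L φ := by
    rw [ae_iff]; simpa using h0
  have htail := ENNReal.tendsto_tsum_compl_atTop_zero (tsum_inv_theta_ne_top (L := L) hm hβ)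
  obtain ⟨s, hs⟩ := (htail.eventually (gt_mem_nhds
    (show (0 : ENNReal) < ENNReal.ofReal (n / 4) by simpa using by positivity))).exists
  -- The `+ 1` allows `s` to be empty and keeps the total over `s` within `n / 2`.
  set δ := n / (2 * (s.card + 1)) with hδ
  have hδ0 : 0 < δ := by positivity
  set B : Set (ℤ → ℂ) := Set.pi s fun _ => {z : ℂ | ‖z‖ ^ 2 < δ} with hB
  have hball : MeasurableSet {z : ℂ | ‖z‖ ^ 2 < δ} := measurableSet_lt (by fun_prop) measurable_const
  have hBm : MeasurableSet B := MeasurableSet.pi s.countable_toSet fun _ _ => hball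
  have hBpos : 0 < coeffLaw L m β B := by
    rw [coeffLaw, hB, Measure.infinitePi_pi _ fun _ _ => hball]
    rw [pos_iff_ne_zero, Finset.prod_ne_zero_iff]
    exact fun k _ => (planeGaussian_ball_pos (theta_pos hm hβ k) hδ0).ne'
  have hFm : ∀ k : ℤ, Measurable fun X : ℤ → ℂ =>
      B.indicator 1 X * ENNReal.ofReal (‖X k‖ ^ 2) := fun k =>
    (measurable_one.indicator hBm).mul (by fun_prop)
  have hterm : ∀ k : {k : ℤ // k ∉ s},
      ∫⁻ X, B.indicator 1 X * ENNReal.ofReal (‖X k‖ ^ 2) ∂coeffLaw L m β ≤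
        coeffLaw L m β B * ENNReal.ofReal (8 * (theta L m β k)⁻¹) := by
    intro k
    -- Independence: `B` does not see the coordinate `k ∉ s`, so resampling it factors the integral.
    rw [lintegral_coeffLaw_update (k : ℤ) (hFm k)]
    have e : ∀ (X : ℤ → ℂ) (z : ℂ), B.indicator (1 : (ℤ → ℂ) → ENNReal) (Function.update X k z) =
        B.indicator 1 X := by
      intro X z
      have : Function.update X k z ∈ B ↔ X ∈ B := by
        simp only [hB, Set.mem_pi]
        refine forall₂_congr fun j hj => ?_
        rw [Function.update_of_ne (ne_of_mem_of_not_mem hj k.2)]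
      by_cases hX : X ∈ B
      · rw [Set.indicator_of_mem hX, Set.indicator_of_mem (this.2 hX)]; rfl
      · rw [Set.indicator_of_notMem hX, Set.indicator_of_notMem (mt this.1 hX)]
    simp only [e, Function.update_self]
    have e2 : ∀ X : ℤ → ℂ, ∫⁻ z, B.indicator 1 X * ENNReal.ofReal (‖z‖ ^ 2)
        ∂planeGaussian (theta L m β k) ≤
        B.indicator 1 X * ENNReal.ofReal (8 * (theta L m β k)⁻¹) := by
      intro X
      rw [lintegral_const_mul _ (by fun_prop)]
      gcongr
      exact lintegral_planeGaussian_sq_le (theta_pos hm hβ k)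
    refine (lintegral_mono e2).trans ?_
    rw [lintegral_mul_const _ (measurable_one.indicator hBm), lintegral_indicator_one hBm]
  have hupper : ∫⁻ X, ∑' k : {k : ℤ // k ∉ s}, B.indicator 1 X * ENNReal.ofReal (‖X k‖ ^ 2)
      ∂coeffLaw L m β ≤ coeffLaw L m β B * ENNReal.ofReal (n / 4) := by
    rw [lintegral_tsum fun k : {k : ℤ // k ∉ s} => (hFm k).aemeasurable]
    refine (ENNReal.tsum_le_tsum hterm).trans ?_
    rw [ENNReal.tsum_mul_left]
    gcongr
  have hlower : coeffLaw L m β B * ENNReal.ofReal (n / 2) ≤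
      ∫⁻ X, ∑' k : {k : ℤ // k ∉ s}, B.indicator 1 X * ENNReal.ofReal (‖X k‖ ^ 2)
        ∂coeffLaw L m β := by
    rw [← lintegral_indicator_one hBm, ← lintegral_mul_const _ (measurable_one.indicator hBm),
      ← lintegral_gaussMeasure_coeff hm hβ ((measurable_one.indicator hBm).mul_const _),
      ← lintegral_gaussMeasure_coeff hm hβ (Measurable.tsum fun k : {k : ℤ // k ∉ s} => hFm k)]
    refine lintegral_mono_ae (hae.mono fun φ hφ => ?_)
    rw [ENNReal.tsum_mul_left]
    by_cases hmem : coeff L φ ∈ B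
    · simp only [Set.indicator_of_mem hmem, Pi.one_apply, one_mul]
      have h1 : ∑ k ∈ s, ‖coeff L φ k‖ ^ 2 ≤ n / 2 := by
        calc ∑ k ∈ s, ‖coeff L φ k‖ ^ 2 ≤ ∑ _k ∈ s, δ :=
              Finset.sum_le_sum fun k hk => le_of_lt (hmem k hk)
          _ = s.card * δ := by rw [Finset.sum_const, nsmul_eq_mul]
          _ ≤ (s.card + 1) * δ := by gcongr; linarith
          _ = n / 2 := by rw [hδ]; field_simp
      have h2 := ofReal_sqNorm_eq s φ
      have h3 : ENNReal.ofReal (n / 2) + ENNReal.ofReal (n / 2) ≤ ENNReal.ofReal (n / 2) +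
          ∑' k : {k : ℤ // k ∉ s}, ENNReal.ofReal (‖coeff L φ k‖ ^ 2) := by
        calc _ = ENNReal.ofReal n := by
              rw [← ENNReal.ofReal_add (by positivity) (by positivity), add_halves]
          _ ≤ ENNReal.ofReal (sqNorm L φ) := ENNReal.ofReal_le_ofReal hφ
          _ ≤ _ := by rw [h2]; gcongr
      exact (ENNReal.add_le_add_iff_left ENNReal.ofReal_ne_top).1 h3
    · simp [Set.indicator_of_notMem hmem]
  have hle := hlower.trans hupper
  rw [ENNReal.mul_le_mul_iff_right hBpos.ne' (measure_ne_top _ _),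
    ENNReal.ofReal_le_ofReal_iff (by positivity)] at hle
  linarith

end Resampling

/-! ### The conditional law as a limit of Fejér averages. -/

section Conditional

variable {L m β : ℝ} [hL : Fact (0 < L)]

/-- Integration against a density normalized to a probability measure. -/
lemma integral_normalized {Ω : Type*} [MeasurableSpace Ω] {ρ : Measure Ω} {w : Ω → ℝ}
    (hw : Measurable w) (hw0 : ∀ x, 0 ≤ w x) (hint : Integrable w ρ) (f : Ω → ℝ) :
    ∫ x, f x ∂((∫⁻ x, ENNReal.ofReal (w x) ∂ρ)⁻¹ • ρ.withDensity fun x => ENNReal.ofReal (w x)) =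
      (∫ x, w x ∂ρ)⁻¹ * ∫ x, w x * f x ∂ρ := by
  rw [integral_smul_measure, integral_withDensity_eq_integral_toReal_smul (by fun_prop)
    (Eventually.of_forall fun _ => ENNReal.ofReal_lt_top),
    ← ofReal_integral_eq_lintegral_ofReal hint (Eventually.of_forall hw0), ENNReal.toReal_inv,
    ENNReal.toReal_ofReal (integral_nonneg hw0), smul_eq_mul]
  simp only [ENNReal.toReal_ofReal (hw0 _), smul_eq_mul]

lemma isProbabilityMeasure_normalized {Ω : Type*} [MeasurableSpace Ω] {ρ : Measure Ω} {w : Ω → ℝ}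
    (hw0 : ∀ x, 0 ≤ w x) (hint : Integrable w ρ) (hpos : 0 < ∫ x, w x ∂ρ) :
    IsProbabilityMeasure
      ((∫⁻ x, ENNReal.ofReal (w x) ∂ρ)⁻¹ • ρ.withDensity fun x => ENNReal.ofReal (w x)) := by
  constructor
  rw [← ofReal_integral_eq_lintegral_ofReal hint (Eventually.of_forall hw0), Measure.smul_apply,
    withDensity_apply _ MeasurableSet.univ, Measure.restrict_univ,
    ← ofReal_integral_eq_lintegral_ofReal hint (Eventually.of_forall hw0), smul_eq_mul]
  exact ENNReal.inv_mul_cancel (by simpa using hpos) ENNReal.ofReal_ne_top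

/-- The density of the exponential law `expLaw θ`, as a function on the line. -/
def expDensity (θ s : ℝ) : ℝ := (Set.Ioi (0 : ℝ)).indicator (fun s => θ / 2 * Real.exp (-(θ * s / 2))) s

lemma measurable_expDensity (θ : ℝ) : Measurable (expDensity θ) :=
  Measurable.indicator (by fun_prop) measurableSet_Ioi

lemma expDensity_nonneg {θ : ℝ} (hθ : 0 < θ) (s : ℝ) : 0 ≤ expDensity θ s :=
  Set.indicator_nonneg (fun _ _ => by positivity) s

lemma expDensity_le {θ : ℝ} (hθ : 0 < θ) (s : ℝ) : expDensity θ s ≤ θ / 2 := by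
  refine Set.indicator_le' (g := fun _ => θ / 2) (fun s hs => ?_) (fun _ _ => by positivity) s
  have hs' : (0 : ℝ) < s := hs
  have : Real.exp (-(θ * s / 2)) ≤ 1 := Real.exp_le_one_iff.2 (by
    have : 0 < θ * s / 2 := by positivity
    linarith)
  nlinarith

lemma integrable_expDensity {θ : ℝ} (hθ : 0 < θ) : Integrable (expDensity θ) := by
  refine IntegrableOn.integrable_indicator ?_ measurableSet_Ioi
  have h : IntegrableOn (fun s : ℝ => Real.exp (-(θ / 2) * s)) (Set.Ioi 0) :=
    integrableOn_exp_mul_Ioi (by linarith) 0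
  refine (h.const_mul (θ / 2)).congr (Eventually.of_forall fun s => ?_)
  simp only
  congr 2
  ring

lemma continuousAt_expDensity {θ a : ℝ} (ha : a ≠ 0) : ContinuousAt (expDensity θ) a := by
  rcases lt_or_gt_of_ne ha with h | h
  · refine continuousAt_const.congr (f := fun _ => (0 : ℝ)) ?_
    filter_upwards [gt_mem_nhds h] with s hs
    have hs' : s ∉ Set.Ioi (0 : ℝ) := not_lt.2 (le_of_lt hs)
    rw [expDensity, Set.indicator_of_notMem hs']
  · refine ContinuousAt.congr (f := fun s => θ / 2 * Real.exp (-(θ * s / 2))) (by fun_prop) ?_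
    filter_upwards [lt_mem_nhds h] with s hs
    have hs' : s ∈ Set.Ioi (0 : ℝ) := hs
    rw [expDensity, Set.indicator_of_mem hs']

lemma integral_expLaw {θ : ℝ} (hθ : 0 < θ) (f : ℝ → ℝ) :
    ∫ s, f s ∂expLaw θ = ∫ s, expDensity θ s * f s := by
  rw [expLaw, integral_withDensity_eq_integral_toReal_smul (by fun_prop)
    (Eventually.of_forall fun _ => ENNReal.ofReal_lt_top), ← integral_indicator measurableSet_Ioi]
  refine integral_congr_ae (Eventually.of_forall fun s => ?_)
  by_cases hs : s ∈ Set.Ioi (0 : ℝ)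
  · simp only [expDensity, Set.indicator_of_mem hs, smul_eq_mul]
    rw [ENNReal.toReal_ofReal (by positivity)]
  · simp only [expDensity, Set.indicator_of_notMem hs, zero_mul]

/-- The joint law of the path and an independent uniform angle. -/
def pathAngle (L m β : ℝ) [Fact (0 < L)] : Measure (PathSpace L × ℝ) :=
  (gaussMeasure L m β).prod angLaw

/-- The path whose constant mode is replaced by the point with squared modulus `s` and argument
`ω`. -/
def polarResample (L : ℝ) [Fact (0 < L)] (q : (PathSpace L × ℝ) × ℝ) : PathSpace L :=
  resample L 0 q.1.1 (radialPoint q.2 q.1.2)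

lemma continuous_polarResample : Continuous (polarResample L) := by
  have h1 := continuous_resample (L := L) 0
  have h2 := continuous_radialPoint
  exact h1.comp ((continuous_fst.comp continuous_fst).prodMk
    (h2.comp (continuous_snd.prodMk (continuous_snd.comp continuous_fst))))

lemma sqNorm_polarResample (q : PathSpace L × ℝ) {s : ℝ} (hs : 0 ≤ s) :
    sqNorm L (polarResample L (q, s)) = tailSq L q.1 + s := by
  rw [polarResample, sqNorm_resample_zero, norm_radialPoint_sq hs]

lemma isProbabilityMeasure_pathAngle (hm : 0 < m) (hβ : 0 < β) :
    IsProbabilityMeasure (pathAngle L m β) := by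
  have := isProbabilityMeasure_gaussMeasure (L := L) hm hβ
  unfold pathAngle
  infer_instance

/-- Resampling the zero mode preserves the law, and the fresh Gaussian is an independent angle and
an exponential squared modulus. The particle number is then `tailSq` plus that exponential variable.
-/
lemma map_polarResample (hm : 0 < m) (hβ : 0 < β) :
    ((pathAngle L m β).prod (expLaw (theta L m β 0))).map (polarResample L) =
      gaussMeasure L m β := by
  have := isProbabilityMeasure_gaussMeasure (L := L) hm hβ
  have hθ := theta_pos (L := L) hm hβ 0
  have hrad : Measurable fun q : ℝ × ℝ => radialPoint q.2 q.1 :=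
    (continuous_radialPoint.comp continuous_swap).measurable
  have h1 : planeGaussian (theta L m β 0) =
      (angLaw.prod (expLaw (theta L m β 0))).map fun q => radialPoint q.2 q.1 := by
    rw [planeGaussian_eq_map_polar hθ, ← Measure.prod_swap,
      Measure.map_map continuous_radialPoint.measurable measurable_swap]
    rfl
  have h2 := gaussMeasure_map_resample (L := L) hm hβ 0
  have h3 := Measure.map_prod_map (gaussMeasure L m β) (angLaw.prod (expLaw (theta L m β 0)))
    measurable_id hrad
  rw [Measure.map_id, ← h1] at h3
  have h4 := (measurePreserving_prodAssoc (gaussMeasure L m β) angLaw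
    (expLaw (theta L m β 0))).map_eq
  rw [h3, ← h4, Measure.map_map (measurable_id.prodMap hrad) MeasurableEquiv.prodAssoc.measurable,
    Measure.map_map (continuous_resample 0).measurable
      ((measurable_id.prodMap hrad).comp MeasurableEquiv.prodAssoc.measurable)] at h2
  exact h2

/-- The weight of the conditional law: the conditional density of the particle number. -/
def condWeight (L m β n : ℝ) [Fact (0 < L)] (q : PathSpace L × ℝ) : ℝ :=
  expDensity (theta L m β 0) (n - tailSq L q.1)

/-- The path with particle number `n` with the same higher modes. -/
def condPath (L n : ℝ) [Fact (0 < L)] (q : PathSpace L × ℝ) : PathSpace L :=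
  polarResample L (q, n - tailSq L q.1)

/-- The explicit form of the law conditioned on the particle number. -/
def condLaw (L m n β : ℝ) [Fact (0 < L)] : Measure (PathSpace L) :=
  ((∫⁻ q, ENNReal.ofReal (condWeight L m β n q) ∂pathAngle L m β)⁻¹ •
    (pathAngle L m β).withDensity fun q => ENNReal.ofReal (condWeight L m β n q)).map (condPath L n)

lemma continuous_condPath (n : ℝ) : Continuous (condPath L n) :=
  continuous_polarResample.comp (continuous_id.prodMk
    (continuous_const.sub (continuous_tailSq.comp continuous_fst)))

lemma measurable_condWeight (n : ℝ) : Measurable (condWeight L m β n) :=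
  (measurable_expDensity _).comp
    (measurable_const.sub (continuous_tailSq.measurable.comp measurable_fst))

lemma condWeight_nonneg (hm : 0 < m) (hβ : 0 < β) (n : ℝ) (q : PathSpace L × ℝ) :
    0 ≤ condWeight L m β n q :=
  expDensity_nonneg (theta_pos hm hβ 0) _

lemma integrable_condWeight (hm : 0 < m) (hβ : 0 < β) (n : ℝ) :
    Integrable (condWeight L m β n) (pathAngle L m β) := by
  have := isProbabilityMeasure_pathAngle (L := L) hm hβ
  have hθ := theta_pos (L := L) hm hβ 0
  refine Integrable.of_bound (measurable_condWeight n).aestronglyMeasurable (theta L m β 0 / 2)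
    (Eventually.of_forall fun q => ?_)
  rw [Real.norm_eq_abs, condWeight, abs_of_nonneg (expDensity_nonneg hθ _)]
  exact expDensity_le hθ _

/-- Where `N < n`, the tail is also below `n`, so the density is positive there, and this event has
positive probability. -/
lemma integral_condWeight_pos (hm : 0 < m) (hβ : 0 < β) {n : ℝ} (hn : 0 < n) :
    0 < ∫ q, condWeight L m β n q ∂pathAngle L m β := by
  have := isProbabilityMeasure_gaussMeasure (L := L) hm hβ
  have hθ := theta_pos (L := L) hm hβ 0
  rw [integral_pos_iff_support_of_nonneg (condWeight_nonneg hm hβ n)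
    (integrable_condWeight hm hβ n)]
  have hsub : {φ : PathSpace L | sqNorm L φ < n} ×ˢ (Set.univ : Set ℝ) ⊆
      Function.support (condWeight L m β n) := by
    rintro ⟨φ, ω⟩ ⟨hφ, -⟩
    have hφ' : sqNorm L φ < n := hφ
    have h1 : n - tailSq L φ ∈ Set.Ioi (0 : ℝ) := by
      have := tailSq_le_sqNorm φ
      simp only [Set.mem_Ioi]
      linarith
    rw [Function.mem_support, condWeight, expDensity, Set.indicator_of_mem h1]
    positivity
  refine lt_of_lt_of_le ?_ (measure_mono hsub)
  rw [pathAngle, Measure.prod_prod, measure_univ, mul_one]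
  exact gaussMeasure_sqNorm_lt_pos hm hβ hn

lemma isProbabilityMeasure_condLaw (hm : 0 < m) (hβ : 0 < β) {n : ℝ} (hn : 0 < n) :
    IsProbabilityMeasure (condLaw L m n β) := by
  have := isProbabilityMeasure_normalized (condWeight_nonneg (L := L) hm hβ n)
    (integrable_condWeight hm hβ n) (integral_condWeight_pos (L := L) hm hβ hn)
  exact Measure.isProbabilityMeasure_map (continuous_condPath n).measurable.aemeasurable

lemma integral_condLaw (hm : 0 < m) (hβ : 0 < β) (n : ℝ)
    (f : BoundedContinuousFunction (PathSpace L) ℝ) :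
    ∫ φ, f φ ∂condLaw L m n β = (∫ q, condWeight L m β n q ∂pathAngle L m β)⁻¹ *
      ∫ q, condWeight L m β n q * f (condPath L n q) ∂pathAngle L m β := by
  rw [condLaw, integral_map (continuous_condPath n).measurable.aemeasurable
    f.continuous.aestronglyMeasurable]
  exact integral_normalized (measurable_condWeight n) (condWeight_nonneg hm hβ n)
    (integrable_condWeight hm hβ n) fun q => f (condPath L n q)

lemma measurable_fejer_sqNorm (l : ℕ) (n : ℝ) :
    Measurable fun φ : PathSpace L => fejer l (n - sqNorm L φ) :=
  (measurable_fejer l).comp (measurable_const.sub continuous_sqNorm.measurable)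

lemma integral_fejerMeasure (hm : 0 < m) (hβ : 0 < β) (n : ℝ) (l : ℕ)
    (f : PathSpace L → ℝ) :
    ∫ φ, f φ ∂fejerMeasure L m n β l =
      (∫ φ, fejer l (n - sqNorm L φ) ∂gaussMeasure L m β)⁻¹ *
        ∫ φ, fejer l (n - sqNorm L φ) * f φ ∂gaussMeasure L m β := by
  have := isProbabilityMeasure_gaussMeasure (L := L) hm hβ
  refine integral_normalized (measurable_fejer_sqNorm l n) (fun _ => fejer_nonneg _ _) ?_ f
  refine Integrable.of_bound (measurable_fejer_sqNorm l n).aestronglyMeasurable (1 / l * l ^ 2)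
    (Eventually.of_forall fun φ => ?_)
  rw [Real.norm_eq_abs, abs_of_nonneg (fejer_nonneg _ _)]
  exact fejer_le _ _

/-- Fejér averages of a bounded continuous function converge to the corresponding integral over the
paths with given particle number. -/
lemma tendsto_integral_fejer_sqNorm (hm : 0 < m) (hβ : 0 < β) (n : ℝ)
    (f : BoundedContinuousFunction (PathSpace L) ℝ) :
    Tendsto (fun l : ℕ => ∫ φ, fejer l (n - sqNorm L φ) * f φ ∂gaussMeasure L m β) atTop
      (𝓝 (2 * Real.pi *
        ∫ q, condWeight L m β n q * f (condPath L n q) ∂pathAngle L m β)) := by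
  have hpi := Real.pi_pos
  have hprob := isProbabilityMeasure_gaussMeasure (L := L) hm hβ
  have hprob2 := isProbabilityMeasure_pathAngle (L := L) hm hβ
  have hθ := theta_pos (L := L) hm hβ 0
  set θ := theta L m β 0 with hθdef
  have hfb : ∀ φ, |f φ| ≤ ‖f‖ := fun φ => f.norm_coe_le_norm φ
  have hG : ∀ l : ℕ, Integrable (fun φ => fejer l (n - sqNorm L φ) * f φ)
      (gaussMeasure L m β) := fun l => by
    refine Integrable.of_bound ((measurable_fejer_sqNorm l n).mul
      f.continuous.measurable).aestronglyMeasurable (1 / l * l ^ 2 * ‖f‖)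
      (Eventually.of_forall fun φ => ?_)
    rw [Real.norm_eq_abs, abs_mul, abs_of_nonneg (fejer_nonneg _ _)]
    gcongr
    · exact fejer_le _ _
    · exact hfb φ
  -- Disintegrate along the squared modulus `s` of the zero mode. For a fixed path and angle the
  -- inner integral is a Fejér average at `n - tailSq`, bounded uniformly in `l ≥ 1`, so dominated
  -- convergence applies.
  have hstep : ∀ l : ℕ, ∫ φ, fejer l (n - sqNorm L φ) * f φ ∂gaussMeasure L m β =
      ∫ q, (∫ s, fejer l (n - tailSq L q.1 - s) *
        (expDensity θ s * f (polarResample L (q, s)))) ∂pathAngle L m β := by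
    intro l
    have h1 := hG l
    conv_lhs => rw [← map_polarResample hm hβ]
    rw [← map_polarResample hm hβ] at h1
    have h2 : Integrable (fun x => fejer l (n - sqNorm L (polarResample L x)) *
        f (polarResample L x)) ((pathAngle L m β).prod (expLaw (theta L m β 0))) :=
      h1.comp_measurable continuous_polarResample.measurable
    rw [integral_map continuous_polarResample.measurable.aemeasurable h1.aestronglyMeasurable,
      integral_prod _ h2]
    refine integral_congr_ae (Eventually.of_forall fun q => ?_)
    simp only
    rw [integral_expLaw hθ]
    refine integral_congr_ae (Eventually.of_forall fun s => ?_)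
    by_cases hs : s ∈ Set.Ioi (0 : ℝ)
    · simp only
      rw [sqNorm_polarResample q (le_of_lt hs)]
      rw [← sub_sub]
      ring
    · simp only [expDensity, Set.indicator_of_notMem hs]
      ring
  simp only [hstep]
  rw [← integral_const_mul]
  have hpm : ∀ q : PathSpace L × ℝ, Continuous fun s : ℝ => f (polarResample L (q, s)) := fun q =>
    f.continuous.comp (continuous_polarResample.comp (by fun_prop))
  refine tendsto_integral_filter_of_dominated_convergence (fun _ => 2 * Real.pi * (θ / 2 * ‖f‖))
    ?_ ?_ (integrable_const _) ?_
  · refine Eventually.of_forall fun l => ?_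
    have hm2 : Measurable fun q : (PathSpace L × ℝ) × ℝ =>
        fejer l (n - tailSq L q.1.1 - q.2) * (expDensity θ q.2 * f (polarResample L q)) := by
      refine Measurable.mul ((measurable_fejer l).comp ?_)
        (((measurable_expDensity θ).comp measurable_snd).mul
          (f.continuous.comp continuous_polarResample).measurable)
      exact (measurable_const.sub (continuous_tailSq.measurable.comp
        (measurable_fst.comp measurable_fst))).sub measurable_snd
    exact (hm2.stronglyMeasurable.integral_prod_right' (ν := volume)).aestronglyMeasurable
  · filter_upwards [eventually_ne_atTop 0] with l hl
    refine Eventually.of_forall fun q => ?_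
    have hb : ∀ s, ‖fejer l (n - tailSq L q.1 - s) *
        (expDensity θ s * f (polarResample L (q, s)))‖ ≤
        fejer l (n - tailSq L q.1 - s) * (θ / 2 * ‖f‖) := by
      intro s
      rw [norm_mul, norm_mul, Real.norm_eq_abs, Real.norm_eq_abs,
        abs_of_nonneg (fejer_nonneg _ _), abs_of_nonneg (expDensity_nonneg hθ s)]
      gcongr
      · exact fejer_nonneg _ _
      · exact expDensity_le hθ s
      · exact hfb _
    refine (norm_integral_le_of_norm_le
      ((integrable_fejer_sub l (n - tailSq L q.1)).mul_const (θ / 2 * ‖f‖))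
      (Eventually.of_forall hb)).trans_eq ?_
    rw [integral_mul_const, integral_sub_left_eq_self (fejer l) volume (n - tailSq L q.1),
      integral_fejer hl]
  -- The exponential density jumps at 0, so the approximate identity needs `n - tailSq` to be
  -- nonzero; this holds almost surely.
  · have hne : ∀ᵐ q ∂pathAngle L m β, tailSq L q.1 ≠ n :=
      Measure.quasiMeasurePreserving_fst.ae (ae_tailSq_ne hm hβ n)
    filter_upwards [hne] with q hq
    have hcont : ContinuousAt (fun s => expDensity θ s * f (polarResample L (q, s)))
        (n - tailSq L q.1) :=
      (continuousAt_expDensity (sub_ne_zero.2 hq.symm)).mul (hpm q).continuousAt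
    refine tendsto_integral_fejer ?_ hcont
    exact (integrable_expDensity hθ).mul_bdd (c := ‖f‖) (hpm q).aestronglyMeasurable
      (Eventually.of_forall fun s => hfb _)

/-- The normalizer is the same Fejér average with `f = 1`; its limit is positive, so the quotient
converges and the factors `2π` cancel. -/
lemma isConditionalLaw_condLaw (hm : 0 < m) (hβ : 0 < β) {n : ℝ} (hn : 0 < n) :
    IsConditionalLaw L m n β (condLaw L m n β) := by
  refine ⟨isProbabilityMeasure_condLaw hm hβ hn, fun f => ?_⟩
  have hpi := Real.pi_pos
  have hpos := integral_condWeight_pos (L := L) hm hβ hn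
  have h1 := tendsto_integral_fejer_sqNorm (L := L) hm hβ n
    (BoundedContinuousFunction.const (PathSpace L) (1 : ℝ))
  have h2 := tendsto_integral_fejer_sqNorm (L := L) hm hβ n f
  simp only [BoundedContinuousFunction.const_apply, mul_one] at h1
  simp only [integral_fejerMeasure hm hβ, integral_condLaw hm hβ]
  have h3 := (h1.inv₀ (by positivity)).mul h2
  convert h3 using 2
  field_simp

lemma isConditionalLaw_unique {n : ℝ} {ν₁ ν₂ : Measure (PathSpace L)}
    (h₁ : IsConditionalLaw L m n β ν₁) (h₂ : IsConditionalLaw L m n β ν₂) : ν₁ = ν₂ := by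
  have := h₁.1
  have := h₂.1
  exact ext_of_forall_integral_eq_of_IsFiniteMeasure fun f =>
    tendsto_nhds_unique (h₁.2 f) (h₂.2 f)

lemma isConditionalLaw_condMeasure (hm : 0 < m) (hβ : 0 < β) {n : ℝ} (hn : 0 < n) :
    IsConditionalLaw L m n β (condMeasure L m n β) := by
  have h : ∃ ν, IsConditionalLaw L m n β ν := ⟨_, isConditionalLaw_condLaw hm hβ hn⟩
  rw [condMeasure, dif_pos h]
  exact h.choose_spec

lemma condMeasure_eq_condLaw (hm : 0 < m) (hβ : 0 < β) {n : ℝ} (hn : 0 < n) :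
    condMeasure L m n β = condLaw L m n β :=
  isConditionalLaw_unique (isConditionalLaw_condMeasure hm hβ hn)
    (isConditionalLaw_condLaw hm hβ hn)

end Conditional

/-! ### Scaling of the conditional law. -/

section CondScaling

variable {L m β : ℝ} [hL : Fact (0 < L)]

lemma tailSq_smul (c : ℝ) (φ : PathSpace L) : tailSq L ((c : ℂ) • φ) = c ^ 2 * tailSq L φ := by
  rw [tailSq, tailSq, sqNorm_smul, coeff_smul, norm_mul, mul_pow, Complex.norm_real,
    Real.norm_eq_abs, sq_abs]
  ring

lemma resample_smul (c z : ℂ) (i : ℤ) (φ : PathSpace L) :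
    resample L i (c • φ) (c * z) = c • resample L i φ z := by
  rw [resample, resample, coeff_smul, smul_add, smul_smul, mul_sub]

lemma expDensity_scale (hβ : 0 < β) (θ s : ℝ) :
    expDensity (β * θ) (β⁻¹ * s) = β * expDensity θ s := by
  by_cases hs : 0 < s
  · have h1 : s ∈ Set.Ioi (0 : ℝ) := hs
    have h2 : β⁻¹ * s ∈ Set.Ioi (0 : ℝ) := by
      simp only [Set.mem_Ioi]; positivity
    rw [expDensity, expDensity, Set.indicator_of_mem h1, Set.indicator_of_mem h2]
    have : β * θ * (β⁻¹ * s) = θ * s := by field_simp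
    rw [this]
    ring
  · have h1 : s ∉ Set.Ioi (0 : ℝ) := hs
    have h2 : β⁻¹ * s ∉ Set.Ioi (0 : ℝ) := by
      simp only [Set.mem_Ioi, not_lt]
      exact mul_nonpos_of_nonneg_of_nonpos (by positivity) (not_lt.1 hs)
    rw [expDensity, expDensity, Set.indicator_of_notMem h1, Set.indicator_of_notMem h2, mul_zero]

lemma pathAngle_map_smul (hm : 0 < m) (hβ : 0 < β) :
    (pathAngle L m 1).map (fun q => ((((√β)⁻¹ : ℝ) : ℂ) • q.1, q.2)) = pathAngle L m β := by
  have := isProbabilityMeasure_gaussMeasure (L := L) hm one_pos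
  have h := Measure.map_prod_map (gaussMeasure L m 1) angLaw
    (continuous_smul_path (L := L) (((√β)⁻¹ : ℝ) : ℂ)).measurable measurable_id
  rw [gaussMeasure_one_map_smul hm hβ, Measure.map_id] at h
  exact h.symm

/-- Scaling a path by `β^{-1/2}` turns the explicit conditional path at `k` into the one at `β⁻¹ k`
and multiplies its weight by `β`, which the normalization removes. -/
lemma condLaw_map_smul (hm : 0 < m) (hβ : 0 < β) {k : ℝ} (hk : 0 < k) :
    (condLaw L m k 1).map (fun φ => (((√β)⁻¹ : ℝ) : ℂ) • φ) = condLaw L m (β⁻¹ * k) β := by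
  have := isProbabilityMeasure_condLaw (L := L) hm one_pos hk
  have := isProbabilityMeasure_condLaw (L := L) hm hβ (show 0 < β⁻¹ * k by positivity)
  have hsm := continuous_smul_path (L := L) (((√β)⁻¹ : ℝ) : ℂ)
  have := Measure.isProbabilityMeasure_map (μ := condLaw L m k 1) hsm.measurable.aemeasurable
  have hc2 : (√β)⁻¹ ^ 2 = β⁻¹ := by rw [inv_pow, Real.sq_sqrt hβ.le]
  have htail : ∀ φ : PathSpace L, β⁻¹ * k - tailSq L ((((√β)⁻¹ : ℝ) : ℂ) • φ) =
      β⁻¹ * (k - tailSq L φ) := fun φ => by rw [tailSq_smul, hc2]; ring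
  have hweight : ∀ q : PathSpace L × ℝ, condWeight L m β (β⁻¹ * k)
      ((((√β)⁻¹ : ℝ) : ℂ) • q.1, q.2) = β * condWeight L m 1 k q := by
    intro q
    have hθ : theta L m β 0 = β * theta L m 1 0 := by unfold theta; ring
    rw [condWeight, condWeight, htail, hθ, expDensity_scale hβ]
  have hpath : ∀ q : PathSpace L × ℝ, condPath L (β⁻¹ * k)
      ((((√β)⁻¹ : ℝ) : ℂ) • q.1, q.2) = (((√β)⁻¹ : ℝ) : ℂ) • condPath L k q := by
    intro q
    rw [condPath, condPath, htail, polarResample, polarResample, ← resample_smul]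
    simp only [radialPoint]
    rw [Real.sqrt_mul (by positivity), Real.sqrt_inv]
    push_cast
    rw [mul_assoc]
  have hmeas : Measurable fun q : PathSpace L × ℝ => ((((√β)⁻¹ : ℝ) : ℂ) • q.1, q.2) :=
    (hsm.measurable.comp measurable_fst).prodMk measurable_snd
  refine ext_of_forall_integral_eq_of_IsFiniteMeasure fun f => ?_
  have e1 : ∫ φ, f ((((√β)⁻¹ : ℝ) : ℂ) • φ) ∂condLaw L m k 1 =
      (∫ q, condWeight L m 1 k q ∂pathAngle L m 1)⁻¹ * ∫ q, condWeight L m 1 k q *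
        f ((((√β)⁻¹ : ℝ) : ℂ) • condPath L k q) ∂pathAngle L m 1 :=
    integral_condLaw hm one_pos k (f.compContinuous ⟨_, hsm⟩)
  have hw := measurable_condWeight (L := L) (m := m) (β := β) (β⁻¹ * k)
  have hwf : Measurable fun q : PathSpace L × ℝ =>
      condWeight L m β (β⁻¹ * k) q * f (condPath L (β⁻¹ * k) q) :=
    hw.mul (f.continuous.comp (continuous_condPath _)).measurable
  rw [integral_map hsm.measurable.aemeasurable f.continuous.aestronglyMeasurable, e1,
    integral_condLaw hm hβ, ← pathAngle_map_smul hm hβ,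
    integral_map hmeas.aemeasurable hw.aestronglyMeasurable,
    integral_map hmeas.aemeasurable hwf.aestronglyMeasurable]
  simp only [hweight, hpath, mul_assoc]
  rw [integral_const_mul, integral_const_mul]
  field_simp

/-- The two expressions for the canonical partition function agree. -/
lemma canonZReal_eq_canonZ (hm : 0 < m) (p : ℝ) {k : ℝ} (hk : 0 < k) (hβ : 0 < β) (lam : ℂ) :
    canonZReal L m p (β⁻¹ * k) β lam = canonZ L m p k β lam := by
  have hc : 0 < (√β)⁻¹ := inv_pos.2 (Real.sqrt_pos.2 hβ)
  have hβ' : (β : ℂ) ≠ 0 := by exact_mod_cast hβ.ne'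
  rw [canonZReal, canonZ, condMeasure_eq_condLaw hm hβ (by positivity),
    condMeasure_eq_condLaw hm one_pos hk, ← condLaw_map_smul hm hβ hk,
    (measurableEmbedding_smul hc).integral_map]
  congr 1
  · congr 1
    push_cast
    field_simp
  · refine integral_congr_ae (Eventually.of_forall fun φ => ?_)
    simp only [canonIntegrand]
    congr 1
    rw [pNormPow_smul hc.le, ofReal_cpow_one_sub_half hβ, ← mul_inv_sqrt_rpow hβ]
    push_cast
    ring

end CondScaling

/-! ### The canonical partition function. -/

section Canonical

variable {L m β : ℝ} [hL : Fact (0 < L)]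

lemma blockSum_update_zero_succ (X : ℤ → ℂ) (z : ℂ) (j : ℕ) :
    blockSum L (Function.update X 0 z) (j + 1) = blockSum L X (j + 1) := by
  refine Finset.sum_congr rfl fun k hk => ?_
  have hk0 : k ≠ 0 := by
    rintro rfl
    have := mem_block.1 hk
    simp at this
  rw [Function.update_of_ne hk0]

/-- Block 0 consists of the frequency 0 alone, so replacing that mode leaves every other block
unchanged. This transfers control from the Gaussian path to the conditioned one. -/
lemma expSum_update_zero_le (X : ℤ → ℂ) (z : ℂ) :
    expSum L m β (Function.update X 0 z) ≤
      ENNReal.ofReal (Real.exp (expRate L m β * (‖z‖ ^ 2 * L⁻¹)) * L) + expSum L m β X := by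
  unfold expSum
  rw [tsum_eq_zero_add' ENNReal.summable]
  simp only [blockSum_update_zero_succ]
  refine add_le_add ?_ (ENNReal.tsum_comp_le_tsum_of_injective (add_left_injective 1) _)
  have h : ∀ x, ‖blockSum L (Function.update X 0 z) 0 x‖ ^ 2 = ‖z‖ ^ 2 * L⁻¹ := by
    intro x
    rw [blockSum_apply, block_zero, Finset.sum_singleton, Function.update_self, norm_mul, mul_pow,
      norm_mode_sq, mul_comm]
  simp only [h, pow_zero, mul_one, inv_one, ENNReal.ofReal_one, one_mul]
  rw [lintegral_const, AddCircle.measure_univ, ENNReal.ofReal_mul (by positivity)]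

lemma exists_exponent {p : ℝ} (hp' : p < 6) : ∃ α : ℝ, 0 < α ∧ α < 1 / 2 ∧ p < 4 * α + 4 := by
  -- The midpoint of the admissible interval, which is nonempty because `p < 6`.
  refine ⟨(max 0 ((p - 4) / 4) + 1 / 2) / 2, ?_, ?_, ?_⟩
  · have := le_max_left 0 ((p - 4) / 4)
    linarith
  · have : max 0 ((p - 4) / 4) < 1 / 2 := max_lt (by norm_num) (by linarith)
    linarith
  · have h1 := le_max_right 0 ((p - 4) / 4)
    have h2 : max 0 ((p - 4) / 4) < 1 / 2 := max_lt (by norm_num) (by linarith)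
    linarith

/-- All exponential moments of the interaction are finite under the conditional law. -/
lemma integrable_exp_condLaw (hm : 0 < m) {p : ℝ} (hp : 2 < p) (hp' : p < 6) {k : ℝ}
    (hk : 0 < k) (A : ℝ) : Integrable (fun φ => Real.exp (A * pNormPow L p φ)) (condLaw L m k 1) := by
  have hprob := isProbabilityMeasure_pathAngle (L := L) hm one_pos
  have hprob' := isProbabilityMeasure_gaussMeasure (L := L) hm one_pos
  have hL0 := hL.out
  obtain ⟨α, hα, hα', hpα⟩ := exists_exponent hp'
  obtain ⟨C, hC, hkey⟩ := exists_mul_pNormPow_le (L := L) hm one_pos hp hα hα' hpα A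
  set e := (2 * α * p + 2) / (4 * α + 4 - p)
  have hcont : Continuous fun φ : PathSpace L => Real.exp (A * pNormPow L p φ) := by
    have := continuous_pNormPow (L := L) (show 0 ≤ p by linarith)
    fun_prop
  have hpos := integral_condWeight_pos (L := L) hm one_pos hk
  have hmass : (∫⁻ q, ENNReal.ofReal (condWeight L m 1 k q) ∂pathAngle L m 1) ≠ 0 := by
    rw [← ofReal_integral_eq_lintegral_ofReal (integrable_condWeight hm one_pos k)
      (Eventually.of_forall (condWeight_nonneg hm one_pos k))]
    simpa using hpos
  have hw1 : Measurable fun q => ENNReal.ofReal (condWeight L m 1 k q) :=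
    ENNReal.measurable_ofReal.comp (measurable_condWeight k)
  have hw2 : Measurable fun q => ENNReal.ofReal
      (((fun φ => Real.exp (A * pNormPow L p φ)) ∘ condPath L k) q) :=
    ENNReal.measurable_ofReal.comp (hcont.comp (continuous_condPath k)).measurable
  rw [condLaw, integrable_map_measure hcont.aestronglyMeasurable
    (continuous_condPath k).measurable.aemeasurable]
  refine Integrable.smul_measure ?_ (ENNReal.inv_ne_top.2 hmass)
  refine ⟨(hcont.comp (continuous_condPath k)).aestronglyMeasurable, ?_⟩
  rw [hasFiniteIntegral_iff_ofReal (Eventually.of_forall fun _ => by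
      simp only [Pi.zero_apply, Function.comp_apply]; positivity),
    lintegral_withDensity_eq_lintegral_mul _ hw1 hw2]
  set B := ENNReal.ofReal (Real.exp (expRate L m 1 * (k * L⁻¹)) * L)
  set θ := theta L m 1 0
  have hθ : 0 < θ := theta_pos hm one_pos 0
  -- The weight is bounded and the particle number equals `k` wherever the weight is nonzero, so the
  -- power of `N` in the interpolation bound becomes a constant. What remains is affine in `expSum`
  -- of the unconditioned path.
  have hle : ∀ᵐ q ∂pathAngle L m 1, ENNReal.ofReal (condWeight L m 1 k q) *
      ENNReal.ofReal (Real.exp (A * pNormPow L p (condPath L k q))) ≤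
      ENNReal.ofReal (θ / 2) * (ENNReal.ofReal (Real.exp (C * k ^ e)) *
        (ENNReal.ofReal (Real.exp 1) * (1 + (B + expSum L m 1 (coeff L q.1))))) := by
    have hfin : ∀ᵐ q ∂pathAngle L m 1, expSum L m 1 (coeff L q.1) ≠ ⊤ :=
      Measure.quasiMeasurePreserving_fst.ae (ae_expSum_coeff_ne_top (L := L) hm one_pos)
    filter_upwards [hfin] with q hq
    by_cases hs : 0 < k - tailSq L q.1
    · have hsq : sqNorm L (condPath L k q) = k := by
        rw [condPath, sqNorm_polarResample q hs.le]; ring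
      have hz : ‖radialPoint (k - tailSq L q.1) q.2‖ ^ 2 ≤ k := by
        rw [norm_radialPoint_sq hs.le]; linarith [tailSq_nonneg q.1]
      have hY : expSum L m 1 (coeff L (condPath L k q)) ≤ B + expSum L m 1 (coeff L q.1) := by
        rw [condPath, polarResample, coeff_resample]
        refine (expSum_update_zero_le _ _).trans ?_
        have := expRate_pos (L := L) hm one_pos
        gcongr
        simp only [B]
        gcongr
      have hYfin : expSum L m 1 (coeff L (condPath L k q)) ≠ ⊤ :=
        ne_top_of_le_ne_top (ENNReal.add_ne_top.2 ⟨ENNReal.ofReal_ne_top, hq⟩) hY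
      have h1 := hkey _ hYfin
      rw [hsq] at h1
      gcongr
      · exact expDensity_le hθ _
      · calc ENNReal.ofReal (Real.exp (A * pNormPow L p (condPath L k q)))
            ≤ ENNReal.ofReal (Real.exp (C * k ^ e) *
                Real.exp (1 + logSum L m 1 (coeff L (condPath L k q)))) := by
              rw [← Real.exp_add, add_comm (C * k ^ e)]
              gcongr
          _ ≤ _ := by
              rw [ENNReal.ofReal_mul (by positivity), exp_one_add_logSum hYfin]
              gcongr
    -- Here `condPath` uses `√` at a nonpositive argument, so its default value 0 may enter; the
    -- zero weight makes it irrelevant.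
    · have h0 : condWeight L m 1 k q = 0 := by
        have h1 : k - tailSq L q.1 ∉ Set.Ioi (0 : ℝ) := hs
        rw [condWeight, expDensity, Set.indicator_of_notMem h1]
      rw [h0]
      simp
  refine (lintegral_mono_ae hle).trans_lt ?_
  have hmeas : Measurable fun q : PathSpace L × ℝ => expSum L m 1 (coeff L q.1) :=
    measurable_expSum.comp (continuous_coeff.measurable.comp measurable_fst)
  rw [lintegral_const_mul' _ _ ENNReal.ofReal_ne_top, lintegral_const_mul' _ _ ENNReal.ofReal_ne_top,
    lintegral_const_mul' _ _ ENNReal.ofReal_ne_top, lintegral_add_left measurable_const,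
    lintegral_add_left measurable_const, lintegral_const, lintegral_const, measure_univ]
  have hY : ∫⁻ q, expSum L m 1 (coeff L q.1) ∂pathAngle L m 1 < ⊤ := by
    rw [pathAngle, lintegral_prod _ hmeas.aemeasurable]
    simpa using lintegral_expSum_coeff_lt_top (L := L) hm one_pos
  refine ENNReal.mul_lt_top ENNReal.ofReal_lt_top (ENNReal.mul_lt_top ENNReal.ofReal_lt_top
    (ENNReal.mul_lt_top ENNReal.ofReal_lt_top (ENNReal.add_lt_top.2 ⟨by simp,
      ENNReal.add_lt_top.2 ⟨?_, hY⟩⟩)))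
  simp [B]

lemma integrable_exp_condMeasure (hm : 0 < m) {p : ℝ} (hp : 2 < p) (hp' : p < 6) {k : ℝ}
    (hk : 0 < k) (A : ℝ) :
    Integrable (fun φ => Real.exp (A * pNormPow L p φ)) (condMeasure L m k 1) := by
  rw [condMeasure_eq_condLaw hm one_pos hk]
  exact integrable_exp_condLaw hm hp hp' hk A

lemma integrable_canonIntegrand (hm : 0 < m) {p : ℝ} (hp : 2 < p) (hp' : p < 6) {k : ℝ}
    (hk : 0 < k) (β lam : ℂ) : Integrable (canonIntegrand L p β lam) (condMeasure L m k 1) := by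
  have hP := continuous_pNormPow (L := L) (show 0 ≤ p by linarith)
  have hcont : Continuous (canonIntegrand L p β lam) := by
    unfold canonIntegrand
    fun_prop
  rw [← integrable_norm_iff hcont.aestronglyMeasurable]
  refine (integrable_exp_condMeasure hm hp hp' hk (β ^ (1 - p / 2 : ℂ) * lam / p).re).congr
    (Eventually.of_forall fun φ => ?_)
  simp only [canonIntegrand, Complex.norm_exp, Complex.re_mul_ofReal]

/-- The moment generating function of the interaction under the conditional law. -/
def condMGF (L m : ℝ) [Fact (0 < L)] (p k : ℝ) (a : ℂ) : ℂ :=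
  ∫ φ, Complex.exp (((pNormPow L p φ : ℂ) • ContinuousLinearMap.id ℂ ℂ) a) * 1 ∂condMeasure L m k 1

/-- Exponential moments of every order are finite, so any radius works and no sign condition on the
coupling is needed. -/
lemma analyticAt_condMGF (hm : 0 < m) {p : ℝ} (hp : 2 < p) (hp' : p < 6) {k : ℝ} (hk : 0 < k)
    (a : ℂ) : AnalyticAt ℂ (condMGF L m p k) a := by
  have hP := continuous_pNormPow (L := L) (show 0 ≤ p by linarith)
  refine analyticAt_integral_exp (R := 1) (Continuous.aestronglyMeasurable (by fun_prop))
    aestronglyMeasurable_const a one_pos ?_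
  refine (integrable_exp_condMeasure hm hp hp' hk (1 + a.re)).congr
    (Eventually.of_forall fun φ => ?_)
  simp only
  rw [mul_one, Complex.norm_exp, ← Real.exp_add, norm_smul, ContinuousLinearMap.norm_id,
    Complex.norm_real, Real.norm_eq_abs, abs_of_nonneg (pNormPow_nonneg p φ)]
  congr 1
  simp
  ring

lemma canonZ_eq_condMGF (p k : ℝ) (β lam : ℂ) :
    canonZ L m p k β lam =
      Complex.exp (m ^ 2 * k / 2) * condMGF L m p k (β ^ (1 - p / 2 : ℂ) * lam / p) := by
  rw [canonZ, condMGF]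
  congr 1
  refine integral_congr_ae (Eventually.of_forall fun φ => ?_)
  simp [canonIntegrand, mul_comm]

lemma analyticAt_canonZ (hm : 0 < m) {p : ℝ} (hp : 2 < p) (hp' : p < 6) {k : ℝ} (hk : 0 < k)
    {z : ℂ × ℂ} (hz : 0 < z.1.re) :
    AnalyticAt ℂ (fun z : ℂ × ℂ => canonZ L m p k z.1 z.2) z := by
  simp only [canonZ_eq_condMGF]
  have ha : AnalyticAt ℂ (fun z : ℂ × ℂ => z.1 ^ (1 - p / 2 : ℂ) * z.2 / p) z :=
    ((analyticAt_cpow_const analyticAt_fst hz _).mul analyticAt_snd).div_const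
  exact analyticAt_const.mul (AnalyticAt.fun_comp (analyticAt_condMGF hm hp hp' hk _) ha)

lemma canonZ_ofReal_mem_slitPlane (hm : 0 < m) {p : ℝ} (hp : 2 < p) (hp' : p < 6) {k b : ℝ}
    (hk : 0 < k) (hb : 0 < b) (l : ℝ) : canonZ L m p k b l ∈ Complex.slitPlane := by
  have hprob := (isConditionalLaw_condMeasure (L := L) hm one_pos hk).1
  have hint := integrable_exp_condMeasure (L := L) hm hp hp' hk (b ^ (1 - p / 2) * l / p)
  have e : canonZ L m p k b l = ((Real.exp (m ^ 2 * k / 2) *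
      ∫ φ, Real.exp (b ^ (1 - p / 2) * l / p * pNormPow L p φ) ∂condMeasure L m k 1 : ℝ) : ℂ) := by
    rw [canonZ, Complex.ofReal_mul, ← integral_complex_ofReal]
    congr 1
    · push_cast; rfl
    · refine integral_congr_ae (Eventually.of_forall fun φ => ?_)
      simp only [canonIntegrand, ofReal_cpow_one_sub_half hb]
      push_cast
      rfl
  rw [e, Complex.ofReal_mem_slitPlane]
  exact mul_pos (Real.exp_pos _) (integral_exp_pos hint)

/-- Same component argument as in `grand_canonical`; the fixed particle number replaces the cutoff,
so `Re β > 0` is the only convergence constraint imposed. -/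
lemma canonical (hm : 0 < m) {p : ℝ} (hp : 2 < p) (hp' : p < 6) {k : ℝ} (hk : 0 < k) :
    ∃ D : Set (ℂ × ℂ), IsOpen D ∧ IsConnected D ∧
      (∀ b l : ℝ, 0 < b → ∃ ε : ℝ, 0 < ε ∧ ∀ β lam : ℂ,
        β.re = b → lam.re = l → |β.im| < ε → |lam.im| < ε → (β, lam) ∈ D) ∧
      (∀ β lam : ℂ, (β, lam) ∈ D →
        0 < β.re ∧ Integrable (canonIntegrand L p β lam) (condMeasure L m k 1) ∧
        canonZ L m p k β lam ∈ Complex.slitPlane) ∧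
      AnalyticOnNhd ℂ (fun z : ℂ × ℂ => Complex.log (canonZ L m p k z.1 z.2)) D := by
  set U : Set (ℂ × ℂ) := {z | 0 < z.1.re} with hUdef
  have hU : IsOpen U := isOpen_lt continuous_const (by fun_prop)
  set Z := fun z : ℂ × ℂ => canonZ L m p k z.1 z.2 with hZdef
  have hZ : ∀ z ∈ U, AnalyticAt ℂ Z z := fun z hz => analyticAt_canonZ hm hp hp' hk hz
  have hO : IsOpen (U ∩ Z ⁻¹' Complex.slitPlane) :=
    ContinuousOn.isOpen_inter_preimage (fun z hz => (hZ z hz).continuousAt.continuousWithinAt) hU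
      Complex.isOpen_slitPlane
  set S : Set (ℂ × ℂ) := (fun q : ℝ × ℝ => ((q.1 : ℂ), (q.2 : ℂ))) '' (Set.Ioi 0 ×ˢ Set.univ)
  have hS : IsConnected S := by
    refine IsConnected.image ?_ _ (by fun_prop)
    exact Convex.isConnected ((convex_Ioi 0).prod convex_univ) ⟨(1, 1), by simp⟩
  have hSO : S ⊆ U ∩ Z ⁻¹' Complex.slitPlane := by
    rintro _ ⟨⟨b, l⟩, ⟨hb, -⟩, rfl⟩
    exact ⟨by simpa [hUdef] using hb, canonZ_ofReal_mem_slitPlane hm hp hp' hk hb l⟩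
  obtain ⟨D, hDO, hDo, hDc, hball⟩ := exists_domain hO hS hSO
  refine ⟨D, hDo, hDc, fun b l hb => ?_, fun β lam hz => ?_, fun z hz => ?_⟩
  · obtain ⟨ε, hε, h⟩ := hball (b, l) ⟨(b, l), ⟨hb, trivial⟩, rfl⟩
    refine ⟨ε, hε, fun β lam h1 h2 h3 h4 => h ?_⟩
    subst h1 h2
    rw [Metric.mem_ball, Prod.dist_eq, max_lt_iff]
    exact ⟨dist_re_lt_of_abs_im_lt h3, dist_re_lt_of_abs_im_lt h4⟩
  · exact ⟨(hDO hz).1, integrable_canonIntegrand hm hp hp' hk β lam, (hDO hz).2⟩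
  · exact (hZ z (hDO hz).1).clog (hDO hz).2

end Canonical

end

end NLSGibbs

theorem mainTheorem4 (L m p : ℝ) [Fact (0 < L)] (hm : 0 < m) (hp : 2 < p) (hp' : p < 6) :
    -- the reference measures are probability measures on the path space
    (∀ β : ℝ, 0 < β → IsProbabilityMeasure (NLSGibbs.gaussMeasure L m β)) ∧
    -- grand-canonical ensemble
    (∀ α r : ℝ, 0 < α → α < 1 / 2 → p < 4 * α + 4 →
      (2 * α * p + 2) / (4 * α + 4 - p) < r →
      (∀ (κ : ℂ) (β : ℝ) (lam : ℂ), 0 < β →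
        NLSGibbs.grandZReal L m p r κ β lam = NLSGibbs.grandZ L m p r κ β lam) ∧
      ∃ D : Set (ℂ × ℂ × ℂ), IsOpen D ∧ IsConnected D ∧
        (∀ k b l : ℝ, 0 < k → 0 < b → ∃ ε : ℝ, 0 < ε ∧ ∀ κ β lam : ℂ,
          κ.re = k → β.re = b → lam.re = l → |κ.im| < ε → |β.im| < ε → |lam.im| < ε →
            (κ, β, lam) ∈ D) ∧
        (∀ κ β lam : ℂ, (κ, β, lam) ∈ D →
          0 < β.re ∧ 0 < (β ^ (1 - r : ℂ) * κ).re ∧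
          MeasureTheory.Integrable (NLSGibbs.grandIntegrand L m p r κ β lam)
            (NLSGibbs.gaussMeasure L m 1) ∧
          NLSGibbs.grandZ L m p r κ β lam ∈ Complex.slitPlane) ∧
        AnalyticOnNhd ℂ
          (fun z : ℂ × ℂ × ℂ => Complex.log (NLSGibbs.grandZ L m p r z.1 z.2.1 z.2.2)) D) ∧
    -- canonical ensemble
    (∀ n β : ℝ, 0 < n → 0 < β →
      NLSGibbs.IsConditionalLaw L m n β (NLSGibbs.condMeasure L m n β)) ∧
    (∀ k : ℝ, 0 < k →
      (∀ (β : ℝ) (lam : ℂ), 0 < β →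
        NLSGibbs.canonZReal L m p (β⁻¹ * k) β lam = NLSGibbs.canonZ L m p k β lam) ∧
      ∃ D : Set (ℂ × ℂ), IsOpen D ∧ IsConnected D ∧
        (∀ b l : ℝ, 0 < b → ∃ ε : ℝ, 0 < ε ∧ ∀ β lam : ℂ,
          β.re = b → lam.re = l → |β.im| < ε → |lam.im| < ε → (β, lam) ∈ D) ∧
        (∀ β lam : ℂ, (β, lam) ∈ D →
          0 < β.re ∧
          MeasureTheory.Integrable (NLSGibbs.canonIntegrand L p β lam)
            (NLSGibbs.condMeasure L m k 1) ∧
          NLSGibbs.canonZ L m p k β lam ∈ Complex.slitPlane) ∧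
        AnalyticOnNhd ℂ
          (fun z : ℂ × ℂ => Complex.log (NLSGibbs.canonZ L m p k z.1 z.2)) D) := by
  refine ⟨fun β hβ => NLSGibbs.isProbabilityMeasure_gaussMeasure hm hβ,
    fun α r hα hα' hpα hr => ⟨fun κ β lam hβ => NLSGibbs.grandZReal_eq_grandZ hm p r κ hβ lam,
      NLSGibbs.grand_canonical hm hp hα hα' hpα hr⟩,
    fun n β hn hβ => NLSGibbs.isConditionalLaw_condMeasure hm hβ hn,
    fun k hk => ⟨fun β lam hβ => NLSGibbs.canonZReal_eq_canonZ hm p hk hβ lam,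
      NLSGibbs.canonical hm hp hp' hk⟩⟩
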